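/- Let $n\ge m\ge 1$ be integers, let $\mathbb L$ be $\mathbb R$ or $\mathbb C$, and put $\beta=1$ if $\mathbb L=\mathbb R$ and $\beta=2$ if $\mathbb L=\mathbb C$. Let $W\sim W_m(n,I_m)$, that is, $W$ is a random $m\times m$ matrix with the law of $H^\dagger H$, where $H\in\mathbb L^{n\times m}$ has i.i.d. Gaussian entries with mean zero and unit variance (circularly symmetric if $\mathbb L=\mathbb C$). Let $\lambda_1\ge\lambda_2\ge\cdots\ge\lambda_m\ge 0$ be the ordered eigenvalues of $W$. For $1\le i\le m$ define $$ \zeta_i=\frac{\displaystyle\int_{S_m} x_i\,\prod_{j=1}^m x_j^{\frac{\beta}{2}(n-m+1)-1}\,|\Delta_m(x)|^{\beta}\,d\sigma(x)}{\displaystyle\int_{S_m}\prod_{j=1}^m x_j^{\frac{\beta}{2}(n-m+1)-1}\,|\Delta_m(x)|^{\beta}\,d\sigma(x)},\qquad |\Delta_m(x)|=\prod_{1\le k<j\le m}|x_k-x_j| , $$ where $S_m=\{x\in\mathbb R^m:\ x_1\ge\cdots\ge x_m\ge 0,\ \sum_{j=1}^m x_j=1\}$ and $d\sigma=dx_1\cdots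 dx_{m-1}$ is Lebesgue measure on the hyperplane $\sum_j x_j=1$ in the coordinates $x_1,\dots,x_{m-1}$ (a unit point mass if $m=1$). Then both integrals converge, the denominator is positive, and each $\lambda_i$ is integrable and satisfies $$ \mathrm E\Big[\lambda_i\,\Big|\,\sum_{j=1}^m\lambda_j=c\Big]=\zeta_i\,c\qquad\text{for every } c>0 , $$ so the ratio of the conditional expectation to the trace $c$ does not depend on $c$. Here the conditional expectation is understood in both usual senses: $\mathrm E\big[\lambda_i\mid\sum_j\lambda_j\big]=\zeta_i\sum_j\lambda_j$ almost surely, and, for every $c>0$, the event $\big|\sum_j\lambda_j-c\big|<\varepsilon$ has positive probability for all $\varepsilon>0$ and $\mathrm E\big[\lambda_i\,\big|\,\big|\sum_j\lambda_j-c\big|<\varepsilon\big]\to\zeta_i\,c$ as $\varepsilon\downarrow 0$. -/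

import Mathlib

open MeasureTheory ProbabilityTheory Filter Topology
open scoped Matrix NNReal

namespace Wishart

noncomputable section

/-- Matrices carry the product (entrywise) measurable structure. -/
instance matrixMeasurableSpace {ι κ 𝕜 : Type*} [MeasurableSpace 𝕜] :
    MeasurableSpace (Matrix ι κ 𝕜) :=
  inferInstanceAs (MeasurableSpace (ι → κ → 𝕜))

/-! ### Gaussian entries and the Wishart distribution -/

/-- The real Gaussian law with mean zero and variance one. -/
def realEntry : Measure ℝ := gaussianReal 0 1

/-- The circularly symmetric complex Gaussian law with mean zero and unit variance: real and
imaginary parts are independent, centred Gaussian with variance `1 / 2` each. -/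
def complexEntry : Measure ℂ :=
  ((gaussianReal 0 (1 / 2 : ℝ≥0)).prod (gaussianReal 0 (1 / 2 : ℝ≥0))).map
    (fun p : ℝ × ℝ => (⟨p.1, p.2⟩ : ℂ))

/-- The law of an `n × m` matrix with i.i.d. entries of law `ν`. -/
def iidEntries {𝕜 : Type*} [RCLike 𝕜] [MeasurableSpace 𝕜] (ν : Measure 𝕜) (n m : ℕ) :
    Measure (Matrix (Fin n) (Fin m) 𝕜) :=
  (Measure.pi fun _ : Fin n => Measure.pi fun _ : Fin m => ν).map
    (fun x : Fin n → Fin m → 𝕜 => Matrix.of x)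

/-- The law of `Hᴴ * H` where `H` is an `n × m` matrix with i.i.d. entries of law `ν`. -/
def gramLaw {𝕜 : Type*} [RCLike 𝕜] [MeasurableSpace 𝕜] (ν : Measure 𝕜) (n m : ℕ) :
    Measure (Matrix (Fin m) (Fin m) 𝕜) :=
  (iidEntries ν n m).map (fun H => Hᴴ * H)

/-- The real Wishart distribution `W_m(n, I_m)`. -/
def realWishart (n m : ℕ) : Measure (Matrix (Fin m) (Fin m) ℝ) := gramLaw realEntry n m

/-- The complex Wishart distribution `W_m(n, I_m)`. -/
def complexWishart (n m : ℕ) : Measure (Matrix (Fin m) (Fin m) ℂ) := gramLaw complexEntry n m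

/-! ### Ordered eigenvalues -/

open Classical in
/-- The `i`-th eigenvalue of a Hermitian matrix, eigenvalues being listed in nonincreasing order
with multiplicity (and `0` for a matrix that is not Hermitian). -/
def eig {𝕜 : Type*} [RCLike 𝕜] {m : ℕ} (A : Matrix (Fin m) (Fin m) 𝕜) (i : Fin m) : ℝ :=
  if h : A.IsHermitian then h.eigenvalues₀ (Fin.cast (Fintype.card_fin m).symm i) else 0

/-- The sum of the eigenvalues of a matrix. -/
def eigSum {𝕜 : Type*} [RCLike 𝕜] {m : ℕ} (A : Matrix (Fin m) (Fin m) 𝕜) : ℝ := ∑ i, eig A i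

/-- For a Hermitian matrix the sum of the ordered eigenvalues is the trace. -/
theorem eigSum_eq_trace {𝕜 : Type*} [RCLike 𝕜] {m : ℕ} (A : Matrix (Fin m) (Fin m) 𝕜)
    (hA : A.IsHermitian) : ((eigSum A : ℝ) : 𝕜) = A.trace := by
  rw [hA.trace_eq_sum_eigenvalues]
  unfold eigSum
  push_cast
  simp only [eig, dif_pos hA, Matrix.IsHermitian.eigenvalues]
  exact Fintype.sum_equiv
    ((finCongr (Fintype.card_fin m).symm).trans (Fintype.equivOfCardEq (Fintype.card_fin _)))
    _ _ (fun i => by simp)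

/-! ### Integration over the ordered simplex -/

/-- The point of the hyperplane `∑ x_j = 1` with given first `m - 1` coordinates. -/
def simplexPoint (m : ℕ) (x : Fin (m - 1) → ℝ) : Fin m → ℝ := fun j =>
  if h : (j : ℕ) < m - 1 then x ⟨j, h⟩ else 1 - ∑ k, x k

theorem measurable_simplexPoint (m : ℕ) : Measurable (simplexPoint m) := by
  refine measurable_pi_lambda _ fun j => ?_
  unfold simplexPoint
  split_ifs <;> fun_prop

/-- Lebesgue measure on the hyperplane `∑ x_j = 1`, in the coordinates `x_1, …, x_{m-1}`
(a point mass if `m = 1`). -/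
def hyperplaneMeasure (m : ℕ) : Measure (Fin m → ℝ) :=
  Measure.map (simplexPoint m) volume

/-- The points `x_1 ≥ ⋯ ≥ x_m ≥ 0` with `∑ x_j = 1`. -/
def orderedSimplex (m : ℕ) : Set (Fin m → ℝ) :=
  {x | Antitone x ∧ (∀ j, 0 ≤ x j) ∧ ∑ j, x j = 1}

/-- The weight `∏ x_j ^ (β / 2 * (n - m + 1) - 1) * |Δ_m(x)| ^ β`. -/
def weight (β : ℝ) (n m : ℕ) (x : Fin m → ℝ) : ℝ :=
  (∏ j, x j ^ (β / 2 * ((n : ℝ) - m + 1) - 1)) *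
    |∏ i, ∏ j ∈ Finset.Ioi i, (x i - x j)| ^ β

/-- The normalising integral of the weight over the ordered simplex. -/
def zetaDen (β : ℝ) (n m : ℕ) : ℝ :=
  ∫ x in orderedSimplex m, weight β n m x ∂hyperplaneMeasure m

/-- The integral of the `i`-th coordinate against the weight over the ordered simplex. -/
def zetaNum (β : ℝ) (n m : ℕ) (i : Fin m) : ℝ :=
  ∫ x in orderedSimplex m, x i * weight β n m x ∂hyperplaneMeasure m

/-- The constant `ζ_i`. -/
def zeta (β : ℝ) (n m : ℕ) (i : Fin m) : ℝ := zetaNum β n m i / zetaDen β n m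

/-- The integrals in the definition of `ζ_i` converge and the denominator is positive. -/
def ZetaWellDefined (β : ℝ) (n m : ℕ) (i : Fin m) : Prop :=
  IntegrableOn (weight β n m) (orderedSimplex m) (hyperplaneMeasure m) ∧
  IntegrableOn (fun x => x i * weight β n m x) (orderedSimplex m) (hyperplaneMeasure m) ∧
  0 < zetaDen β n m

/-! ### Conditioning on the value of a random variable -/

/-- `E[X | T = c] = r` at an individual value `c`: the events `|T - c| < ε` have positive
probability, and the conditional expectations of `X` given them tend to `r` as `ε → 0`. -/
def CondMeanAt {Ω : Type*} [MeasurableSpace Ω] (μ : Measure Ω) (X T : Ω → ℝ) (c r : ℝ) : Prop :=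
  (∀ ε : ℝ, 0 < ε → 0 < μ {ω | |T ω - c| < ε}) ∧
  Tendsto (fun ε : ℝ => ∫ ω, X ω ∂(cond μ {ω | |T ω - c| < ε})) (𝓝[>] 0) (𝓝 r)

end

end Wishart

/-! Write W = H†H, T = tr W and p_k = tr W^k, the k-th power sum of the eigenvalues. The joint
density of the eigenvalues is not derived by a change of variables on matrices; it is identified
only through the expectations of products of the p_k. Put d = n - m and ε = 2/β - 1, so that ε = 1
in the real case and ε = 0 in the complex case. Gaussian integration by parts in the entries of H
expresses E[p_{j+1} Q], for Q a product of power sums, through (d + εj) p_j Q, the sum of the p_r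
p_{j-r} Q, and (1 + ε) times the action on Q of the vector field sending p_l to l p_{j+l}. These are
the `LoopEquations`. Together with p_0 = m they determine every expectation from E[1]
(`LoopEquations.unique`). The density ∏ x_j^α e^{-βx_j/2} |Δ(x)|^β on the ordered cone, with α = β/2
(n-m+1) - 1, satisfies the same recursion: integrate by parts against the fields x_i^{j+1} Q ∂_i and
symmetrise the singular terms (`coneIntegral_loopEquations`). Hence both laws have proportional
moments (`GaussianEntry.exists_integral_eq`). The passage from moments to laws takes place on a
compact set. The Gaussian density depends only on T = ‖H‖², so T is independent of every bounded
scale invariant function of H, in particular of functions of the shares λ/T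
(`lintegral_mul_eq_of_scale_invariant`). On the other side, homogeneity separates the radial
variable from the simplex (`lintegral_coneDensity_of_homogeneous`). Dividing out the radial factors,
the shares have the moments of the normalised weight on the ordered simplex. Power sums separate
ordered vectors, so by Stone–Weierstrass the barycentres agree, that is E[λ_i/T] = ζ_i
(`GaussianEntry.integral_eigShare`). Finally E[g(T) λ_i] = E[g(T) T · λ_i/T] = ζ_i E[g(T) T] for
every measurable g ≥ 0, and both forms of the conditional expectation follow. -/

namespace Wishart

/-! ### Loop equations and their uniqueness -/

noncomputable section

open MvPolynomial

/-- The derivation of `ℝ[y₀, y₁, …]` with `y_l ↦ l * y_{j + l}`: the action of the vector field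
`∑ i, x_i ^ (j + 1) ∂_i` on power sums. -/
def powerShift (j : ℕ) : Derivation ℝ (MvPolynomial ℕ ℝ) (MvPolynomial ℕ ℝ) :=
  mkDerivation ℝ fun l => C (l : ℝ) * X (j + l)

theorem powerShift_X (j l : ℕ) : powerShift j (X l) = C (l : ℝ) * X (j + l) :=
  mkDerivation_X ..

/-- The product of the variables with indices in a list. -/
def listMon (l : List ℕ) : MvPolynomial ℕ ℝ := (l.map X).prod

/-- The recursion satisfied by the expectations of products of power sums. -/
structure LoopEquations {F : Type*} [AddCommGroup F] [Module ℝ F] (m : ℕ) (d ε : ℝ)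
    (L : MvPolynomial ℕ ℝ →ₗ[ℝ] F) : Prop where
  zero : ∀ Q, L (X 0 * Q) = (m : ℝ) • L Q
  succ : ∀ (j : ℕ) (l : List ℕ), L (X (j + 1) * listMon l) =
    L (C (d + ε * j) * (X j * listMon l)
      + ∑ r ∈ Finset.range (j + 1), X r * X (j - r) * listMon l
      + C (1 + ε) * powerShift j (listMon l))

/-- The weight of a list of indices used in the induction. -/
def listWeight (l : List ℕ) : ℕ := (l.map fun k => 2 * k + 1).sum

/-- The span of the monomials of weight at most `N`. -/
def lowWeight (N : ℕ) : Submodule ℝ (MvPolynomial ℕ ℝ) :=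
  Submodule.span ℝ {p | ∃ l, listWeight l ≤ N ∧ p = listMon l}

theorem listMon_mem_lowWeight {l : List ℕ} {N : ℕ} (h : listWeight l ≤ N) :
    listMon l ∈ lowWeight N := Submodule.subset_span ⟨l, h, rfl⟩

theorem C_mul_mem_lowWeight {p : MvPolynomial ℕ ℝ} {N : ℕ} (c : ℝ) (h : p ∈ lowWeight N) :
    C c * p ∈ lowWeight N := by
  rw [C_mul']; exact Submodule.smul_mem _ _ h

theorem X_mul_mem_lowWeight {p : MvPolynomial ℕ ℝ} {N k : ℕ} (h : p ∈ lowWeight N) :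
    X k * p ∈ lowWeight (N + (2 * k + 1)) := by
  induction h using Submodule.span_induction with
  | mem x hx =>
    obtain ⟨l, hl, rfl⟩ := hx
    have : (X k * listMon l : MvPolynomial ℕ ℝ) = listMon (k :: l) := by simp [listMon]
    rw [this]
    refine listMon_mem_lowWeight ?_
    simp only [listWeight, List.map_cons, List.sum_cons] at hl ⊢
    omega
  | zero => simp
  | add x y _ _ hx hy => rw [mul_add]; exact Submodule.add_mem _ hx hy
  | smul a x _ hx => rw [mul_smul_comm]; exact Submodule.smul_mem _ _ hx

theorem lowWeight_mono {M N : ℕ} (h : M ≤ N) : lowWeight M ≤ lowWeight N :=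
  Submodule.span_mono fun _ ⟨l, hl, e⟩ => ⟨l, hl.trans h, e⟩

/-- By the Leibniz rule each term replaces one index k by j + k, which raises the weight by 2j. -/
theorem powerShift_listMon_mem (j : ℕ) (l : List ℕ) :
    powerShift j (listMon l) ∈ lowWeight (listWeight l + 2 * j) := by
  induction l with
  | nil => simp [listMon]
  | cons k l ih =>
    have h1 : (listMon (k :: l) : MvPolynomial ℕ ℝ) = X k * listMon l := by simp [listMon]
    have h2 : listWeight (k :: l) = 2 * k + 1 + listWeight l := by simp [listWeight]
    rw [h1, h2, Derivation.leibniz, powerShift_X, smul_eq_mul, smul_eq_mul]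
    refine Submodule.add_mem _ (lowWeight_mono (by omega) (X_mul_mem_lowWeight ih)) ?_
    rw [show listMon l * (C (k : ℝ) * X (j + k)) = C (k : ℝ) * (X (j + k) * listMon l) by ring]
    exact C_mul_mem_lowWeight _ (lowWeight_mono (by omega)
      (X_mul_mem_lowWeight (listMon_mem_lowWeight le_rfl)))

theorem exists_mem_lowWeight (p : MvPolynomial ℕ ℝ) : ∃ N, p ∈ lowWeight N := by
  induction p using MvPolynomial.induction_on with
  | C a =>
    refine ⟨0, ?_⟩
    rw [← mul_one (C a)]
    exact C_mul_mem_lowWeight a (listMon_mem_lowWeight (l := []) (by simp [listWeight]))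
  | add p q hp hq =>
    obtain ⟨M, hM⟩ := hp
    obtain ⟨N, hN⟩ := hq
    exact ⟨max M N, Submodule.add_mem _ (lowWeight_mono (le_max_left _ _) hM)
      (lowWeight_mono (le_max_right _ _) hN)⟩
  | mul_X p n hp =>
    obtain ⟨M, hM⟩ := hp
    exact ⟨_, mul_comm p (X n) ▸ X_mul_mem_lowWeight hM⟩

/-- Used to compare functionals on products of power sums alone. Unlike general polynomials these
are homogeneous, and nonnegative on the cone, so they can be handled with lower Lebesgue integrals.
-/
theorem linearMap_ext_listMon {F : Type*} [AddCommGroup F] [Module ℝ F]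
    {L₁ L₂ : MvPolynomial ℕ ℝ →ₗ[ℝ] F} (h : ∀ l, L₁ (listMon l) = L₂ (listMon l)) : L₁ = L₂ := by
  refine LinearMap.ext fun p => ?_
  obtain ⟨N, hN⟩ := exists_mem_lowWeight p
  have : lowWeight N ≤ LinearMap.eqLocus L₁ L₂ :=
    Submodule.span_le.2 fun _ ⟨l, _, e⟩ => e ▸ h l
  exact this hN

/-- The loop equations and the value at `1` determine a linear functional. -/
theorem LoopEquations.unique {F : Type*} [AddCommGroup F] [Module ℝ F] {m : ℕ} {d ε : ℝ}
    {L₁ L₂ : MvPolynomial ℕ ℝ →ₗ[ℝ] F} (h₁ : LoopEquations m d ε L₁) (h₂ : LoopEquations m d ε L₂)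
    (h : L₁ 1 = L₂ 1) : L₁ = L₂ := by
  -- Induction on the weight. Removing X_0 lowers it by 1. The recursion trades X_{j+1}, of weight
  -- 2j + 3, for X_j (2j + 1), for X_r X_{j-r} (2j + 2), or for a shift of the rest (2j). The extra
  -- 1 per factor in `listWeight` makes X_0 count, and the coefficient 2 makes the quadratic term
  -- still smaller.
  have key : ∀ N : ℕ, ∀ l : List ℕ, listWeight l ≤ N → L₁ (listMon l) = L₂ (listMon l) := by
    intro N
    induction N with
    | zero =>
      rintro (_ | ⟨k, l⟩) hl
      · simpa [listMon] using h
      · simp [listWeight] at hl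
    | succ N ih =>
      have ih' : ∀ p ∈ lowWeight N, L₁ p = L₂ p := by
        intro p hp
        have : lowWeight N ≤ LinearMap.eqLocus L₁ L₂ :=
          Submodule.span_le.2 fun _ ⟨l, hl, e⟩ => e ▸ ih l hl
        exact this hp
      rintro (_ | ⟨k, l⟩) hl
      · simpa [listMon] using h
      · have h1 : (listMon (k :: l) : MvPolynomial ℕ ℝ) = X k * listMon l := by simp [listMon]
        have h2 : listWeight (k :: l) = 2 * k + 1 + listWeight l := by simp [listWeight]
        rw [h1]
        have hm := listMon_mem_lowWeight (le_refl (listWeight l))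
        rcases k with _ | j
        · rw [h₁.zero, h₂.zero, ih' _ (lowWeight_mono (by omega) hm)]
        · rw [h₁.succ, h₂.succ]
          refine ih' _ (Submodule.add_mem _ (Submodule.add_mem _ ?_ ?_) ?_)
          · exact C_mul_mem_lowWeight _ (lowWeight_mono (by omega) (X_mul_mem_lowWeight hm))
          · refine Submodule.sum_mem _ fun r hr => ?_
            rw [Finset.mem_range] at hr
            rw [mul_assoc]
            exact lowWeight_mono (by omega) (X_mul_mem_lowWeight (X_mul_mem_lowWeight hm))
          · exact C_mul_mem_lowWeight _ (lowWeight_mono (by omega) (powerShift_listMon_mem j l))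
  refine LinearMap.ext fun p => ?_
  obtain ⟨N, hN⟩ := exists_mem_lowWeight p
  have : lowWeight N ≤ LinearMap.eqLocus L₁ L₂ :=
    Submodule.span_le.2 fun _ ⟨l, hl, e⟩ => e ▸ key N l hl
  exact this hN

end

/-! ### Loop equations from formal derivatives in the matrix entries -/

noncomputable section

open MvPolynomial

section MatrixDerivation

variable {P : Type*} [CommRing P] [Algebra ℝ P]

theorem map_derivation_mul {ι κ τ : Type*} [Fintype κ] (D : Derivation ℝ P P) (A : Matrix ι κ P)
    (B : Matrix κ τ P) : (A * B).map D = A.map D * B + A * B.map D := by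
  ext i j
  simp only [Matrix.map_apply, Matrix.mul_apply, Matrix.add_apply, map_sum, Derivation.leibniz,
    smul_eq_mul, Finset.sum_add_distrib]
  rw [add_comm]
  congr 1
  exact Finset.sum_congr rfl fun k _ => mul_comm _ _

theorem map_derivation_pow {κ : Type*} [Fintype κ] [DecidableEq κ] (D : Derivation ℝ P P)
    (W : Matrix κ κ P) (j : ℕ) :
    (W ^ j).map D = ∑ r ∈ Finset.range j, W ^ r * W.map D * W ^ (j - 1 - r) := by
  induction j with
  | zero =>
    ext a b
    by_cases h : a = b <;> simp [h]
  | succ j ih =>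
    rw [pow_succ, map_derivation_mul, ih, Finset.sum_range_succ, Finset.sum_mul]
    simp only [Nat.add_sub_cancel, Nat.sub_self, pow_zero, mul_one]
    congr 1
    refine Finset.sum_congr rfl fun r hr => ?_
    rw [Finset.mem_range] at hr
    rw [mul_assoc, ← pow_succ, show j - 1 - r + 1 = j - r by omega]

theorem derivation_trace {κ : Type*} [Fintype κ] (D : Derivation ℝ P P) (W : Matrix κ κ P) :
    D W.trace = (W.map D).trace := by
  simp [Matrix.trace, Matrix.map_apply]

/-- Cyclicity of the trace makes the l terms of the noncommutative product rule equal. -/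
theorem derivation_trace_pow {κ : Type*} [Fintype κ] [DecidableEq κ] (D : Derivation ℝ P P)
    (W : Matrix κ κ P) (l : ℕ) :
    D (W ^ l).trace = (l : P) * (W ^ (l - 1) * W.map D).trace := by
  rw [derivation_trace, map_derivation_pow, Matrix.trace_sum]
  have : ∀ r ∈ Finset.range l, (W ^ r * W.map D * W ^ (l - 1 - r)).trace
      = (W ^ (l - 1) * W.map D).trace := by
    intro r hr
    rw [Finset.mem_range] at hr
    rw [Matrix.trace_mul_comm, ← mul_assoc, ← pow_add, Nat.sub_add_cancel (by omega)]
  rw [Finset.sum_congr rfl this]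
  simp

end MatrixDerivation

section LoopAlgebra

variable {ι κ : Type*} [Fintype ι] [Fintype κ] [DecidableEq ι] [DecidableEq κ]
  {P A : Type*} [CommRing P] [Algebra ℝ P] [CommRing A] [Algebra ℝ A]

/-- Derivations `D i a` on a ring with two matrices `H`, `K`, acting like the Wirtinger
derivatives (`ε = 0`) or the real derivatives (`ε = 1`) in the entry `H i a`. -/
structure EntryDerivations (H : Matrix ι κ P) (K : Matrix κ ι P) (ε : ℝ)
    (D : ι → κ → Derivation ℝ P P) (ev : P →ₐ[ℝ] A) : Prop where
  left : ∀ i a j b, D i a (H j b) = if i = j ∧ a = b then 1 else 0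
  right : ∀ i a j b, D i a (K b j) = if i = j ∧ a = b then algebraMap ℝ P ε else 0
  transpose : ε = 0 ∨ K.map ev = (H.map ev)ᵀ

variable {H : Matrix ι κ P} {K : Matrix κ ι P} {ε : ℝ}
    {D : ι → κ → Derivation ℝ P P} {ev : P →ₐ[ℝ] A}

theorem EntryDerivations.map_gram (hD : EntryDerivations H K ε D ev) (i : ι) (a : κ) :
    (K * H).map (D i a) = Matrix.of fun b c =>
      (if a = b then algebraMap ℝ P ε * H i c else 0) + (if a = c then K b i else 0) := by
  ext b c
  simp only [Matrix.map_apply, Matrix.mul_apply, map_sum, Derivation.leibniz, hD.left, hD.right,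
    smul_eq_mul, Finset.sum_add_distrib, Matrix.of_apply]
  rw [add_comm]
  congr 1
  · by_cases h : a = b <;> simp [h, mul_comm]
  · by_cases h : a = c <;> simp [h]

/-- The derivative falls on K or on H. The first case gives a product of two (i, a) entries, which
later recombines into a single trace and carries ε. The second gives a product of two diagonal
entries, which after summation splits one trace into two. -/
theorem EntryDerivations.sum_mul_gram_mul (hD : EntryDerivations H K ε D ev)
    (X : Matrix ι κ P) (Y : Matrix κ κ P) (i : ι) (a : κ) :
    (X * (K * H).map (D i a) * Y) i a
      = algebraMap ℝ P ε * (X i a * (H * Y) i a) + (X * K) i i * Y a a := by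
  rw [hD.map_gram]
  simp only [Matrix.mul_apply, Matrix.of_apply, mul_add, Finset.sum_add_distrib, add_mul,
    mul_ite, mul_zero, Finset.sum_ite_eq, Finset.mem_univ, if_true]
  congr 1
  · rw [Finset.mul_sum, Finset.mul_sum]
    exact Finset.sum_congr rfl fun _ _ => by ring
  · rw [Finset.sum_eq_single a]
    · simp
    · intro b _ hb
      simp [hb.symm]
    · simp

theorem EntryDerivations.trace_mul_gram (hD : EntryDerivations H K ε D ev)
    (Y : Matrix κ κ P) (i : ι) (a : κ) :
    (Y * (K * H).map (D i a)).trace = algebraMap ℝ P ε * (H * Y) i a + (Y * K) a i := by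
  rw [hD.map_gram]
  simp only [Matrix.trace, Matrix.diag_apply, Matrix.mul_apply, Matrix.of_apply, mul_add,
    Finset.sum_add_distrib,
    mul_ite, mul_zero, Finset.sum_ite_eq, Finset.mem_univ, if_true]
  congr 1
  · rw [Finset.mul_sum]
    exact Finset.sum_congr rfl fun _ _ => by ring
  · rw [Finset.sum_eq_single a]
    · simp
    · intro b _ hb
      simp [hb.symm]
    · simp

/-- The second factor enters transposed, so the sum is a trace only if K becomes the transpose of H.
Formally these are independent matrices; the relation holds only after evaluation and is needed only
when ε ≠ 0. This is why the identities here are stated under `ev`. -/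
theorem EntryDerivations.transpose_sum (hD : EntryDerivations H K ε D ev) (r s : ℕ) :
    ev (algebraMap ℝ P ε * ∑ i, ∑ a, (H * (K * H) ^ r) i a * (H * (K * H) ^ s) i a)
      = ev (algebraMap ℝ P ε * ((K * H) ^ (r + s + 1)).trace) := by
  rcases hD.transpose with h | h
  · simp [h]
  · rw [map_mul, map_mul]
    congr 1
    have e1 : ∀ M : Matrix κ κ P, ev M.trace = (M.map ev).trace := fun M => by
      simp [Matrix.trace, Matrix.map_apply]
    have e2 : ∀ t : ℕ, ((K * H) ^ t).map ev = (K.map ev * H.map ev) ^ t := fun t => by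
      have := map_pow ev.mapMatrix (K * H) t
      simpa [AlgHom.mapMatrix_apply, Matrix.map_mul] using this
    have e3 : ∀ t : ℕ, (H * (K * H) ^ t).map ev = H.map ev * (K.map ev * H.map ev) ^ t :=
      fun t => by rw [Matrix.map_mul, e2]
    rw [e1, e2, map_sum]
    simp_rw [map_sum, map_mul, ← Matrix.map_apply (f := ev), e3, h]
    set h' := H.map ev
    have hs : (h'ᵀ * h')ᵀ = h'ᵀ * h' := by rw [Matrix.transpose_mul, Matrix.transpose_transpose]
    have : ∑ i, ∑ a, (h' * (h'ᵀ * h') ^ r) i a * (h' * (h'ᵀ * h') ^ s) i a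
        = ((h' * (h'ᵀ * h') ^ r)ᵀ * (h' * (h'ᵀ * h') ^ s)).trace := by
      rw [Finset.sum_comm]
      rfl
    rw [this, Matrix.transpose_mul, Matrix.transpose_pow, hs, Matrix.mul_assoc,
      ← Matrix.mul_assoc h'ᵀ, ← pow_succ', ← pow_add, add_assoc]

theorem sum_trace_split (X : Matrix ι κ P) (Y : Matrix κ ι P) :
    ∑ i, ∑ a, X i a * Y a i = (Y * X).trace := by
  rw [Matrix.trace_mul_comm]
  simp [Matrix.trace, Matrix.mul_apply]

/-- Differentiating the leading H gives (number of rows) · tr W^j. Differentiating the j factors of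
W^j gives εj tr W^j and the split products of traces. -/
theorem EntryDerivations.divergence (hD : EntryDerivations H K ε D ev) (j : ℕ) :
    ev (∑ i, ∑ a, D i a ((H * (K * H) ^ j) i a)) =
      ev (algebraMap ℝ P ((Fintype.card ι - Fintype.card κ : ℝ) + ε * j) * ((K * H) ^ j).trace
        + ∑ r ∈ Finset.range (j + 1), ((K * H) ^ r).trace * ((K * H) ^ (j - r)).trace) := by
  have h1 : ∀ i a, D i a ((H * (K * H) ^ j) i a) = ((K * H) ^ j) a a
      + ∑ r ∈ Finset.range j, (algebraMap ℝ P ε *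
        ((H * (K * H) ^ r) i a * (H * (K * H) ^ (j - 1 - r)) i a)
        + (H * (K * H) ^ r * K) i i * ((K * H) ^ (j - 1 - r)) a a) := by
    intro i a
    rw [← Matrix.map_apply (f := D i a), map_derivation_mul, map_derivation_pow, Matrix.add_apply]
    congr 1
    · have : H.map (D i a) = Matrix.single i a 1 := by
        ext j b
        simp [hD.left, Matrix.single_apply]
      rw [this]
      simp
    · rw [Matrix.mul_sum, Matrix.sum_apply]
      refine Finset.sum_congr rfl fun r _ => ?_
      rw [← hD.sum_mul_gram_mul]
      simp only [Matrix.mul_assoc]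
  have h2 : ∀ r ∈ Finset.range j, ∑ i, ∑ a, (H * (K * H) ^ r * K) i i * ((K * H) ^ (j - 1 - r)) a a
      = ((K * H) ^ (r + 1)).trace * ((K * H) ^ (j - (r + 1))).trace := by
    intro r _
    rw [← Finset.sum_mul_sum, show j - (r + 1) = j - 1 - r by omega, pow_succ (K * H) r,
      ← Matrix.mul_assoc, Matrix.trace_mul_comm, ← Matrix.mul_assoc]
    rfl
  have h3 : ∀ r ∈ Finset.range j,
      ev (algebraMap ℝ P ε * ∑ i, ∑ a, (H * (K * H) ^ r) i a * (H * (K * H) ^ (j - 1 - r)) i a)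
      = ev (algebraMap ℝ P ε * ((K * H) ^ j).trace) := by
    intro r hr
    rw [Finset.mem_range] at hr
    rw [hD.transpose_sum, show r + (j - 1 - r) + 1 = j by omega]
  simp_rw [h1, Finset.sum_add_distrib]
  -- The r = 0 term on the right is tr 1 · tr W^j, with tr 1 the number of columns. It is not
  -- produced by the derivatives, and including it turns the coefficient n into n - m.
  rw [Finset.sum_range_succ']
  have h4 : ∑ i : ι, ∑ a : κ, ((K * H) ^ j) a a = (Fintype.card ι : P) * ((K * H) ^ j).trace := by
    simp [Matrix.trace, Finset.mul_sum]
  have h5 : ∑ i : ι, ∑ a : κ, ∑ r ∈ Finset.range j, algebraMap ℝ P ε *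
        ((H * (K * H) ^ r) i a * (H * (K * H) ^ (j - 1 - r)) i a)
      = ∑ r ∈ Finset.range j, algebraMap ℝ P ε * ∑ i, ∑ a,
        (H * (K * H) ^ r) i a * (H * (K * H) ^ (j - 1 - r)) i a := by
    simp_rw [Finset.mul_sum]
    rw [Finset.sum_comm (s := Finset.range j)]
    exact Finset.sum_congr rfl fun i _ => Finset.sum_comm
  have h6 : ∑ i : ι, ∑ a : κ, ∑ r ∈ Finset.range j,
        (H * (K * H) ^ r * K) i i * ((K * H) ^ (j - 1 - r)) a a
      = ∑ r ∈ Finset.range j, ((K * H) ^ (r + 1)).trace * ((K * H) ^ (j - (r + 1))).trace := by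
    rw [← Finset.sum_congr rfl h2]
    simp_rw [Finset.sum_comm (t := Finset.range j)]
  rw [h4, h5, h6, map_add, map_add, map_sum, Finset.sum_congr rfl h3, Finset.sum_const,
    Finset.card_range]
  simp only [map_add, map_mul, map_sub, map_natCast, pow_zero, Matrix.trace_one, Nat.sub_zero,
    nsmul_eq_mul]
  ring

/-- The derivative of tr W^l has an H-part and a K-part. Contracted with H W^j, each yields l tr
W^{j+l}, with coefficients 1 and ε; the Leibniz rule extends this to polynomials in traces. -/
theorem EntryDerivations.contract (hD : EntryDerivations H K ε D ev) (j : ℕ)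
    (q : MvPolynomial ℕ ℝ) :
    ev (∑ i, ∑ a, (H * (K * H) ^ j) i a * D i a (aeval (fun l => ((K * H) ^ l).trace) q)) =
      ev (algebraMap ℝ P (1 + ε) * aeval (fun l => ((K * H) ^ l).trace) (powerShift j q)) := by
  induction q using MvPolynomial.induction_on with
  | C c => simp [← MvPolynomial.algebraMap_eq]
  | add p q hp hq =>
    simp only [map_add, mul_add, Finset.sum_add_distrib] at hp hq ⊢
    rw [hp, hq]
  | mul_X p l hp =>
    have hX : ev (∑ i, ∑ a, (H * (K * H) ^ j) i a * D i a ((K * H) ^ l).trace)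
        = ev (algebraMap ℝ P (1 + ε) * ((l : P) * ((K * H) ^ (j + l)).trace)) := by
      rcases l with _ | l
      · simp
      · have : ∀ i a, (H * (K * H) ^ j) i a * D i a ((K * H) ^ (l + 1)).trace
          = ((l + 1 : ℕ) : P) * (algebraMap ℝ P ε *
            ((H * (K * H) ^ j) i a * (H * (K * H) ^ l) i a)
            + (H * (K * H) ^ j) i a * ((K * H) ^ l * K) a i) := by
          intro i a
          rw [derivation_trace_pow, Nat.add_sub_cancel, hD.trace_mul_gram]
          ring
        simp_rw [this, ← Finset.mul_sum, Finset.sum_add_distrib, ← Finset.mul_sum]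
        rw [sum_trace_split, map_mul, map_add, hD.transpose_sum, Matrix.mul_assoc ((K * H) ^ l),
          ← Matrix.mul_assoc K H, ← pow_succ', ← pow_add]
        rw [show l + (j + 1) = j + l + 1 by ring, show j + (l + 1) = j + l + 1 by ring]
        simp only [map_add, map_mul, map_one]
        ring
    simp only [map_mul, aeval_X, Derivation.leibniz, smul_eq_mul, powerShift_X, map_add, aeval_C,
      mul_add, Finset.sum_add_distrib] at hp hX ⊢
    have e1 : ∀ i a, (H * (K * H) ^ j) i a * (aeval (fun l => ((K * H) ^ l).trace) p *
        D i a ((K * H) ^ l).trace) = aeval (fun l => ((K * H) ^ l).trace) p *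
          ((H * (K * H) ^ j) i a * D i a ((K * H) ^ l).trace) := fun _ _ => by ring
    have e2 : ∀ i a, (H * (K * H) ^ j) i a * (((K * H) ^ l).trace *
        D i a (aeval (fun l => ((K * H) ^ l).trace) p)) = ((K * H) ^ l).trace *
          ((H * (K * H) ^ j) i a * D i a (aeval (fun l => ((K * H) ^ l).trace) p)) :=
      fun _ _ => by ring
    simp_rw [e1, e2, ← Finset.mul_sum]
    rw [map_mul, map_mul, hX, hp]
    simp only [map_add, map_natCast, map_one]
    ring

/-- A functional that integrates by parts against the entries satisfies the loop equations. -/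
theorem EntryDerivations.loopEquations (hD : EntryDerivations H K ε D ev)
    {F : Type*} [AddCommGroup F] [Module ℝ F] (E : P →ₗ[ℝ] F)
    (hE : ∀ p q, ev p = ev q → E p = E q) (hparts : ∀ i a G, E (K a i * G) = E (D i a G)) :
    LoopEquations (Fintype.card κ) ((Fintype.card ι : ℝ) - Fintype.card κ) ε
      (E ∘ₗ (aeval fun l => ((K * H) ^ l).trace : MvPolynomial ℕ ℝ →ₐ[ℝ] P).toLinearMap) where
  zero Q := by
    simp only [LinearMap.comp_apply, AlgHom.toLinearMap_apply, map_mul, aeval_X, pow_zero,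
      Matrix.trace_one]
    rw [← nsmul_eq_mul, map_nsmul, Nat.cast_smul_eq_nsmul]
  succ j l := by
    simp only [LinearMap.comp_apply, AlgHom.toLinearMap_apply]
    set Q := listMon l
    set φ := (aeval fun l => ((K * H) ^ l).trace : MvPolynomial ℕ ℝ →ₐ[ℝ] P) with hφ
    have hX : ∀ k, φ (X k) = ((K * H) ^ k).trace := fun k => by simp [hφ]
    -- Writing W^{j+1} = K (H W^j) puts an entry of K in front, ready for integration by parts.
    have h1 : φ (X (j + 1) * Q) = ∑ i, ∑ a, K a i * ((H * (K * H) ^ j) i a * φ Q) := by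
      rw [map_mul, hX, pow_succ', Matrix.mul_assoc, ← sum_trace_split, Finset.sum_mul]
      refine Finset.sum_congr rfl fun i _ => ?_
      rw [Finset.sum_mul]
      exact Finset.sum_congr rfl fun a _ => by ring
    have h2 : ∑ i, ∑ a, D i a ((H * (K * H) ^ j) i a * φ Q)
        = φ Q * ∑ i, ∑ a, D i a ((H * (K * H) ^ j) i a)
          + ∑ i, ∑ a, (H * (K * H) ^ j) i a * D i a (φ Q) := by
      simp_rw [Derivation.leibniz, smul_eq_mul, Finset.sum_add_distrib, ← Finset.mul_sum]
      rw [add_comm]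
    have h3 : E (∑ i, ∑ a, K a i * ((H * (K * H) ^ j) i a * φ Q))
        = E (∑ i, ∑ a, D i a ((H * (K * H) ^ j) i a * φ Q)) := by
      simp_rw [map_sum, hparts]
    rw [h1, h3]
    refine hE _ _ ?_
    rw [h2, map_add, hD.contract, map_mul, hD.divergence, ← map_mul, ← map_add]
    congr 1
    have hC : ∀ c : ℝ, φ (C c) = algebraMap ℝ P c := fun c => aeval_C _ _
    simp only [map_add φ, map_mul φ, map_sum φ, hX, hC, ← hφ]
    rw [← Finset.sum_mul]
    ring

end LoopAlgebra

end

/-! ### Real and complex Gaussian entries -/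

noncomputable section

section GaussianEntries

open scoped ComplexConjugate

/-- Gaussian integration by parts. -/
theorem integral_smul_gaussianReal_eq {E : Type*} [NormedAddCommGroup E] [NormedSpace ℝ E]
    {v : ℝ≥0} (hv : v ≠ 0) {f f' : ℝ → E} (hf : ∀ x, HasDerivAt f (f' x) x)
    (h0 : Integrable f (gaussianReal 0 v)) (h1 : Integrable f' (gaussianReal 0 v))
    (h2 : Integrable (fun x => x • f x) (gaussianReal 0 v)) :
    ∫ x, x • f x ∂gaussianReal 0 v = (v : ℝ) • ∫ x, f' x ∂gaussianReal 0 v := by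
  have conv : ∀ g : ℝ → E, Integrable g (gaussianReal 0 v) →
      Integrable (fun x => gaussianPDFReal 0 v x • g x) := by
    intro g hg
    rw [gaussianReal_of_var_ne_zero _ hv, integrable_withDensity_iff_integrable_smul₀'
      (measurable_gaussianPDF 0 v).aemeasurable (by simp [gaussianPDF])] at hg
    refine hg.congr (ae_of_all _ fun x => ?_)
    simp [gaussianPDF, ENNReal.toReal_ofReal (gaussianPDFReal_nonneg 0 v x)]
  have hv' : (v : ℝ) ≠ 0 := by exact_mod_cast hv
  have hpdf : ∀ x, HasDerivAt (gaussianPDFReal 0 v)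
      (-(x / v) * gaussianPDFReal 0 v x) x := by
    intro x
    have h : HasDerivAt (fun x : ℝ => -(x - 0) ^ 2 / (2 * (v : ℝ))) (-(x / v)) x := by
      have := (((hasDerivAt_id x).sub_const 0).pow 2).neg.div_const (2 * (v : ℝ))
      refine this.congr_deriv ?_
      simp
      field_simp
    have := h.exp.const_mul (√(2 * Real.pi * v))⁻¹
    refine this.congr_deriv ?_
    rw [gaussianPDFReal]
    ring
  have h3 : Integrable (fun x => (v : ℝ)⁻¹ • gaussianPDFReal 0 v x • (x • f x)) :=
    (conv _ h2).smul _
  -- For the Gaussian density ρ one has ρ' = -(x/v) ρ, so the integrand is (ρ f)', whose integral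
  -- over the line is 0.
  have hzero := integral_eq_zero_of_hasDerivAt_of_integrable
    (f := fun x => gaussianPDFReal 0 v x • f x)
    (f' := fun x => gaussianPDFReal 0 v x • f' x - (v : ℝ)⁻¹ • gaussianPDFReal 0 v x • (x • f x))
    (fun x => by
      refine ((hpdf x).smul (hf x)).congr_deriv ?_
      rw [sub_eq_add_neg]
      congr 1
      rw [smul_smul, smul_smul, ← neg_smul]
      congr 1
      field_simp)
    ((conv _ h1).sub h3) (conv _ h0)
  rw [integral_sub (conv _ h1) h3, integral_smul, sub_eq_zero] at hzero
  rw [integral_gaussianReal_eq_integral_smul hv, integral_gaussianReal_eq_integral_smul hv, hzero,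
    smul_smul, mul_inv_cancel₀ hv', one_smul]

/-- A law on `ℝ` or `ℂ` with a density proportional to `exp (- β / 2 * ‖z‖ ^ 2)`, together with its
integration by parts formula. -/
structure GaussianEntry {𝕜 : Type*} [RCLike 𝕜] [MeasurableSpace 𝕜] [BorelSpace 𝕜] (ν : Measure 𝕜)
    (β : ℝ) : Prop where
  one_le : 1 ≤ β
  prob : IsProbabilityMeasure ν
  integrable : ∀ a b : ℕ, Integrable (fun z : 𝕜 => z ^ a * conj z ^ b) ν
  parts : ∀ a b : ℕ, ∫ z, conj z * (z ^ a * conj z ^ b) ∂ν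
    = (a : 𝕜) * ∫ z, z ^ (a - 1) * conj z ^ b ∂ν
      + ((2 / β - 1 : ℝ) : 𝕜) * ((b : 𝕜) * ∫ z, z ^ a * conj z ^ (b - 1) ∂ν)
  star_eq : 2 / β - 1 = 0 ∨ ∀ z : 𝕜, conj z = z
  density : ∃ κ : Measure 𝕜, κ.IsAddHaarMeasure ∧ ∃ c : ℝ, 0 < c ∧
    ν = κ.withDensity fun z => ENNReal.ofReal (c * Real.exp (-(β / 2 * ‖z‖ ^ 2)))

theorem integrable_of_memLp {𝕜 : Type*} [RCLike 𝕜] {Ω : Type*} [MeasurableSpace Ω] {μ : Measure Ω}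
    [IsFiniteMeasure μ] {Z : Ω → 𝕜} (hZ : ∀ p : ℝ≥0, MemLp Z p μ) {E : Type*}
    [NormedAddCommGroup E] {f : Ω → E} (hf : AEStronglyMeasurable f μ) (N : ℕ)
    (h : ∀ ω, ‖f ω‖ ≤ ‖Z ω‖ ^ N) : Integrable f μ := by
  have : Integrable (fun ω => ‖Z ω‖ ^ N) μ :=
    (show MemLp Z (N : ENNReal) μ from by simpa using hZ N).integrable_norm_pow'
  exact this.mono' hf (ae_of_all _ h)

/-- Conjugation is trivial and 2/β - 1 = 1, so the two derivative terms add up to (a + b) z^{a+b-1}.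
The truncated exponents at a = 0 or b = 0 are harmless because their coefficients vanish. -/
theorem gaussianEntry_real : GaussianEntry realEntry 1 where
  one_le := le_rfl
  prob := by unfold realEntry; infer_instance
  integrable a b := by
    refine integrable_of_memLp (Z := (id : ℝ → ℝ)) (fun p => memLp_id_gaussianReal p)
      (by simp only [conj_trivial]; fun_prop) (a + b) fun z => ?_
    simp [pow_add]
  parts a b := by
    have hint : ∀ N : ℕ, Integrable (fun x : ℝ => x ^ N) (gaussianReal 0 1) := fun N =>
      integrable_of_memLp (Z := (id : ℝ → ℝ)) (fun p => memLp_id_gaussianReal p)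
        (by fun_prop) N fun z => by simp
    have h := integral_smul_gaussianReal_eq (v := 1) one_ne_zero
      (f := fun x : ℝ => x ^ (a + b)) (f' := fun x => ((a + b : ℕ) : ℝ) * x ^ (a + b - 1))
      (fun x => hasDerivAt_pow _ x) (hint _) ((hint _).const_mul _)
      (by simpa [← pow_succ'] using hint (a + b + 1))
    simp only [smul_eq_mul, integral_const_mul, NNReal.coe_one, one_mul] at h
    have e1 : ∀ z : ℝ, conj z * (z ^ a * conj z ^ b) = z * z ^ (a + b) := fun z => by
      simp [pow_add]
    have e2 : (a : ℝ) * ∫ z : ℝ, z ^ (a - 1) * conj z ^ b ∂realEntry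
        = a * ∫ z : ℝ, z ^ (a + b - 1) ∂realEntry := by
      rcases a with _ | a
      · simp
      · congr 2
        funext z
        simp [← pow_add, show a + 1 + b - 1 = a + b by omega]
    have e3 : (b : ℝ) * ∫ z : ℝ, z ^ a * conj z ^ (b - 1) ∂realEntry
        = b * ∫ z : ℝ, z ^ (a + b - 1) ∂realEntry := by
      rcases b with _ | b
      · simp
      · congr 2
        funext z
        simp [← pow_add]
    simp_rw [e1]
    rw [e2, e3]
    unfold realEntry
    rw [h]
    push_cast
    norm_num
    ring
  star_eq := Or.inr fun z => by simp
  density := by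
    refine ⟨volume, inferInstance, (√(2 * Real.pi))⁻¹, by positivity, ?_⟩
    rw [realEntry, gaussianReal_of_var_ne_zero _ one_ne_zero]
    congr 1
    funext x
    simp only [gaussianPDF, gaussianPDFReal]
    congr 2
    · simp
    · simp
      ring

theorem complex_memLp (v : ℝ≥0) (p : ℝ≥0) :
    MemLp (fun q : ℝ × ℝ => (q.1 : ℂ) + q.2 * Complex.I) p
      ((gaussianReal 0 v).prod (gaussianReal 0 v)) := by
  have h1 : MemLp (fun q : ℝ × ℝ => q.1) p ((gaussianReal 0 v).prod (gaussianReal 0 v)) :=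
    (memLp_id_gaussianReal p).comp_measurePreserving measurePreserving_fst
  have h2 : MemLp (fun q : ℝ × ℝ => q.2) p ((gaussianReal 0 v).prod (gaussianReal 0 v)) :=
    (memLp_id_gaussianReal p).comp_measurePreserving measurePreserving_snd
  refine MemLp.mono (g := fun q : ℝ × ℝ => ‖q.1‖ + ‖q.2‖) (h1.norm.add h2.norm) (by fun_prop)
    (ae_of_all _ fun q => ?_)
  refine (norm_add_le _ _).trans ?_
  rw [norm_mul, Complex.norm_I, mul_one, Complex.norm_real, Complex.norm_real]
  exact le_abs_self _

theorem complexEntry_eq_map : complexEntry =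
    ((gaussianReal 0 (1 / 2 : ℝ≥0)).prod (gaussianReal 0 (1 / 2 : ℝ≥0))).map
      (fun q : ℝ × ℝ => (q.1 : ℂ) + q.2 * Complex.I) := by
  unfold complexEntry
  congr 1
  funext q
  exact Complex.mk_eq_add_mul_I _ _

/-- With conj z = x - iy and variance 1/2 in each coordinate, integration by parts produces (∂_x -
i∂_y)/2 = ∂_z. Hence the derivative in conj z has coefficient 0 = 2/β - 1. -/
theorem gaussianEntry_complex : GaussianEntry complexEntry 2 where
  one_le := one_le_two
  prob := by
    rw [complexEntry_eq_map]
    exact Measure.isProbabilityMeasure_map (by fun_prop)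
  integrable a b := by
    rw [complexEntry_eq_map, integrable_map_measure (by fun_prop) (by fun_prop)]
    refine integrable_of_memLp (fun p => complex_memLp _ p) (by fun_prop) (a + b) fun q => ?_
    simp only [Function.comp_apply, norm_mul, norm_pow, RCLike.norm_conj, pow_add, le_refl]
  parts a b := by
    set γ := gaussianReal 0 (1 / 2 : ℝ≥0)
    set Z : ℝ × ℝ → ℂ := fun q => (q.1 : ℂ) + q.2 * Complex.I with hZ
    set Y : ℝ × ℝ → ℂ := fun q => (q.1 : ℂ) - q.2 * Complex.I with hY
    have hconj : ∀ q, conj (Z q) = Y q := fun q => by simp [hZ, hY, sub_eq_add_neg]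
    have hnY : ∀ q, ‖Y q‖ = ‖Z q‖ := fun q => by rw [← hconj]; simp
    have hmap : ∀ g : ℂ → ℂ, Continuous g → ∫ z, g z ∂complexEntry = ∫ q, g (Z q) ∂γ.prod γ := by
      intro g hg
      rw [complexEntry_eq_map, integral_map (by fun_prop) hg.aestronglyMeasurable]
    have hint : ∀ (a b : ℕ), Integrable (fun q => Z q ^ a * Y q ^ b) (γ.prod γ) := by
      intro a b
      refine integrable_of_memLp (fun p => complex_memLp _ p)
        (by simp only [hZ, hY]; fun_prop) (a + b) fun q => ?_
      simp only [norm_mul, norm_pow, hnY, pow_add, hZ, le_refl]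
    -- The coordinates are x = (z + conj z)/2 and, below, y = (z - conj z)/(2i), so integrability
    -- reduces to that of monomials in z and conj z.
    have hint1 : Integrable (fun q : ℝ × ℝ => q.1 • (Z q ^ a * Y q ^ b)) (γ.prod γ) := by
      have : Integrable (fun q => (2 : ℂ)⁻¹ * (Z q ^ (a + 1) * Y q ^ b + Z q ^ a * Y q ^ (b + 1)))
        (γ.prod γ) := ((hint _ _).add (hint _ _)).const_mul _
      refine this.congr (ae_of_all _ fun q => ?_)
      simp only [hZ, hY, Complex.real_smul]
      ring
    have hint2 : Integrable (fun q : ℝ × ℝ => q.2 • (Z q ^ a * Y q ^ b)) (γ.prod γ) := by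
      have : Integrable (fun q => (2 * Complex.I)⁻¹ *
        (Z q ^ (a + 1) * Y q ^ b - Z q ^ a * Y q ^ (b + 1)))
        (γ.prod γ) := ((hint _ _).sub (hint _ _)).const_mul _
      refine this.congr (ae_of_all _ fun q => ?_)
      have := Complex.I_ne_zero
      simp only [hZ, hY, Complex.real_smul]
      field_simp
      ring
    set A := fun q => (a : ℂ) * (Z q ^ (a - 1) * Y q ^ b) with hA
    set B := fun q => (b : ℂ) * (Z q ^ a * Y q ^ (b - 1)) with hB
    have hAi : Integrable A (γ.prod γ) := (hint _ _).const_mul _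
    have hBi : Integrable B (γ.prod γ) := (hint _ _).const_mul _
    have dx : ∀ x y : ℝ, HasDerivAt (fun x : ℝ => Z (x, y) ^ a * Y (x, y) ^ b)
        (A (x, y) + B (x, y)) x := by
      intro x y
      have h1 : HasDerivAt (fun x : ℝ => Z (x, y)) 1 x :=
        (Complex.ofRealCLM.hasDerivAt (x := x)).add_const ((y : ℂ) * Complex.I)
      have h2 : HasDerivAt (fun x : ℝ => Y (x, y)) 1 x :=
        (Complex.ofRealCLM.hasDerivAt (x := x)).sub_const ((y : ℂ) * Complex.I)
      refine ((h1.pow a).mul (h2.pow b)).congr_deriv ?_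
      simp only [hA, hB, Pi.pow_apply]
      ring
    have dy : ∀ x y : ℝ, HasDerivAt (fun y : ℝ => Z (x, y) ^ a * Y (x, y) ^ b)
        (Complex.I * A (x, y) - Complex.I * B (x, y)) y := by
      intro x y
      have h1 : HasDerivAt (fun y : ℝ => Z (x, y)) (1 * Complex.I) y :=
        ((Complex.ofRealCLM.hasDerivAt (x := y)).mul_const Complex.I).const_add (x : ℂ)
      have h2 : HasDerivAt (fun y : ℝ => Y (x, y)) (-(1 * Complex.I)) y :=
        ((Complex.ofRealCLM.hasDerivAt (x := y)).mul_const Complex.I).const_sub (x : ℂ)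
      refine ((h1.pow a).mul (h2.pow b)).congr_deriv ?_
      simp only [hA, hB, Pi.pow_apply]
      ring
    have hv : (1 / 2 : ℝ≥0) ≠ 0 := by norm_num
    have hABi : Integrable (fun q => A q + B q) (γ.prod γ) := hAi.add hBi
    have ex : ∫ q, q.1 • (Z q ^ a * Y q ^ b) ∂γ.prod γ = (1 / 2 : ℝ) • ∫ q, A q + B q ∂γ.prod γ := by
      rw [integral_prod_symm _ hint1, integral_prod_symm _ hABi, ← integral_smul]
      refine integral_congr_ae ?_
      filter_upwards [(hint a b).prod_left_ae, hint1.prod_left_ae, hABi.prod_left_ae]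
        with y h0 h2 h1
      have := integral_smul_gaussianReal_eq hv (fun x => dx x y) h0 h1 h2
      rwa [show ((1 / 2 : ℝ≥0) : ℝ) = 1 / 2 by norm_num] at this
    have ey : ∫ q, q.2 • (Z q ^ a * Y q ^ b) ∂γ.prod γ
        = (1 / 2 : ℝ) • ∫ q, Complex.I * A q - Complex.I * B q ∂γ.prod γ := by
      have hi : Integrable (fun q => Complex.I * A q - Complex.I * B q) (γ.prod γ) :=
        (hAi.const_mul Complex.I).sub (hBi.const_mul Complex.I)
      rw [integral_prod _ hint2, integral_prod _ hi, ← integral_smul]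
      refine integral_congr_ae ?_
      filter_upwards [(hint a b).prod_right_ae, hint2.prod_right_ae, hi.prod_right_ae]
        with x h0 h2 h1
      have := integral_smul_gaussianReal_eq hv (fun y => dy x y) h0 h1 h2
      rwa [show ((1 / 2 : ℝ≥0) : ℝ) = 1 / 2 by norm_num] at this
    rw [hmap _ (by fun_prop), hmap _ (by fun_prop), hmap _ (by fun_prop)]
    simp_rw [hconj]
    have e : ∀ q, Y q * (Z q ^ a * Y q ^ b)
        = q.1 • (Z q ^ a * Y q ^ b) - Complex.I * (q.2 • (Z q ^ a * Y q ^ b)) := by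
      intro q
      simp only [Complex.real_smul, hY]
      ring
    simp_rw [e]
    have eA : (a : ℂ) * ∫ q, Z q ^ (a - 1) * Y q ^ b ∂γ.prod γ = ∫ q, A q ∂γ.prod γ :=
      (integral_const_mul _ _).symm
    rw [integral_sub hint1 (hint2.const_mul _), integral_const_mul Complex.I, ex, ey, integral_add hAi hBi,
      integral_sub (hAi.const_mul _) (hBi.const_mul _), integral_const_mul Complex.I A,
      integral_const_mul Complex.I B, eA]
    simp only [Complex.real_smul]
    have hI := Complex.I_mul_I
    push_cast
    norm_num
    linear_combination (-(1 / 2 : ℂ) * (∫ q, A q ∂γ.prod γ) + (1 / 2 : ℂ) * ∫ q, B q ∂γ.prod γ) * hI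
  star_eq := Or.inl (by norm_num)
  density := by
    refine ⟨volume, inferInstance, Real.pi⁻¹, by positivity, ?_⟩
    have hv : (1 / 2 : ℝ≥0) ≠ 0 := by norm_num
    have hm := (Complex.volume_preserving_equiv_real_prod.symm)
    have hfun : (fun p : ℝ × ℝ => (⟨p.1, p.2⟩ : ℂ)) = Complex.measurableEquivRealProd.symm := rfl
    rw [complexEntry, gaussianReal_of_var_ne_zero _ hv,
      prod_withDensity (measurable_gaussianPDF _ _) (measurable_gaussianPDF _ _), hfun]
    refine Measure.ext fun s hs => ?_
    rw [Measure.map_apply (by fun_prop) hs, withDensity_apply _ (by measurability),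
      withDensity_apply _ hs, ← hm.setLIntegral_comp_preimage hs (by fun_prop)]
    refine lintegral_congr fun p => ?_
    simp only [gaussianPDF, gaussianPDFReal]
    rw [← ENNReal.ofReal_mul (by positivity)]
    congr 1
    rw [mul_mul_mul_comm, ← Real.exp_add, ← mul_inv]
    congr 1
    · rw [Real.mul_self_sqrt (by positivity)]
      congr 1
      push_cast
      ring
    · congr 1
      rw [← Complex.normSq_eq_norm_sq, Complex.normSq_apply]
      simp
      ring

end GaussianEntries

end

/-! ### Expectations of polynomials in the entries -/

noncomputable section

open MvPolynomial

section PolynomialExpectation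

open scoped ComplexConjugate

variable {𝕜 : Type*} [RCLike 𝕜] {n m : ℕ}

/-- The values of the formal entries: `(i, a, false)` stands for `H i a`, and `(i, a, true)` for
its conjugate. -/
def entryValue (H : Fin n → Fin m → 𝕜) : (Fin n × Fin m) × Bool → 𝕜 :=
  fun k => bif k.2 then conj (H k.1.1 k.1.2) else H k.1.1 k.1.2

/-- Polynomials in the entries and their conjugates, as functions of the matrix. -/
def entryEval : MvPolynomial ((Fin n × Fin m) × Bool) 𝕜 →ₐ[ℝ] ((Fin n → Fin m → 𝕜) → 𝕜) :=
  AlgHom.pi fun H => (aeval (R := 𝕜) (entryValue H)).restrictScalars ℝ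

theorem entryEval_apply (p : MvPolynomial ((Fin n × Fin m) × Bool) 𝕜) (H : Fin n → Fin m → 𝕜) :
    entryEval p H = eval (entryValue H) p := by
  simp [entryEval, aeval_eq_eval]

theorem entryEval_monomial (s : (Fin n × Fin m) × Bool →₀ ℕ) (c : 𝕜) (H : Fin n → Fin m → 𝕜) :
    entryEval (monomial s c) H
      = c * ∏ i, ∏ a, (H i a ^ s ((i, a), false) * conj (H i a) ^ s ((i, a), true)) := by
  rw [entryEval_apply, eval_monomial, Finsupp.prod_fintype _ _ (fun _ => pow_zero _),
    Fintype.prod_prod_type, Fintype.prod_prod_type]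
  simp only [Fintype.prod_bool, entryValue, cond_true, cond_false]
  congr 1
  exact Finset.prod_congr rfl fun i _ => Finset.prod_congr rfl fun a _ => mul_comm _ _

variable [MeasurableSpace 𝕜] [BorelSpace 𝕜] {ν : Measure 𝕜} {β : ℝ}

theorem GaussianEntry.integrable_monomial (hν : GaussianEntry ν β)
    (s : (Fin n × Fin m) × Bool →₀ ℕ) (c : 𝕜) :
    Integrable (entryEval (monomial s c))
      (Measure.pi fun _ : Fin n => Measure.pi fun _ : Fin m => ν) := by
  have := hν.prob
  have h : Integrable (fun H : Fin n → Fin m → 𝕜 =>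
      c * ∏ i, ∏ a, (H i a ^ s ((i, a), false) * conj (H i a) ^ s ((i, a), true)))
      (Measure.pi fun _ : Fin n => Measure.pi fun _ : Fin m => ν) := by
    refine Integrable.const_mul ?_ c
    refine Integrable.fintype_prod (f := fun i (h : Fin m → 𝕜) =>
      ∏ a, (h a ^ s ((i, a), false) * conj (h a) ^ s ((i, a), true))) fun i => ?_
    exact Integrable.fintype_prod (f := fun a (z : 𝕜) =>
      z ^ s ((i, a), false) * conj z ^ s ((i, a), true)) fun a => hν.integrable _ _
  exact h.congr (ae_of_all _ fun H => (entryEval_monomial s c H).symm)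

theorem GaussianEntry.integral_monomial (hν : GaussianEntry ν β)
    (s : (Fin n × Fin m) × Bool →₀ ℕ) (c : 𝕜) :
    ∫ H, entryEval (monomial s c) H
      ∂(Measure.pi fun _ : Fin n => Measure.pi fun _ : Fin m => ν)
      = c * ∏ k : Fin n × Fin m, ∫ z, z ^ s (k, false) * conj z ^ s (k, true) ∂ν := by
  have := hν.prob
  simp_rw [entryEval_monomial]
  rw [integral_const_mul, integral_fintype_prod_eq_prod (f := fun i (h : Fin m → 𝕜) =>
      ∏ a, (h a ^ s ((i, a), false) * conj (h a) ^ s ((i, a), true))), Fintype.prod_prod_type]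
  congr 1
  refine Finset.prod_congr rfl fun i _ => ?_
  rw [integral_fintype_prod_eq_prod (f := fun a (z : 𝕜) =>
      z ^ s ((i, a), false) * conj z ^ s ((i, a), true))]

theorem GaussianEntry.integrable_entryEval (hν : GaussianEntry ν β)
    (p : MvPolynomial ((Fin n × Fin m) × Bool) 𝕜) :
    Integrable (entryEval p) (Measure.pi fun _ : Fin n => Measure.pi fun _ : Fin m => ν) := by
  induction p using MvPolynomial.induction_on' with
  | monomial s c => exact hν.integrable_monomial s c
  | add p q hp hq => rw [map_add]; exact hp.add hq

/-- The expectation of a polynomial in the entries. -/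
def GaussianEntry.expect (hν : GaussianEntry ν β) (n m : ℕ) :
    MvPolynomial ((Fin n × Fin m) × Bool) 𝕜 →ₗ[ℝ] 𝕜 where
  toFun p := ∫ H, entryEval p H ∂(Measure.pi fun _ : Fin n => Measure.pi fun _ : Fin m => ν)
  map_add' p q := by
    simp only [map_add, Pi.add_apply]
    exact integral_add (hν.integrable_entryEval p) (hν.integrable_entryEval q)
  map_smul' c p := by
    simp only [map_smul, Pi.smul_apply, RingHom.id_apply]
    exact integral_smul c _

/-- The derivation in the entry `(i, a)` adjoint to multiplication by its conjugate. -/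
def entryDerivation (𝕜 : Type*) [RCLike 𝕜] {n m : ℕ} (ε : ℝ) (i : Fin n) (a : Fin m) :
    Derivation ℝ (MvPolynomial ((Fin n × Fin m) × Bool) 𝕜)
      (MvPolynomial ((Fin n × Fin m) × Bool) 𝕜) :=
  (pderiv ((i, a), false) + (ε : 𝕜) • pderiv ((i, a), true)).restrictScalars ℝ

theorem entryDerivation_apply (ε : ℝ) (i : Fin n) (a : Fin m)
    (p : MvPolynomial ((Fin n × Fin m) × Bool) 𝕜) :
    entryDerivation 𝕜 ε i a p
      = pderiv ((i, a), false) p + (ε : 𝕜) • pderiv ((i, a), true) p := rfl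

/-- On a monomial the expectation factors over the entries by independence. The one-entry formula
applies to the factor at (i, a) and the other factors are common to all three terms. -/
theorem GaussianEntry.expect_X_mul (hν : GaussianEntry ν β) (i : Fin n) (a : Fin m)
    (p : MvPolynomial ((Fin n × Fin m) × Bool) 𝕜) :
    hν.expect n m (X ((i, a), true) * p)
      = hν.expect n m (entryDerivation 𝕜 (2 / β - 1) i a p) := by
  induction p using MvPolynomial.induction_on' with
  | add p q hp hq => rw [mul_add, map_add, map_add, map_add, hp, hq]
  | monomial s c =>
    rw [entryDerivation_apply, pderiv_monomial, pderiv_monomial, smul_monomial, map_add,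
      X, monomial_mul, one_mul]
    simp only [GaussianEntry.expect, LinearMap.coe_mk, AddHom.coe_mk, hν.integral_monomial]
    set k : Fin n × Fin m := (i, a)
    have split : ∀ t : (Fin n × Fin m) × Bool →₀ ℕ, (∀ l, l ≠ k → ∀ b, t (l, b) = s (l, b)) →
        ∏ l : Fin n × Fin m, ∫ z, z ^ t (l, false) * conj z ^ t (l, true) ∂ν
        = (∫ z, z ^ t (k, false) * conj z ^ t (k, true) ∂ν) *
          ∏ l ∈ Finset.univ.erase k, ∫ z, z ^ s (l, false) * conj z ^ s (l, true) ∂ν := by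
      intro t ht
      rw [← Finset.mul_prod_erase _ _ (Finset.mem_univ k)]
      congr 1
      refine Finset.prod_congr rfl fun l hl => ?_
      rw [ht l (Finset.ne_of_mem_erase hl), ht l (Finset.ne_of_mem_erase hl)]
    have hne : ∀ l, l ≠ k → ∀ b b' : Bool, ((k, b') : (Fin n × Fin m) × Bool) ≠ (l, b) :=
      fun l hl b b' h => hl (by simpa using (congrArg Prod.fst h).symm)
    rw [split _ (fun l hl b => by simp [Finsupp.single_eq_of_ne' (hne l hl b _)]),
      split _ (fun l hl b => by simp [Finsupp.single_eq_of_ne' (hne l hl b _)]),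
      split _ (fun l hl b => by simp [Finsupp.single_eq_of_ne' (hne l hl b _)])]
    have hp := hν.parts (s (k, false)) (s (k, true))
    have e : ∀ z : 𝕜, conj z * (z ^ s (k, false) * conj z ^ s (k, true))
        = z ^ s (k, false) * conj z ^ (1 + s (k, true)) := fun z => by ring
    simp_rw [e] at hp
    simp only [Finsupp.coe_add, Pi.add_apply, Finsupp.coe_tsub, Pi.sub_apply, Finsupp.single_eq_same]
    rw [Finsupp.single_eq_of_ne (by simp), Finsupp.single_eq_of_ne (by simp), zero_add, hp]
    simp only [tsub_zero, smul_eq_mul]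
    ring

/-- The formal matrix. -/
def formalEntries (𝕜 : Type*) [RCLike 𝕜] (n m : ℕ) :
    Matrix (Fin n) (Fin m) (MvPolynomial ((Fin n × Fin m) × Bool) 𝕜) :=
  Matrix.of fun i a => X ((i, a), false)

/-- The formal adjoint matrix. -/
def formalAdjoint (𝕜 : Type*) [RCLike 𝕜] (n m : ℕ) :
    Matrix (Fin m) (Fin n) (MvPolynomial ((Fin n × Fin m) × Bool) 𝕜) :=
  Matrix.of fun a i => X ((i, a), true)

theorem GaussianEntry.entryDerivations (hν : GaussianEntry ν β) :
    EntryDerivations (formalEntries 𝕜 n m) (formalAdjoint 𝕜 n m) (2 / β - 1)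
      (entryDerivation 𝕜 (2 / β - 1)) entryEval where
  left i a j b := by
    rw [entryDerivation_apply, formalEntries, Matrix.of_apply, pderiv_X, pderiv_X]
    simp [Pi.single_apply, eq_comm]
  right i a j b := by
    rw [entryDerivation_apply, formalAdjoint, Matrix.of_apply, pderiv_X, pderiv_X]
    simp [Pi.single_apply, eq_comm, MvPolynomial.algebraMap_apply, MvPolynomial.smul_eq_C_mul]
  transpose := by
    refine hν.star_eq.imp_right fun h => ?_
    ext a i H
    simp [formalEntries, formalAdjoint, entryEval_apply, entryValue, h]

/-- The moments of the traces of powers of the Gram matrix satisfy the loop equations. -/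
theorem GaussianEntry.loopEquations (hν : GaussianEntry ν β) :
    LoopEquations m ((n : ℝ) - m) (2 / β - 1)
      (hν.expect n m ∘ₗ (aeval fun l => ((formalAdjoint 𝕜 n m * formalEntries 𝕜 n m) ^ l).trace :
        MvPolynomial ℕ ℝ →ₐ[ℝ] _).toLinearMap) := by
  have := (hν.entryDerivations (n := n) (m := m)).loopEquations (hν.expect n m)
    (fun p q h => by simp [GaussianEntry.expect, h]) (fun i a G => hν.expect_X_mul i a G)
  simpa using this

theorem entryEval_aeval_trace (q : MvPolynomial ℕ ℝ) (H : Fin n → Fin m → 𝕜) :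
    entryEval (aeval (fun l => ((formalAdjoint 𝕜 n m * formalEntries 𝕜 n m) ^ l).trace) q) H
      = aeval (fun l => (((Matrix.of H)ᴴ * Matrix.of H) ^ l).trace) q := by
  set ψ : MvPolynomial ((Fin n × Fin m) × Bool) 𝕜 →ₐ[ℝ] 𝕜 :=
    (aeval (R := 𝕜) (entryValue H)).restrictScalars ℝ with hψ
  change ψ _ = _
  rw [MvPolynomial.comp_aeval_apply]
  congr 2
  funext l
  have h1 : ∀ M : Matrix (Fin m) (Fin m) (MvPolynomial ((Fin n × Fin m) × Bool) 𝕜),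
      ψ M.trace = (ψ.mapMatrix M).trace := fun M => by simp [Matrix.trace]
  have h2 : (formalAdjoint 𝕜 n m).map ψ = (Matrix.of H)ᴴ := by
    ext a i
    simp [hψ, formalAdjoint, entryValue]
  have h3 : (formalEntries 𝕜 n m).map ψ = Matrix.of H := by
    ext a i
    simp [hψ, formalEntries, entryValue]
  rw [h1, map_pow, AlgHom.mapMatrix_apply, Matrix.map_mul, h2, h3]

end PolynomialExpectation

end

/-! ### Integrability of the eigenvalue density on the cone -/

noncomputable section

section ConeIntegrals

/-- If `f` and its derivative, defined off a countable set, are integrable on the half line and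
`f` vanishes at `0`, then the integral of the derivative vanishes. -/
theorem integral_Ioi_eq_zero_of_hasDerivAt {f f' : ℝ → ℝ} {s : Set ℝ} (hs : s.Countable)
    (hc : ContinuousOn f (Set.Ici 0)) (h0 : f 0 = 0)
    (hd : ∀ t, 0 < t → t ∉ s → HasDerivAt f (f' t) t)
    (hf : IntegrableOn f (Set.Ioi 0)) (hf' : IntegrableOn f' (Set.Ioi 0)) :
    ∫ t in Set.Ioi 0, f' t = 0 := by
  have h1 : Tendsto (fun R : ℝ => ∫ t in (0 : ℝ)..R, f' t) atTop (𝓝 (∫ t in Set.Ioi 0, f' t)) :=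
    intervalIntegral_tendsto_integral_Ioi 0 hf' tendsto_id
  have h2 : ∀ᶠ R : ℝ in atTop, ∫ t in (0 : ℝ)..R, f' t = f R := by
    filter_upwards [eventually_ge_atTop 0] with R hR
    rw [integral_eq_of_hasDerivAt_off_countable_of_le f f' hR hs
      (hc.mono Set.Icc_subset_Ici_self) (fun x hx => hd x hx.1.1 hx.2), h0, sub_zero]
    rw [intervalIntegrable_iff_integrableOn_Ioc_of_le hR]
    exact hf'.mono_set Set.Ioc_subset_Ioi_self
  -- The integral of f' is the limit of f at infinity; integrability of f forces that limit to be 0.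
  have h3 : Tendsto f atTop (𝓝 (∫ t in Set.Ioi 0, f' t)) := h1.congr' h2
  refine IntegrableAtFilter.eq_zero_of_tendsto (μ := volume) ⟨Set.Ioi 0, Ioi_mem_atTop 0, hf⟩ ?_ h3
  intro t ht
  obtain ⟨a, ha⟩ := mem_atTop_sets.1 ht
  exact measure_mono_top (s₁ := Set.Ici a) (fun b hb => ha b hb) Real.volume_Ici

/-- The density `t ^ α * exp (- a * t)` on the positive half line. -/
def gammaDensity (α a t : ℝ) : ℝ := if 0 < t then t ^ α * Real.exp (-(a * t)) else 0

theorem gammaDensity_nonneg (α a t : ℝ) : 0 ≤ gammaDensity α a t := by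
  unfold gammaDensity; split_ifs <;> positivity

theorem measurable_gammaDensity (α a : ℝ) : Measurable (gammaDensity α a) :=
  Measurable.ite measurableSet_Ioi (by fun_prop) measurable_const

theorem integrable_gammaDensity_mul {α a : ℝ} (hα : -1 < α) (ha : 0 < a) (N : ℕ) :
    Integrable fun t => gammaDensity α a t * (1 + |t|) ^ N := by
  have h : IntegrableOn (fun t : ℝ => ∑ k ∈ Finset.range (N + 1),
      (N.choose k : ℝ) * (t ^ (α + (N - k : ℕ)) * Real.exp (-a * t ^ (1 : ℝ)))) (Set.Ioi 0) := by
    refine integrable_finsetSum _ fun k _ => Integrable.const_mul ?_ _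
    refine integrableOn_rpow_mul_exp_neg_mul_rpow ?_ one_pos ha
    have : (0 : ℝ) ≤ (N - k : ℕ) := Nat.cast_nonneg _
    linarith
  rw [← integrable_indicator_iff measurableSet_Ioi] at h
  refine h.congr (ae_of_all _ fun t => ?_)
  by_cases ht : 0 < t
  · change _ = gammaDensity α a t * (1 + |t|) ^ N
    rw [Set.indicator_of_mem (show t ∈ Set.Ioi 0 from ht), gammaDensity, if_pos ht, abs_of_pos ht,
      add_pow, Finset.mul_sum]
    refine Finset.sum_congr rfl fun k _ => ?_
    rw [Real.rpow_add ht, Real.rpow_natCast, Real.rpow_one, one_pow]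
    ring_nf
  · change _ = gammaDensity α a t * (1 + |t|) ^ N
    rw [Set.indicator_of_notMem (show t ∉ Set.Ioi 0 from ht), gammaDensity, if_neg ht, zero_mul]

variable {m : ℕ}

/-- The factor of the Vandermonde product at a pair of indices. -/
def pairFactor (β : ℝ) (x : Fin m → ℝ) (p : Fin m × Fin m) : ℝ :=
  if p.1 < p.2 then (max (x p.1 - x p.2) 0) ^ β else 1

/-- The Vandermonde factor of the weight, restricted to nonincreasing vectors. -/
def vandermondePos (β : ℝ) (x : Fin m → ℝ) : ℝ := ∏ p, pairFactor β x p

/-- The density of the ordered eigenvalues, up to normalisation. -/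
def coneDensity (α a β : ℝ) (x : Fin m → ℝ) : ℝ :=
  (∏ j, gammaDensity α a (x j)) * vandermondePos β x

theorem pairFactor_nonneg (β : ℝ) (x : Fin m → ℝ) (p : Fin m × Fin m) : 0 ≤ pairFactor β x p := by
  unfold pairFactor; split_ifs <;> positivity

theorem vandermondePos_nonneg (β : ℝ) (x : Fin m → ℝ) : 0 ≤ vandermondePos β x :=
  Finset.prod_nonneg fun _ _ => pairFactor_nonneg _ _ _

theorem coneDensity_nonneg (α a β : ℝ) (x : Fin m → ℝ) : 0 ≤ coneDensity α a β x :=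
  mul_nonneg (Finset.prod_nonneg fun _ _ => gammaDensity_nonneg _ _ _) (vandermondePos_nonneg _ _)

theorem continuous_vandermondePos {β : ℝ} (hβ : 0 ≤ β) :
    Continuous (vandermondePos (m := m) β) := by
  refine continuous_finsetProd _ fun p _ => ?_
  unfold pairFactor
  split_ifs
  · exact Continuous.rpow_const (by fun_prop) fun _ => Or.inr hβ
  · exact continuous_const

theorem measurable_coneDensity {β : ℝ} (hβ : 0 ≤ β) (α a : ℝ) :
    Measurable (coneDensity (m := m) α a β) :=
  (Finset.measurable_prod _ fun j _ =>
    (measurable_gammaDensity α a).comp (measurable_pi_apply j)).mul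
      (continuous_vandermondePos hβ).measurable

/-- The majorant of polynomials in the coordinates. -/
def growth (x : Fin m → ℝ) : ℝ := ∏ j, (1 + |x j|)

theorem one_le_prod_one_add_abs (x : Fin m → ℝ) (s : Finset (Fin m)) :
    1 ≤ ∏ j ∈ s, (1 + |x j|) := by
  refine (Finset.prod_const_one (s := s)).symm.le.trans ?_
  refine Finset.prod_le_prod (fun _ _ => zero_le_one) fun j _ => ?_
  linarith [abs_nonneg (x j)]

theorem one_le_growth (x : Fin m → ℝ) : 1 ≤ growth x := one_le_prod_one_add_abs x _

theorem abs_le_growth (x : Fin m → ℝ) (i : Fin m) : 1 + |x i| ≤ growth x := by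
  rw [growth, ← Finset.mul_prod_erase _ _ (Finset.mem_univ i)]
  exact le_mul_of_one_le_right (by positivity) (one_le_prod_one_add_abs x _)

theorem abs_eval_le_growth (p : MvPolynomial (Fin m) ℝ) :
    ∃ C : ℝ, 0 ≤ C ∧ ∃ N : ℕ, ∀ x, |MvPolynomial.eval x p| ≤ C * growth x ^ N := by
  induction p using MvPolynomial.induction_on with
  | C c => exact ⟨|c|, abs_nonneg _, 0, fun x => by simp⟩
  | add p q hp hq =>
    obtain ⟨C, hC, N, h⟩ := hp
    obtain ⟨C', hC', N', h'⟩ := hq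
    refine ⟨C + C', by positivity, N + N', fun x => ?_⟩
    have h1 := one_le_growth x
    rw [map_add, add_mul]
    refine (abs_add_le _ _).trans (add_le_add ((h x).trans ?_) ((h' x).trans ?_))
    · gcongr <;> first | exact h1 | omega
    · gcongr <;> first | exact h1 | omega
  | mul_X p i hp =>
    obtain ⟨C, hC, N, h⟩ := hp
    refine ⟨C, hC, N + 1, fun x => ?_⟩
    rw [map_mul, abs_mul, MvPolynomial.eval_X, pow_succ, ← mul_assoc]
    have := abs_le_growth x i
    have := one_le_growth x
    refine mul_le_mul (h x) (by linarith) (abs_nonneg _) (by positivity)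

/-- The majorant `growth` is a product over the coordinates rather than a norm, so the bound factors
into one-variable gamma integrals. -/
theorem integrable_of_le_growth {α a : ℝ} (hα : -1 < α) (ha : 0 < a) {f : (Fin m → ℝ) → ℝ}
    (hf : AEStronglyMeasurable f) (C : ℝ) (N : ℕ)
    (h : ∀ x, |f x| ≤ (∏ j, gammaDensity α a (x j)) * (C * growth x ^ N)) : Integrable f := by
  have : Integrable fun x : Fin m → ℝ =>
      C * ∏ j, (gammaDensity α a (x j) * (1 + |x j|) ^ N) :=
    (Integrable.fintype_prod fun _ => integrable_gammaDensity_mul hα ha N).const_mul C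
  refine this.mono' hf (ae_of_all _ fun x => (h x).trans (le_of_eq ?_))
  rw [growth, ← Finset.prod_pow, Finset.prod_mul_distrib]
  ring

theorem pair_le_growth {γ : ℝ} (hγ : 0 ≤ γ) (x : Fin m → ℝ) (i j : Fin m) :
    |x i - x j| ^ γ ≤ growth x ^ (2 * γ) := by
  have h1 := abs_le_growth x i
  have h2 := abs_le_growth x j
  have h3 := one_le_growth x
  have : |x i - x j| ≤ growth x ^ (2 : ℝ) := by
    have h4 : |x i - x j| ≤ |x i| + |x j| := by
      rw [sub_eq_add_neg, ← abs_neg (x j)]; exact abs_add_le _ _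
    have h5 : (1 + |x i|) * (1 + |x j|) ≤ growth x * growth x := by
      gcongr
    have : growth x ^ (2 : ℝ) = growth x * growth x := by
      rw [Real.rpow_two, sq]
    rw [this]
    nlinarith [mul_nonneg (abs_nonneg (x i)) (abs_nonneg (x j))]
  rw [Real.rpow_mul (by linarith)]
  gcongr

theorem pairFactor_le_growth {β : ℝ} (hβ : 0 ≤ β) (x : Fin m → ℝ) (p : Fin m × Fin m) :
    pairFactor β x p ≤ growth x ^ (2 * β) := by
  unfold pairFactor
  split_ifs
  · refine le_trans ?_ (pair_le_growth hβ x p.1 p.2)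
    gcongr
    exact max_le (le_abs_self _) (abs_nonneg _)
  · exact Real.one_le_rpow (one_le_growth x) (by positivity)

theorem prod_growth_eq (x : Fin m → ℝ) (γ : ℝ) (s : Finset (Fin m × Fin m)) :
    ∏ _p ∈ s, growth x ^ γ = growth x ^ (γ * s.card) := by
  rw [Finset.prod_const, ← Real.rpow_natCast, ← Real.rpow_mul (by linarith [one_le_growth x])]

theorem vandermondePos_le_growth {β : ℝ} (hβ : 0 ≤ β) :
    ∃ N : ℕ, ∀ x : Fin m → ℝ, vandermondePos β x ≤ growth x ^ N := by
  refine ⟨⌈2 * β * (Finset.univ : Finset (Fin m × Fin m)).card⌉₊, fun x => ?_⟩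
  refine (Finset.prod_le_prod (fun p _ => pairFactor_nonneg β x p)
    fun p _ => pairFactor_le_growth hβ x p).trans ?_
  rw [prod_growth_eq, ← Real.rpow_natCast]
  exact Real.rpow_le_rpow_of_exponent_le (one_le_growth x) (Nat.le_ceil _)

/-- The quotient is a power with exponent β - 1, which stays bounded near coinciding coordinates
because β ≥ 1. Where the factor vanishes the quotient is 0. -/
theorem pairFactor_div_le_growth {β : ℝ} (hβ : 1 ≤ β) (x : Fin m → ℝ) {p : Fin m × Fin m}
    (hp : p.1 < p.2) :
    |pairFactor β x p / (x p.1 - x p.2)| ≤ growth x ^ (2 * β) := by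
  have hg := one_le_growth x
  rw [pairFactor, if_pos hp]
  rcases le_or_gt (x p.1 - x p.2) 0 with h | h
  · rw [max_eq_right h, Real.zero_rpow (by linarith), zero_div, abs_zero]
    positivity
  · rw [max_eq_left h.le, ← Real.rpow_sub_one h.ne', abs_of_nonneg (by positivity)]
    refine le_trans ?_ ((pair_le_growth (sub_nonneg.2 hβ) x p.1 p.2).trans ?_)
    · rw [abs_of_pos h]
    · exact Real.rpow_le_rpow_of_exponent_le hg (by linarith)

theorem vandermondePos_div_le_growth {β : ℝ} (hβ : 1 ≤ β) :
    ∃ N : ℕ, ∀ (x : Fin m → ℝ) (i l : Fin m), |vandermondePos β x / (x i - x l)| ≤ growth x ^ N := by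
  refine ⟨⌈2 * β * (Finset.univ : Finset (Fin m × Fin m)).card⌉₊, ?_⟩
  have key : ∀ (x : Fin m → ℝ) (p : Fin m × Fin m), p.1 < p.2 →
      |vandermondePos β x / (x p.1 - x p.2)|
        ≤ growth x ^ ⌈2 * β * (Finset.univ : Finset (Fin m × Fin m)).card⌉₊ := by
    intro x p hp
    rw [← Real.rpow_natCast]
    refine le_trans ?_ (Real.rpow_le_rpow_of_exponent_le (one_le_growth x) (Nat.le_ceil _))
    rw [← prod_growth_eq, ← Finset.mul_prod_erase _ _ (Finset.mem_univ p), vandermondePos,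
      ← Finset.mul_prod_erase _ _ (Finset.mem_univ p), mul_div_right_comm, abs_mul]
    have hg := one_le_growth x
    refine mul_le_mul (pairFactor_div_le_growth hβ x hp) ?_ (abs_nonneg _) (by positivity)
    rw [Finset.abs_prod]
    refine Finset.prod_le_prod (fun _ _ => abs_nonneg _) fun q _ => ?_
    rw [abs_of_nonneg (pairFactor_nonneg β x q)]
    exact pairFactor_le_growth (by linarith) x q
  intro x i l
  rcases lt_trichotomy i l with h | h | h
  · exact key x (i, l) h
  -- On the diagonal the quotient is a division by zero, hence 0 by convention.
  · have hg := one_le_growth x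
    simp only [h, sub_self, div_zero, abs_zero]
    positivity
  · have := key x (l, i) h
    rwa [← abs_neg, ← div_neg, neg_sub] at this

end ConeIntegrals

end

/-! ### Integration by parts on the cone -/

noncomputable section

section ConeByParts

variable {m : ℕ}

/-- The derivatives are kept in logarithmic form c_k f_k, so that no division by a possibly
vanishing factor occurs. -/
theorem hasDerivAt_finset_prod_of_log {κ : Type*} [DecidableEq κ] (s : Finset κ) {f : κ → ℝ → ℝ}
    {c : κ → ℝ} {t : ℝ} (h : ∀ k ∈ s, HasDerivAt (f k) (c k * f k t) t) :
    HasDerivAt (fun t => ∏ k ∈ s, f k t) ((∑ k ∈ s, c k) * ∏ k ∈ s, f k t) t := by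
  have := HasDerivAt.fun_finsetProd h
  refine this.congr_deriv ?_
  rw [Finset.sum_mul]
  refine Finset.sum_congr rfl fun k hk => ?_
  rw [← Finset.mul_prod_erase _ _ hk, smul_eq_mul]
  ring

theorem hasDerivAt_update {x : Fin m → ℝ} {i : Fin m} (k : Fin m) (t : ℝ) :
    HasDerivAt (fun t => Function.update x i t k) (if k = i then 1 else 0) t := by
  by_cases h : k = i
  · subst h
    simp only [Function.update_self, if_true]
    exact hasDerivAt_id t
  · simp only [Function.update_of_ne h, if_neg h]
    exact hasDerivAt_const _ _

theorem hasDerivAt_eval_update (p : MvPolynomial (Fin m) ℝ) (x : Fin m → ℝ) (i : Fin m) (t : ℝ) :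
    HasDerivAt (fun t => MvPolynomial.eval (Function.update x i t) p)
      (MvPolynomial.eval (Function.update x i t) (MvPolynomial.pderiv i p)) t := by
  induction p using MvPolynomial.induction_on with
  | C c => simpa using hasDerivAt_const t c
  | add p q hp hq => simp only [map_add]; exact hp.add hq
  | mul_X p k hp =>
    simp only [map_mul, MvPolynomial.eval_X]
    refine (hp.mul (hasDerivAt_update k t)).congr_deriv ?_
    rw [MvPolynomial.pderiv_mul, MvPolynomial.pderiv_X, map_add, map_mul, map_mul,
      MvPolynomial.eval_X]
    by_cases h : k = i
    · subst h; simp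
    · simp [h]

/-- Away from coinciding coordinates the truncated power is locally either 0 or a genuine power. At
a coincidence it may have a corner, as for β = 1, so these finitely many t are excluded. -/
theorem hasDerivAt_pairFactor {β : ℝ} (hβ : 0 < β) (x : Fin m → ℝ) (i : Fin m) {t : ℝ}
    (ht : ∀ l, l ≠ i → t ≠ x l) (p : Fin m × Fin m) :
    HasDerivAt (fun t => pairFactor β (Function.update x i t) p)
      ((if p.1 < p.2 then β * ((if p.1 = i then 1 else 0) - (if p.2 = i then 1 else 0)) /
        (Function.update x i t p.1 - Function.update x i t p.2) else 0) *
        pairFactor β (Function.update x i t) p) t := by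
  unfold pairFactor
  by_cases hp : p.1 < p.2
  swap
  · simpa only [if_neg hp, zero_mul] using hasDerivAt_const t (1 : ℝ)
  simp only [if_pos hp]
  set u : ℝ → ℝ := fun t => Function.update x i t p.1 - Function.update x i t p.2 with hu
  set c : ℝ := (if p.1 = i then 1 else 0) - (if p.2 = i then 1 else 0) with hc
  have hd : HasDerivAt u c t := (hasDerivAt_update p.1 t).sub (hasDerivAt_update p.2 t)
  change HasDerivAt (fun t => max (u t) 0 ^ β) (β * c / u t * max (u t) 0 ^ β) t
  by_cases hi : p.1 ≠ i ∧ p.2 ≠ i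
  · have h0 : c = 0 := by simp [hc, hi.1, hi.2]
    have h1 : u = fun _ => x p.1 - x p.2 := by
      funext t
      simp [hu, hi.1, hi.2]
    rw [h0, h1]
    simpa using hasDerivAt_const t _
  have hne : u t ≠ 0 := by
    by_cases h1 : p.1 = i
    · have h2 : p.2 ≠ i := fun h => hp.ne (h1.trans h.symm)
      have := ht p.2 h2
      simp [hu, h1, h2, sub_eq_zero, this]
    · have h2 : p.2 = i := by
        by_contra h2
        exact hi ⟨h1, h2⟩
      have := ht p.1 h1
      simp [hu, h1, h2, sub_eq_zero, this.symm]
  rcases lt_or_gt_of_ne hne with h | h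
  · have h2 : (fun t => max (u t) 0 ^ β) =ᶠ[𝓝 t] fun _ => 0 := by
      filter_upwards [hd.continuousAt.eventually_lt continuousAt_const h] with s hs
      rw [max_eq_right hs.le, Real.zero_rpow hβ.ne']
    refine ((hasDerivAt_const t (0 : ℝ)).congr_of_eventuallyEq h2).congr_deriv ?_
    rw [max_eq_right h.le, Real.zero_rpow hβ.ne', mul_zero]
  · have h2 : (fun t => max (u t) 0 ^ β) =ᶠ[𝓝 t] fun t => u t ^ β := by
      filter_upwards [continuousAt_const.eventually_lt hd.continuousAt h] with s hs
      rw [max_eq_left (le_of_lt hs)]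
    refine ((hd.rpow_const (p := β) (Or.inl h.ne')).congr_of_eventuallyEq h2).congr_deriv ?_
    rw [max_eq_left h.le, Real.rpow_sub_one h.ne']
    ring

/-- Only pairs containing i contribute. Swapping the order of a pair changes two signs, so both
kinds give β / (x_i - x_l); the term l = i on the right is a division by zero and equals 0. -/
theorem sum_pair_log_deriv (β : ℝ) (x : Fin m → ℝ) (i : Fin m) :
    ∑ p : Fin m × Fin m, (if p.1 < p.2 then
      β * ((if p.1 = i then 1 else 0) - (if p.2 = i then 1 else 0)) / (x p.1 - x p.2) else 0)
      = ∑ l, β / (x i - x l) := by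
  have h : ∀ p : Fin m × Fin m, (if p.1 < p.2 then
      β * ((if p.1 = i then 1 else 0) - (if p.2 = i then 1 else 0)) / (x p.1 - x p.2) else 0)
      = (if p.1 = i then (if i < p.2 then β / (x i - x p.2) else 0) else 0)
        + (if p.2 = i then (if p.1 < i then β / (x i - x p.1) else 0) else 0) := by
    rintro ⟨a, b⟩
    by_cases ha : a = i <;> by_cases hb : b = i
    · subst ha; subst hb; simp
    · subst ha; simp [hb]
    · subst hb
      simp only [ha, if_false, zero_add, if_true, zero_sub, mul_neg, mul_one]
      rw [← neg_sub (x b), div_neg, neg_div, neg_neg]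
    · simp [ha, hb]
  simp_rw [h]
  rw [Finset.sum_add_distrib, Fintype.sum_prod_type, Fintype.sum_prod_type_right]
  simp only [Finset.sum_ite_irrel, Finset.sum_const_zero, Finset.sum_ite_eq', Finset.mem_univ,
    if_true]
  rw [← Finset.sum_add_distrib]
  refine Finset.sum_congr rfl fun l _ => ?_
  rcases lt_trichotomy i l with h | h | h
  · simp [h, h.not_gt]
  · simp [h]
  · simp [h, h.not_gt]

theorem hasDerivAt_vandermondePos {β : ℝ} (hβ : 0 < β) (x : Fin m → ℝ) (i : Fin m) {t : ℝ}
    (ht : ∀ l, l ≠ i → t ≠ x l) :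
    HasDerivAt (fun t => vandermondePos β (Function.update x i t))
      ((∑ l, β / (t - Function.update x i t l)) * vandermondePos β (Function.update x i t)) t := by
  have := hasDerivAt_finset_prod_of_log Finset.univ
    (fun p _ => hasDerivAt_pairFactor hβ x i ht p)
  rw [sum_pair_log_deriv] at this
  simp only [Function.update_self] at this
  exact this

theorem hasDerivAt_mul_gammaDensity {α a t : ℝ} (ht : 0 < t) :
    HasDerivAt (fun t => t * gammaDensity α a t) ((1 + α - a * t) * gammaDensity α a t) t := by
  have h : (fun t => t * gammaDensity α a t) =ᶠ[𝓝 t]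
      fun t => t ^ (1 + α) * Real.exp (-(a * t)) := by
    filter_upwards [lt_mem_nhds ht] with s hs
    rw [gammaDensity, if_pos hs, Real.rpow_add hs, Real.rpow_one, mul_assoc]
  have h1 : HasDerivAt (fun t : ℝ => -(a * t)) (-a) t :=
    (((hasDerivAt_id t).const_mul a).neg).congr_deriv (by simp)
  refine (((Real.hasDerivAt_rpow_const (p := 1 + α) (Or.inl ht.ne')).mul
    h1.exp).congr_of_eventuallyEq h).congr_deriv ?_
  rw [gammaDensity, if_pos ht, Real.rpow_add ht, Real.rpow_one, add_sub_cancel_left]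
  ring

/-- The extra factor t raises the exponent to 1 + α > 0. Thus there is no boundary term at the
origin, even where the density itself blows up; this is why the vector fields below carry a factor
x_i. -/
theorem continuousOn_mul_gammaDensity {α a : ℝ} (hα : -1 < α) :
    ContinuousOn (fun t => t * gammaDensity α a t) (Set.Ici 0) := by
  have h : Continuous fun t : ℝ => t ^ (1 + α) * Real.exp (-(a * t)) :=
    (continuous_id.rpow_const fun _ => Or.inr (by linarith)).mul (by fun_prop)
  refine h.continuousOn.congr fun t ht => ?_
  rcases eq_or_lt_of_le (Set.mem_Ici.1 ht) with rfl | ht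
  · simp [Real.zero_rpow (by linarith : 1 + α ≠ 0)]
  · simp only
    rw [gammaDensity, if_pos ht, Real.rpow_add ht, Real.rpow_one, mul_assoc]

/-- The divergence of `x_i * p` against the density. -/
def coneDivergence (α a β : ℝ) (i : Fin m) (p : MvPolynomial (Fin m) ℝ) (x : Fin m → ℝ) : ℝ :=
  ((1 + α - a * x i) * MvPolynomial.eval x p + x i * MvPolynomial.eval x (MvPolynomial.pderiv i p))
      * coneDensity α a β x
    + β * ∑ l, x i * MvPolynomial.eval x p * (coneDensity α a β x / (x i - x l))

theorem integrable_eval_mul_coneDensity {α a β : ℝ} (hα : -1 < α) (ha : 0 < a) (hβ : 1 ≤ β)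
    (p : MvPolynomial (Fin m) ℝ) :
    Integrable fun x => MvPolynomial.eval x p * coneDensity α a β x := by
  obtain ⟨C, hC, N, hp⟩ := abs_eval_le_growth p
  obtain ⟨M, hM⟩ := vandermondePos_le_growth (m := m) (zero_le_one.trans hβ)
  refine integrable_of_le_growth hα ha ?_ C (N + M) fun x => ?_
  · exact ((MvPolynomial.continuous_eval p).measurable.mul
      (measurable_coneDensity (zero_le_one.trans hβ) α a)).aestronglyMeasurable
  · have hg : 0 ≤ ∏ j, gammaDensity α a (x j) :=
      Finset.prod_nonneg fun _ _ => gammaDensity_nonneg _ _ _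
    have h1 := one_le_growth x
    rw [coneDensity, abs_mul, abs_mul, abs_of_nonneg hg,
      abs_of_nonneg (vandermondePos_nonneg β x), mul_left_comm, pow_add, ← mul_assoc C]
    exact mul_le_mul_of_nonneg_left (mul_le_mul (hp x) (hM x) (vandermondePos_nonneg _ _)
      (by positivity)) hg

theorem integrable_eval_mul_coneDensity_div {α a β : ℝ} (hα : -1 < α) (ha : 0 < a) (hβ : 1 ≤ β)
    (p : MvPolynomial (Fin m) ℝ) (i l : Fin m) :
    Integrable fun x => MvPolynomial.eval x p * (coneDensity α a β x / (x i - x l)) := by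
  obtain ⟨C, hC, N, hp⟩ := abs_eval_le_growth p
  obtain ⟨M, hM⟩ := vandermondePos_div_le_growth (m := m) hβ
  refine integrable_of_le_growth hα ha ?_ C (N + M) fun x => ?_
  · exact ((MvPolynomial.continuous_eval p).measurable.mul
      ((measurable_coneDensity (zero_le_one.trans hβ) α a).div
        (by fun_prop))).aestronglyMeasurable
  · have hg : 0 ≤ ∏ j, gammaDensity α a (x j) :=
      Finset.prod_nonneg fun _ _ => gammaDensity_nonneg _ _ _
    have h1 := one_le_growth x
    rw [coneDensity, mul_div_assoc, abs_mul, abs_mul, abs_of_nonneg hg, mul_left_comm, pow_add,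
      ← mul_assoc C]
    exact mul_le_mul_of_nonneg_left (mul_le_mul (hp x) (hM x i l) (abs_nonneg _)
      (by positivity)) hg

theorem integrable_coneDivergence {α a β : ℝ} (hα : -1 < α) (ha : 0 < a) (hβ : 1 ≤ β)
    (p : MvPolynomial (Fin m) ℝ) (i : Fin m) : Integrable (coneDivergence α a β i p) := by
  refine Integrable.add ?_ (Integrable.const_mul (integrable_finsetSum _ fun l _ => ?_) _)
  · have := integrable_eval_mul_coneDensity hα ha hβ
      ((MvPolynomial.C (1 + α) - MvPolynomial.C a * MvPolynomial.X i) * p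
        + MvPolynomial.X i * MvPolynomial.pderiv i p)
    simpa using this
  · have := integrable_eval_mul_coneDensity_div hα ha hβ (MvPolynomial.X i * p) i l
    simpa using this

/-- An integrable function whose integral along a coordinate always vanishes has integral zero. -/
theorem integral_eq_zero_of_update {f g : (Fin m → ℝ) → ℝ} (hf : Integrable f) (hg : Integrable g)
    (i : Fin m) (h : ∀ x, Integrable (fun t => f (Function.update x i t)) →
      Integrable (fun t => g (Function.update x i t)) →
      ∫ t, f (Function.update x i t) = 0) : ∫ x, f x = 0 := by
  obtain _ | k := m
  · exact i.elim0
  have hmp := (volume_preserving_piFinSuccAbove (fun _ : Fin (k + 1) => ℝ) i).symm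
  have hi : ∀ f : (Fin (k + 1) → ℝ) → ℝ, Integrable f → Integrable (fun q : ℝ × (Fin k → ℝ) =>
      f ((MeasurableEquiv.piFinSuccAbove (fun _ : Fin (k + 1) => ℝ) i).symm q))
      (volume.prod volume) := fun f hf =>
    (hmp.integrable_comp_emb (MeasurableEquiv.measurableEmbedding _)).2 hf
  rw [← hmp.integral_comp (MeasurableEquiv.measurableEmbedding _)]
  rw [Measure.volume_eq_prod, integral_prod_symm _ (hi f hf)]
  refine integral_eq_zero_of_ae ?_
  filter_upwards [(hi f hf).prod_left_ae, (hi g hg).prod_left_ae] with y hy hy'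
  have e : ∀ t : ℝ, (MeasurableEquiv.piFinSuccAbove (fun _ : Fin (k + 1) => ℝ) i).symm (t, y)
      = Function.update (i.insertNth 0 y : Fin (k + 1) → ℝ) i t := by
    intro t
    rw [MeasurableEquiv.piFinSuccAbove_symm_apply]
    simp [Fin.insertNthEquiv]
  simp only [e] at hy hy' ⊢
  exact h _ hy hy'

/-- Along each line in the i-th direction `coneDivergence` is the derivative of x_i p times the
density. That primitive must be integrable along the line too, and it is the second function passed
to `integral_eq_zero_of_update`. -/
theorem integral_coneDivergence {α a β : ℝ} (hα : -1 < α) (ha : 0 < a) (hβ : 1 ≤ β)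
    (p : MvPolynomial (Fin m) ℝ) (i : Fin m) : ∫ x, coneDivergence α a β i p x = 0 := by
  have hβ0 : 0 < β := by linarith
  refine integral_eq_zero_of_update (integrable_coneDivergence hα ha hβ p i)
    (integrable_eval_mul_coneDensity hα ha hβ (MvPolynomial.X i * p)) i fun x hx hx' => ?_
  set c : ℝ := ∏ j ∈ Finset.univ.erase i, gammaDensity α a (x j) with hc
  have hG : ∀ t, coneDensity α a β (Function.update x i t)
      = gammaDensity α a t * (c * vandermondePos β (Function.update x i t)) := by
    intro t
    rw [coneDensity, ← Finset.mul_prod_erase _ _ (Finset.mem_univ i), Function.update_self, hc,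
      mul_assoc]
    congr 2
    exact Finset.prod_congr rfl fun j hj => by
      rw [Function.update_of_ne (Finset.ne_of_mem_erase hj)]
  have hF : (fun t => MvPolynomial.eval (Function.update x i t) (MvPolynomial.X i * p) *
      coneDensity α a β (Function.update x i t)) = fun t => (t * gammaDensity α a t) *
        MvPolynomial.eval (Function.update x i t) p *
        (c * vandermondePos β (Function.update x i t)) := by
    funext t
    rw [hG, map_mul, MvPolynomial.eval_X, Function.update_self]
    ring
  rw [hF] at hx'
  have hu : Continuous fun t => Function.update x i t := continuous_const.update i continuous_id
  rw [← setIntegral_eq_integral_of_forall_compl_eq_zero (s := Set.Ioi 0)]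
  -- The exceptional set contains all values at which the moving coordinate meets another one.
  · refine integral_Ioi_eq_zero_of_hasDerivAt (Set.finite_range x).countable ?_ ?_ ?_
      hx'.integrableOn hx.integrableOn
    · exact ((continuousOn_mul_gammaDensity hα).mul
        ((MvPolynomial.continuous_eval p).comp hu).continuousOn).mul
        (((continuous_vandermondePos hβ0.le).comp hu).const_smul c).continuousOn
    · simp
    · intro t ht hts
      have hv := hasDerivAt_vandermondePos hβ0 x i (t := t) fun l _ h => hts ⟨l, h.symm⟩
      refine (((hasDerivAt_mul_gammaDensity ht).mul (hasDerivAt_eval_update p x i t)).mul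
        (hv.const_mul c)).congr_deriv ?_
      simp only [coneDivergence, hG, Function.update_self, Pi.mul_apply]
      have : β * ∑ l, t * MvPolynomial.eval (Function.update x i t) p * (gammaDensity α a t *
          (c * vandermondePos β (Function.update x i t)) / (t - Function.update x i t l))
          = t * MvPolynomial.eval (Function.update x i t) p * (gammaDensity α a t *
          (c * vandermondePos β (Function.update x i t))) *
            ∑ l, β / (t - Function.update x i t l) := by
        rw [Finset.mul_sum, Finset.mul_sum]
        exact Finset.sum_congr rfl fun l _ => by ring
      rw [this]
      ring
  · intro t ht
    have h0 : gammaDensity α a t = 0 := if_neg ht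
    simp [coneDivergence, hG, h0]

end ConeByParts

end

/-! ### Loop equations for the density on the cone -/

noncomputable section

section ConeLoopEquations

open MvPolynomial

theorem LoopEquations.comp {F F' : Type*} [AddCommGroup F] [Module ℝ F] [AddCommGroup F']
    [Module ℝ F'] {m : ℕ} {d ε : ℝ} {L : MvPolynomial ℕ ℝ →ₗ[ℝ] F} (h : LoopEquations m d ε L)
    (T : F →ₗ[ℝ] F') : LoopEquations m d ε (T ∘ₗ L) where
  zero Q := by simp only [LinearMap.comp_apply, h.zero, map_smul]
  succ j l := by simp only [LinearMap.comp_apply, h.succ]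

variable {m : ℕ}

/-- The substitution of power sums. -/
def powerSums (m : ℕ) : MvPolynomial ℕ ℝ →ₐ[ℝ] MvPolynomial (Fin m) ℝ :=
  aeval fun k => psum (Fin m) ℝ k

theorem eval_powerSums (x : Fin m → ℝ) (q : MvPolynomial ℕ ℝ) :
    eval x (powerSums m q) = eval (fun k => ∑ i, x i ^ k) q := by
  rw [powerSums, ← MvPolynomial.aeval_eq_eval, ← MvPolynomial.aeval_eq_eval]
  change aeval x (aeval _ q) = _
  rw [MvPolynomial.comp_aeval_apply]
  simp [psum]

theorem powerSums_powerShift (j : ℕ) (q : MvPolynomial ℕ ℝ) :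
    ∑ i, X i ^ (j + 1) * pderiv i (powerSums m q) = powerSums m (powerShift j q) := by
  induction q using MvPolynomial.induction_on with
  | C c => simp [powerSums, ← MvPolynomial.algebraMap_eq]
  | add p q hp hq => simp only [map_add, mul_add, Finset.sum_add_distrib, hp, hq]
  | mul_X p l hp =>
    have hX : ∑ i, X i ^ (j + 1) * pderiv i (powerSums m (X l)) = powerSums m (powerShift j (X l)) := by
      rw [powerShift_X, map_mul]
      simp only [powerSums, aeval_X, psum, map_sum, aeval_C, Finset.mul_sum]
      refine Finset.sum_congr rfl fun i _ => ?_
      rw [Finset.sum_eq_single i]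
      · rw [pderiv_pow, pderiv_X_self, MvPolynomial.algebraMap_eq, map_natCast]
        rcases l with _ | l
        · simp
        · rw [Nat.add_sub_cancel]
          ring
      · intro b _ hb
        rw [pderiv_pow, pderiv_X_of_ne hb, mul_zero, mul_zero]
      · simp
    rw [Derivation.leibniz, map_mul, map_add, smul_eq_mul, smul_eq_mul, map_mul, map_mul, ← hp,
      ← hX, Finset.mul_sum, Finset.mul_sum, ← Finset.sum_add_distrib]
    refine Finset.sum_congr rfl fun i _ => ?_
    rw [pderiv_mul]
    ring

theorem vandermondePos_eq_zero {β : ℝ} (hβ : β ≠ 0) {x : Fin m → ℝ} (hx : ¬ Function.Injective x) :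
    vandermondePos β x = 0 := by
  have : ∃ i l, i < l ∧ x i = x l := by
    simp only [Function.Injective, not_forall] at hx
    obtain ⟨i, l, h, hne⟩ := hx
    rcases lt_or_gt_of_ne hne with h' | h'
    · exact ⟨i, l, h', h⟩
    · exact ⟨l, i, h', h.symm⟩
  obtain ⟨i, l, hil, h⟩ := this
  refine Finset.prod_eq_zero (Finset.mem_univ (i, l)) ?_
  simp [pairFactor, hil, h, Real.zero_rpow hβ]

/-- Symmetrise in (i, l): off the diagonal, (x_i^{j+1} - x_l^{j+1}) / (x_i - x_l) is a geometric
sum. On the diagonal the left side is 0 by convention, while the geometric sum would be (j + 1)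
x_i^j; this is the correction term. -/
theorem sum_pow_div_sub {x : Fin m → ℝ} (hx : Function.Injective x) (j : ℕ) :
    2 * ∑ i, ∑ l, x i ^ (j + 1) / (x i - x l)
      = ∑ r ∈ Finset.range (j + 1), (∑ i, x i ^ r) * (∑ l, x l ^ (j - r))
        - (j + 1) * ∑ i, x i ^ j := by
  have h : ∀ i l, x i ^ (j + 1) / (x i - x l) + x l ^ (j + 1) / (x l - x i)
      = ∑ r ∈ Finset.range (j + 1), x i ^ r * x l ^ (j - r)
        - if i = l then (j + 1) * x i ^ j else 0 := by
    intro i l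
    by_cases hil : i = l
    · subst hil
      have : ∀ r ∈ Finset.range (j + 1), x i ^ r * x i ^ (j - r) = x i ^ j := fun r hr => by
        rw [← pow_add, Nat.add_sub_cancel' (by simpa [Nat.lt_succ_iff] using hr)]
      rw [Finset.sum_congr rfl this]
      simp
    · have hne : x i - x l ≠ 0 := sub_ne_zero.2 fun h => hil (hx h)
      have := geom_sum₂_mul (x i) (x l) (j + 1)
      rw [if_neg hil, sub_zero, ← neg_sub (x i) (x l), div_neg, ← sub_eq_add_neg, ← sub_div,
        ← this, Nat.add_sub_cancel, mul_div_cancel_right₀ _ hne]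
  rw [two_mul]
  nth_rewrite 2 [Finset.sum_comm]
  rw [← Finset.sum_add_distrib]
  simp_rw [← Finset.sum_add_distrib, h, Finset.sum_sub_distrib, Finset.sum_mul_sum]
  congr 1
  · rw [Finset.sum_comm (s := Finset.range (j + 1))]
    exact Finset.sum_congr rfl fun i _ => Finset.sum_comm
  · simp [Finset.mul_sum]

/-- Summing over i makes the singular terms symmetric, so that they become polynomial in the power
sums. The diagonal correction accounts for -β/2 (j + 1) in the linear coefficient. -/
theorem sum_coneDivergence {α a β : ℝ} (hβ : β ≠ 0) (j : ℕ) (q : MvPolynomial ℕ ℝ)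
    (x : Fin m → ℝ) :
    ∑ i, coneDivergence α a β i (X i ^ j * powerSums m q) x =
      eval x (powerSums m (C (j + 1 + α - β / 2 * (j + 1)) * (X j * q)
        + C (β / 2) * ∑ r ∈ Finset.range (j + 1), X r * X (j - r) * q
        + powerShift j q - C a * (X (j + 1) * q))) * coneDensity α a β x := by
  have hp : ∀ k, eval x (powerSums m (X k)) = ∑ i, x i ^ k := fun k => by
    simp [eval_powerSums]
  have hC : ∀ c, eval x (powerSums m (C c)) = c := fun c => by simp [eval_powerSums]
  have h1 : ∑ i, x i ^ (j + 1) * eval x (pderiv i (powerSums m q))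
      = eval x (powerSums m (powerShift j q)) := by
    rw [← powerSums_powerShift, map_sum]
    simp
  have h2 : (∑ i, ∑ l, x i ^ (j + 1) * (coneDensity α a β x / (x i - x l)))
      = coneDensity α a β x * (2⁻¹ * (∑ r ∈ Finset.range (j + 1), (∑ i, x i ^ r) *
        (∑ l, x l ^ (j - r)) - (j + 1) * ∑ i, x i ^ j)) := by
    -- If two coordinates coincide the density vanishes and both sides are 0.
    by_cases hx : Function.Injective x
    · rw [← sum_pow_div_sub hx, inv_mul_cancel_left₀ two_ne_zero, Finset.mul_sum]
      refine Finset.sum_congr rfl fun i _ => ?_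
      rw [Finset.mul_sum]
      exact Finset.sum_congr rfl fun l _ => by ring
    · simp [coneDensity, vandermondePos_eq_zero hβ hx]
  have h3 : ∀ i, x i * eval x (pderiv i (X i ^ j * powerSums m q))
      = j * x i ^ j * eval x (powerSums m q)
        + x i ^ (j + 1) * eval x (pderiv i (powerSums m q)) := by
    intro i
    rw [pderiv_mul, pderiv_pow, pderiv_X_self]
    rcases j with _ | j
    · simp
    · simp
      ring
  have h4 : ∀ i, coneDivergence α a β i (X i ^ j * powerSums m q) x
      = ((1 + α + j) * eval x (powerSums m q) * x i ^ j
        - a * eval x (powerSums m q) * x i ^ (j + 1)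
        + x i ^ (j + 1) * eval x (pderiv i (powerSums m q))) * coneDensity α a β x
        + β * eval x (powerSums m q) * ∑ l, x i ^ (j + 1) * (coneDensity α a β x / (x i - x l)) := by
    intro i
    have h5 : ∑ l, x i * eval x (X i ^ j * powerSums m q) * (coneDensity α a β x / (x i - x l))
        = eval x (powerSums m q) * ∑ l, x i ^ (j + 1) * (coneDensity α a β x / (x i - x l)) := by
      rw [map_mul, map_pow, eval_X, Finset.mul_sum]
      exact Finset.sum_congr rfl fun l _ => by ring
    rw [coneDivergence, h3, h5, map_mul, map_pow, eval_X]
    ring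
  simp_rw [h4]
  rw [Finset.sum_add_distrib, ← Finset.sum_mul, ← Finset.mul_sum, h2, Finset.sum_add_distrib,
    Finset.sum_sub_distrib, ← Finset.mul_sum, ← Finset.mul_sum, h1]
  simp only [map_add, map_sub, map_mul, map_sum, hp, hC, ← Finset.sum_mul]
  ring

/-- The integral of a symmetric polynomial against the density on the cone. -/
def coneIntegral {α a β : ℝ} (hα : -1 < α) (ha : 0 < a) (hβ : 1 ≤ β) (m : ℕ) :
    MvPolynomial ℕ ℝ →ₗ[ℝ] ℝ where
  toFun q := ∫ x, eval x (powerSums m q) * coneDensity α a β x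
  map_add' p q := by
    simp only [map_add, add_mul]
    exact integral_add (integrable_eval_mul_coneDensity hα ha hβ _)
      (integrable_eval_mul_coneDensity hα ha hβ _)
  map_smul' c p := by
    simp only [map_smul, smul_eval, mul_assoc, RingHom.id_apply, smul_eq_mul]
    exact integral_const_mul _ _

/-- The vanishing total divergence is multiplied by 2/β. With rate a = β/2 the leading coefficient
becomes 1, and the given α makes the linear coefficient exactly d + (2/β - 1) j. -/
theorem coneIntegral_loopEquations {α β d : ℝ} (hα : -1 < α) (hβ : 1 ≤ β) (ha : 0 < β / 2)
    (hd : α = β / 2 * (d + 1) - 1) (m : ℕ) :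
    LoopEquations m d (2 / β - 1) (coneIntegral hα ha hβ m) where
  zero Q := by
    simp only [coneIntegral, LinearMap.coe_mk, AddHom.coe_mk, eval_powerSums, map_mul, eval_X,
      pow_zero, smul_eq_mul, mul_assoc]
    simp [integral_const_mul]
  succ j l := by
    have hβ0 : β ≠ 0 := by linarith
    set Q := listMon l
    have h : coneIntegral hα ha hβ m (C (j + 1 + α - β / 2 * (j + 1)) * (X j * Q)
        + C (β / 2) * ∑ r ∈ Finset.range (j + 1), X r * X (j - r) * Q
        + powerShift j Q - C (β / 2) * (X (j + 1) * Q)) = 0 := by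
      simp only [coneIntegral, LinearMap.coe_mk, AddHom.coe_mk]
      simp_rw [← sum_coneDivergence hβ0]
      rw [integral_finsetSum _ fun i _ => integrable_coneDivergence hα ha hβ _ _]
      exact Finset.sum_eq_zero fun i _ => integral_coneDivergence hα ha hβ _ _
    rw [map_sub, sub_eq_zero, C_mul' (a := β / 2) (p := X (j + 1) * Q), map_smul] at h
    have c1 : d + (2 / β - 1) * j = 2 / β * (j + 1 + α - β / 2 * (j + 1)) := by
      rw [hd]
      field_simp
      ring
    have c2 : (C (2 / β) * C (β / 2) : MvPolynomial ℕ ℝ) = 1 := by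
      rw [← C_mul, show 2 / β * (β / 2) = 1 by field_simp, C_1]
    have c3 : (1 : ℝ) + (2 / β - 1) = 2 / β := by ring
    have e : C (d + (2 / β - 1) * j) * (X j * Q)
        + ∑ r ∈ Finset.range (j + 1), X r * X (j - r) * Q + C (1 + (2 / β - 1)) * powerShift j Q
        = C (2 / β) * (C (j + 1 + α - β / 2 * (j + 1)) * (X j * Q)
          + C (β / 2) * ∑ r ∈ Finset.range (j + 1), X r * X (j - r) * Q + powerShift j Q) := by
      rw [c1, c3, C_mul]
      linear_combination (-(∑ r ∈ Finset.range (j + 1), X r * X (j - r) * Q)) * c2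
    rw [e, C_mul', map_smul, h, smul_smul, show 2 / β * (β / 2) = 1 by field_simp, one_smul]

end ConeLoopEquations

end

/-! ### Separating the trace from the simplex -/

noncomputable section

section SimplexDecomposition

open scoped ENNReal

theorem sum_simplexPoint (k : ℕ) (u : Fin k → ℝ) : ∑ j, simplexPoint (k + 1) u j = 1 := by
  rw [Fin.sum_univ_castSucc]
  simp [simplexPoint]

theorem insertNth_last_eq_smul (k : ℕ) (t : ℝ) (v : Fin k → ℝ) :
    ((Fin.last k).insertNth (t - ∑ l, (t • v) l) (t • v) : Fin (k + 1) → ℝ)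
      = t • simplexPoint (k + 1) v := by
  funext j
  refine Fin.lastCases ?_ (fun l => ?_) j
  · simp [simplexPoint, mul_sub, Finset.mul_sum]
  · rw [Fin.insertNth_last']
    simp [simplexPoint]

theorem lintegral_comp_smul_of_pos {k : ℕ} {t : ℝ} (ht : 0 < t) {g : (Fin k → ℝ) → ℝ≥0∞}
    (hg : Measurable g) :
    ∫⁻ u, g u = ENNReal.ofReal (t ^ k) * ∫⁻ v, g (t • v) := by
  have h := Measure.map_addHaar_smul (volume : Measure (Fin k → ℝ)) ht.ne'
  rw [← lintegral_map (f := g) hg (measurable_const_smul t), h, lintegral_smul_measure, smul_eq_mul,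
    ← mul_assoc, ← ENNReal.ofReal_mul (by positivity), Module.finrank_fin_fun,
    abs_of_pos (by positivity), mul_inv_cancel₀ (by positivity), ENNReal.ofReal_one, one_mul]

/-- Integration in the coordinates `t = ∑ x_j` and `x / t`. -/
theorem lintegral_eq_lintegral_hyperplane (k : ℕ) {f : (Fin (k + 1) → ℝ) → ℝ≥0∞}
    (hf : Measurable f) (h0 : ∀ x, ∑ j, x j ≤ 0 → f x = 0) :
    ∫⁻ x, f x = ∫⁻ t in Set.Ioi (0 : ℝ), ENNReal.ofReal (t ^ k) *
      ∫⁻ y, f (t • y) ∂hyperplaneMeasure (k + 1) := by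
  have hmp := (volume_preserving_piFinSuccAbove (fun _ : Fin (k + 1) => ℝ) (Fin.last k)).symm
  have hm : Measurable fun q : ℝ × (Fin k → ℝ) =>
      ((Fin.last k).insertNth q.1 q.2 : Fin (k + 1) → ℝ) :=
    (MeasurableEquiv.piFinSuccAbove (fun _ : Fin (k + 1) => ℝ) (Fin.last k)).symm.measurable
  have h1 : ∫⁻ x, f x = ∫⁻ u : Fin k → ℝ, ∫⁻ s : ℝ, f ((Fin.last k).insertNth s u) := by
    rw [← hmp.lintegral_comp_emb (MeasurableEquiv.measurableEmbedding _), Measure.volume_eq_prod,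
      lintegral_prod_symm]
    · rfl
    · exact (hf.comp hm).aemeasurable
  -- A translation in the last coordinate makes the total t the new variable, with unit Jacobian.
  have h2 : ∀ u : Fin k → ℝ, ∫⁻ s : ℝ, f ((Fin.last k).insertNth s u)
      = ∫⁻ t : ℝ, f ((Fin.last k).insertNth (t - ∑ l, u l) u) := fun u =>
    (lintegral_sub_right_eq_self (fun s => f ((Fin.last k).insertNth s u)) _).symm
  have hm2 : Measurable fun q : (Fin k → ℝ) × ℝ =>
      f ((Fin.last k).insertNth (q.2 - ∑ l, q.1 l) q.1) :=
    hf.comp (hm.comp (by fun_prop : Measurable fun q : (Fin k → ℝ) × ℝ => (q.2 - ∑ l, q.1 l, q.1)))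
  rw [h1]
  simp_rw [h2]
  rw [lintegral_lintegral_swap hm2.aemeasurable, ← lintegral_indicator measurableSet_Ioi]
  refine lintegral_congr fun t => ?_
  by_cases ht : 0 < t
  · rw [Set.indicator_of_mem (show t ∈ Set.Ioi 0 from ht), lintegral_comp_smul_of_pos ht
      (g := fun u => f ((Fin.last k).insertNth (t - ∑ l, u l) u))
      (hm2.comp (measurable_id.prodMk measurable_const)), hyperplaneMeasure,
      lintegral_map (f := fun y => f (t • y)) (hf.comp (measurable_const_smul t))
        (measurable_simplexPoint _)]
    congr 1
    exact lintegral_congr fun v => by rw [insertNth_last_eq_smul]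
  · rw [Set.indicator_of_notMem (show t ∉ Set.Ioi 0 from ht)]
    refine (lintegral_congr fun u => h0 _ ?_).trans lintegral_zero
    rw [Fin.sum_univ_castSucc]
    simpa using ht

/-- The nonincreasing vectors with nonnegative coordinates. -/
def orderedCone (m : ℕ) : Set (Fin m → ℝ) := {x | Antitone x ∧ ∀ j, 0 ≤ x j}

theorem isClosed_orderedCone (m : ℕ) : IsClosed (orderedCone m) := by
  have h : orderedCone m = (⋂ i, ⋂ j, ⋂ _ : i ≤ j, {x | x j ≤ x i}) ∩ ⋂ j, {x | 0 ≤ x j} := by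
    ext x
    simp [orderedCone, Antitone]
  rw [h]
  refine IsClosed.inter (isClosed_iInter fun i => isClosed_iInter fun j => isClosed_iInter fun _ =>
    isClosed_le (by fun_prop) (by fun_prop)) (isClosed_iInter fun j =>
    isClosed_le (by fun_prop) (by fun_prop))

theorem orderedSimplex_eq (m : ℕ) : orderedSimplex m = orderedCone m ∩ {x | ∑ j, x j = 1} := by
  ext x
  simp [orderedSimplex, orderedCone, and_assoc]

theorem isClosed_orderedSimplex (m : ℕ) : IsClosed (orderedSimplex m) := by
  rw [orderedSimplex_eq]
  exact (isClosed_orderedCone m).inter (isClosed_eq (by fun_prop) (by fun_prop))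

theorem smul_mem_orderedCone {m : ℕ} {t : ℝ} (ht : 0 < t) {x : Fin m → ℝ} :
    t • x ∈ orderedCone m ↔ x ∈ orderedCone m := by
  simp [orderedCone, Antitone, ht, mul_nonneg_iff_of_pos_left]

theorem weight_nonneg {β : ℝ} {n m : ℕ} {x : Fin m → ℝ} (hx : ∀ j, 0 ≤ x j) :
    0 ≤ weight β n m x :=
  mul_nonneg (Finset.prod_nonneg fun j _ => Real.rpow_nonneg (hx j) _) (by positivity)

theorem measurable_weight (β : ℝ) (n m : ℕ) : Measurable (weight β n m) := by
  unfold weight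
  fun_prop

/-- The exponent of the weight. -/
def weightExponent (β : ℝ) (n m : ℕ) : ℝ := β / 2 * ((n : ℝ) - m + 1) - 1

/-- The exact degree of homogeneity is irrelevant; the lower bound suffices for the radial gamma
integral to converge at 0. -/
theorem weight_smul (β : ℝ) (hβ : 0 ≤ β) (n m : ℕ) : ∃ κ : ℝ, m * weightExponent β n m ≤ κ ∧
    ∀ (t : ℝ) (x : Fin m → ℝ), 0 < t → (∀ j, 0 ≤ x j) →
      weight β n m (t • x) = t ^ κ * weight β n m x := by
  refine ⟨m * weightExponent β n m + (∑ i : Fin m, (Finset.Ioi i).card : ℕ) * β, ?_, ?_⟩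
  · have : (0 : ℝ) ≤ (∑ i : Fin m, (Finset.Ioi i).card : ℕ) * β := by positivity
    linarith
  intro t x ht hx
  have h1 : ∏ j, (t • x) j ^ weightExponent β n m
      = t ^ (m * weightExponent β n m) * ∏ j, x j ^ weightExponent β n m := by
    simp only [Pi.smul_apply, smul_eq_mul, Real.mul_rpow ht.le (hx _), Finset.prod_mul_distrib,
      Finset.prod_const, Finset.card_univ, Fintype.card_fin]
    rw [mul_comm (m : ℝ), Real.rpow_mul ht.le, Real.rpow_natCast]
  have h2 : ∏ i, ∏ j ∈ Finset.Ioi i, ((t • x) i - (t • x) j)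
      = t ^ (∑ i : Fin m, (Finset.Ioi i).card) * ∏ i, ∏ j ∈ Finset.Ioi i, (x i - x j) := by
    simp only [Pi.smul_apply, smul_eq_mul, ← mul_sub, Finset.prod_mul_distrib, Finset.prod_const,
      Finset.prod_pow_eq_pow_sum]
  have h3 : t ^ (((∑ i : Fin m, (Finset.Ioi i).card : ℕ) : ℝ) * β)
      = (t ^ (∑ i : Fin m, (Finset.Ioi i).card)) ^ β := by
    rw [Real.rpow_mul ht.le, Real.rpow_natCast]
  unfold weight
  rw [← weightExponent, h1, h2, abs_mul, Real.mul_rpow (abs_nonneg _) (abs_nonneg _),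
    abs_of_pos (pow_pos ht _), Real.rpow_add ht, h3]
  ring

/-- Vanishing coordinates are excluded because there `gammaDensity` is 0, whereas the power in
`weight` is 1 when the exponent is 0. They form a null set. -/
theorem coneDensity_eq {β : ℝ} (hβ : 0 < β) (n m : ℕ) (a : ℝ) {x : Fin m → ℝ} (hx : ∀ j, x j ≠ 0) :
    coneDensity (weightExponent β n m) a β x
      = (orderedCone m).indicator (fun x => weight β n m x * Real.exp (-(a * ∑ j, x j))) x := by
  by_cases hpos : ∀ j, 0 < x j
  swap
  · push Not at hpos
    obtain ⟨j, hj⟩ := hpos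
    have : x ∉ orderedCone m := fun h => hx j (le_antisymm hj (h.2 j))
    rw [Set.indicator_of_notMem this, coneDensity,
      Finset.prod_eq_zero (Finset.mem_univ j) (if_neg hj.not_gt), zero_mul]
  by_cases ha : Antitone x
  swap
  · have : ∃ i l, i < l ∧ x i < x l := by
      unfold Antitone at ha
      push Not at ha
      obtain ⟨i, l, h, h'⟩ := ha
      exact ⟨i, l, lt_of_le_of_ne h fun e => by simp [e] at h', h'⟩
    obtain ⟨i, l, hil, h⟩ := this
    rw [Set.indicator_of_notMem (fun h => ha h.1 : x ∉ orderedCone m), coneDensity, vandermondePos,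
      Finset.prod_eq_zero (Finset.mem_univ (i, l)), mul_zero]
    simp [pairFactor, hil, max_eq_right (sub_nonpos.2 h.le), Real.zero_rpow hβ.ne']
  · have hmem : x ∈ orderedCone m := ⟨ha, fun j => (hpos j).le⟩
    rw [Set.indicator_of_mem hmem, coneDensity, weight, ← weightExponent]
    have h1 : ∏ j, gammaDensity (weightExponent β n m) a (x j)
        = (∏ j, x j ^ weightExponent β n m) * Real.exp (-(a * ∑ j, x j)) := by
      simp only [gammaDensity, if_pos (hpos _), Finset.prod_mul_distrib]
      rw [← Real.exp_sum, Finset.sum_neg_distrib, Finset.mul_sum]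
    have h2 : vandermondePos β x = |∏ i, ∏ j ∈ Finset.Ioi i, (x i - x j)| ^ β := by
      rw [vandermondePos, Fintype.prod_prod_type, Finset.abs_prod,
        ← Real.finsetProd_rpow _ _ (fun _ _ => abs_nonneg _)]
      refine Finset.prod_congr rfl fun i _ => ?_
      rw [Finset.abs_prod, ← Real.finsetProd_rpow _ _ (fun _ _ => abs_nonneg _)]
      simp only [pairFactor]
      rw [← Finset.prod_filter]
      refine Finset.prod_congr (by ext; simp) fun l hl => ?_
      rw [Finset.mem_Ioi] at hl
      have := ha hl.le
      rw [max_eq_left (sub_nonneg.2 this), abs_of_nonneg (sub_nonneg.2 this)]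
    rw [h1, h2]
    ring

theorem ae_ne_zero (m : ℕ) : ∀ᵐ x : Fin m → ℝ, ∀ j, x j ≠ 0 := by
  rw [ae_all_iff]
  intro j
  exact compl_mem_ae_iff.2 (Measure.pi_hyperplane (fun _ => volume) j 0)

/-- Integrals of homogeneous functions against the density on the cone are proportional to integrals
over the simplex. -/
theorem lintegral_coneDensity_of_homogeneous {β : ℝ} (hβ : 0 < β) {n m : ℕ} (hm : 0 < m)
    (hα : -1 < weightExponent β n m) {a : ℝ} (ha : 0 < a) (d : ℕ) :
    ∃ c : ℝ≥0∞, c ≠ 0 ∧ c ≠ ∞ ∧ ∀ p : (Fin m → ℝ) → ℝ≥0∞, Measurable p →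
      (∀ (t : ℝ) x, 0 < t → x ∈ orderedCone m → p (t • x) = ENNReal.ofReal (t ^ d) * p x) →
      ∫⁻ x, p x * ENNReal.ofReal (coneDensity (weightExponent β n m) a β x)
        = c * ∫⁻ x in orderedSimplex m, p x * ENNReal.ofReal (weight β n m x)
          ∂hyperplaneMeasure m := by
  obtain ⟨k, rfl⟩ : ∃ k, m = k + 1 := ⟨m - 1, by omega⟩
  obtain ⟨κ, hκ, hw⟩ := weight_smul β hβ.le n (k + 1)
  -- Since κ is at least (k + 1) times an exponent larger than -1, already k + κ > -1.
  have hexp : -1 < k + d + κ := by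
    push_cast at hκ
    have : (0 : ℝ) ≤ d := Nat.cast_nonneg d
    have : (0 : ℝ) ≤ k := Nat.cast_nonneg k
    nlinarith
  have hval : ∫ t in Set.Ioi (0 : ℝ), t ^ (k + d + κ) * Real.exp (-(a * t))
      = (1 / a) ^ (k + d + κ + 1) * Real.Gamma (k + d + κ + 1) := by
    have := Real.integral_rpow_mul_exp_neg_mul_Ioi (a := k + d + κ + 1) (r := a) (by linarith) ha
    simpa using this
  have hpos : 0 < ∫ t in Set.Ioi (0 : ℝ), t ^ (k + d + κ) * Real.exp (-(a * t)) := by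
    rw [hval]
    have := Real.Gamma_pos_of_pos (show 0 < k + d + κ + 1 by linarith)
    positivity
  -- If the function were not integrable its integral would be 0 by convention, against the positive
  -- value just computed.
  have hint : IntegrableOn (fun t : ℝ => t ^ (k + d + κ) * Real.exp (-(a * t))) (Set.Ioi 0) := by
    by_contra h
    rw [integral_undef h] at hpos
    exact lt_irrefl _ hpos
  have hc : ∫⁻ t in Set.Ioi (0 : ℝ), ENNReal.ofReal (t ^ (k + d + κ) * Real.exp (-(a * t)))
      = ENNReal.ofReal (∫ t in Set.Ioi (0 : ℝ), t ^ (k + d + κ) * Real.exp (-(a * t))) := by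
    refine (ofReal_integral_eq_lintegral_ofReal hint ?_).symm
    filter_upwards [self_mem_ae_restrict measurableSet_Ioi] with t ht
    have : 0 < t := ht
    positivity
  refine ⟨∫⁻ t in Set.Ioi (0 : ℝ), ENNReal.ofReal (t ^ (k + d + κ) * Real.exp (-(a * t))), ?_, ?_,
    fun p hp hhom => ?_⟩
  · rw [hc]
    simpa using hpos
  · rw [hc]
    exact ENNReal.ofReal_ne_top
  set S : Set (Fin (k + 1) → ℝ) := orderedCone (k + 1) ∩ {x | 0 < ∑ j, x j}
  have hS : MeasurableSet S := (isClosed_orderedCone _).measurableSet.inter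
    (measurableSet_lt measurable_const (by fun_prop))
  set w : (Fin (k + 1) → ℝ) → ℝ≥0∞ := fun x =>
    p x * ENNReal.ofReal (weight β n (k + 1) x * Real.exp (-(a * ∑ j, x j))) with hwdef
  have hwm : Measurable w := hp.mul
    (((measurable_weight β n (k + 1)).mul (by fun_prop)).ennreal_ofReal)
  have h1 : ∫⁻ x, p x * ENNReal.ofReal (coneDensity (weightExponent β n (k + 1)) a β x)
      = ∫⁻ x, S.indicator w x := by
    refine lintegral_congr_ae ?_
    filter_upwards [ae_ne_zero (k + 1)] with x hx
    rw [coneDensity_eq hβ n (k + 1) a hx]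
    by_cases h : x ∈ orderedCone (k + 1)
    · have hxS : x ∈ S := ⟨h, Finset.sum_pos (fun j _ => lt_of_le_of_ne (h.2 j) (hx j).symm)
        Finset.univ_nonempty⟩
      rw [Set.indicator_of_mem h, Set.indicator_of_mem hxS]
    · rw [Set.indicator_of_notMem h, Set.indicator_of_notMem fun hxS => h hxS.1]
      simp
  rw [h1, lintegral_eq_lintegral_hyperplane k (hwm.indicator hS)
    (fun x hx => Set.indicator_of_notMem (fun h => absurd h.2 (not_lt.2 hx)) _)]
  have hae : ∀ᵐ y ∂hyperplaneMeasure (k + 1), ∑ j, y j = 1 := by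
    rw [hyperplaneMeasure, ae_map_iff (measurable_simplexPoint _).aemeasurable
      (measurableSet_eq_fun (by fun_prop) measurable_const)]
    exact ae_of_all _ fun u => sum_simplexPoint k u
  have h2 : ∀ t ∈ Set.Ioi (0 : ℝ), ENNReal.ofReal (t ^ k) *
      ∫⁻ y, S.indicator w (t • y) ∂hyperplaneMeasure (k + 1)
      = ENNReal.ofReal (t ^ (k + d + κ) * Real.exp (-(a * t))) *
        ∫⁻ x in orderedSimplex (k + 1), p x * ENNReal.ofReal (weight β n (k + 1) x)
          ∂hyperplaneMeasure (k + 1) := by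
    intro t ht
    have ht : 0 < t := ht
    have h3 : ∫⁻ y, S.indicator w (t • y) ∂hyperplaneMeasure (k + 1)
        = ∫⁻ y, ENNReal.ofReal (t ^ d * t ^ κ * Real.exp (-(a * t))) *
          (orderedSimplex (k + 1)).indicator
            (fun x => p x * ENNReal.ofReal (weight β n (k + 1) x)) y
          ∂hyperplaneMeasure (k + 1) := by
      refine lintegral_congr_ae ?_
      filter_upwards [hae] with y hy
      have hsum : ∑ j, (t • y) j = t := by
        simp [← Finset.mul_sum, hy]
      by_cases h : y ∈ orderedCone (k + 1)
      · have hyS : t • y ∈ S := ⟨(smul_mem_orderedCone ht).2 h, by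
          rw [Set.mem_ofPred_eq, hsum]; exact ht⟩
        have hyO : y ∈ orderedSimplex (k + 1) := by
          rw [orderedSimplex_eq]; exact ⟨h, hy⟩
        rw [Set.indicator_of_mem hyS, Set.indicator_of_mem hyO, hwdef]
        simp only
        rw [hhom t y ht h, hw t y ht h.2, hsum,
          ENNReal.ofReal_mul (mul_nonneg (by positivity) (weight_nonneg h.2)),
          ENNReal.ofReal_mul (p := t ^ κ) (by positivity),
          ENNReal.ofReal_mul (p := t ^ d * t ^ κ) (by positivity),
          ENNReal.ofReal_mul (p := t ^ d) (by positivity)]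
        ring
      · have hyS : t • y ∉ S := fun h' => h ((smul_mem_orderedCone ht).1 h'.1)
        have hyO : y ∉ orderedSimplex (k + 1) := by
          rw [orderedSimplex_eq]; exact fun h' => h h'.1
        rw [Set.indicator_of_notMem hyS, Set.indicator_of_notMem hyO, mul_zero]
    have hpw : Measurable fun x => p x * ENNReal.ofReal (weight β n (k + 1) x) :=
      hp.mul (measurable_weight _ _ _).ennreal_ofReal
    rw [h3, lintegral_const_mul _ (hpw.indicator (isClosed_orderedSimplex _).measurableSet), lintegral_indicator
      (isClosed_orderedSimplex _).measurableSet, ← mul_assoc, ← ENNReal.ofReal_mul (by positivity)]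
    congr 2
    rw [Real.rpow_add ht, Real.rpow_add ht, Real.rpow_natCast, Real.rpow_natCast]
    ring
  rw [setLIntegral_congr_fun measurableSet_Ioi h2, lintegral_mul_const]
  fun_prop

theorem lintegral_coneDensity_pos (α a β : ℝ) (hβ : 0 < β) (m : ℕ) :
    0 < ∫⁻ x : Fin m → ℝ, ENNReal.ofReal (coneDensity α a β x) := by
  rw [lintegral_pos_iff_support (measurable_coneDensity hβ.le α a).ennreal_ofReal]
  set U : Set (Fin m → ℝ) := (⋂ j, {x | 0 < x j}) ∩ ⋂ i, ⋂ j, ⋂ _ : i < j, {x | x j < x i}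
  have hU : IsOpen U := by
    refine IsOpen.inter (isOpen_iInter_of_finite fun j => isOpen_lt (by fun_prop) (by fun_prop))
      (isOpen_iInter_of_finite fun i => isOpen_iInter_of_finite fun j =>
        isOpen_iInter_of_finite fun _ => isOpen_lt (by fun_prop) (by fun_prop))
  have hne : U.Nonempty := by
    refine ⟨fun j => (m : ℝ) - j, ?_, ?_⟩
    · simp
    · simp only [Set.mem_iInter, Set.mem_ofPred_eq]
      intro i j hij
      have : (i : ℝ) < j := by exact_mod_cast hij
      linarith
  refine lt_of_lt_of_le (hU.measure_pos volume hne) (measure_mono fun x hx => ?_)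
  simp only [U, Set.mem_inter_iff, Set.mem_iInter, Set.mem_ofPred_eq] at hx
  rw [Function.mem_support, ne_eq, ENNReal.ofReal_eq_zero, not_le]
  refine mul_pos (Finset.prod_pos fun j _ => ?_) (Finset.prod_pos fun p _ => ?_)
  · have := hx.1 j
    rw [gammaDensity, if_pos this]
    positivity
  · unfold pairFactor
    split_ifs with h
    · exact Real.rpow_pos_of_pos (lt_max_of_lt_left (sub_pos.2 (hx.2 _ _ h))) _
    · exact one_pos

theorem neg_one_lt_weightExponent {β : ℝ} (hβ : 0 < β) {n m : ℕ} (hmn : m ≤ n) :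
    -1 < weightExponent β n m := by
  have : (m : ℝ) ≤ n := by exact_mod_cast hmn
  have : 0 < β / 2 * ((n : ℝ) - m + 1) := by
    have : 0 < (n : ℝ) - m + 1 := by linarith
    positivity
  unfold weightExponent
  linarith

/-- Finiteness and positivity are inherited from the density on the cone, through the decomposition
applied to the constant 1 in degree 0. -/
theorem lintegral_simplex_weight {β : ℝ} (hβ : 1 ≤ β) {n m : ℕ} (hm : 0 < m) (hmn : m ≤ n) :
    ∫⁻ x in orderedSimplex m, ENNReal.ofReal (weight β n m x) ∂hyperplaneMeasure m ≠ 0 ∧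
    ∫⁻ x in orderedSimplex m, ENNReal.ofReal (weight β n m x) ∂hyperplaneMeasure m ≠ ∞ := by
  have hβ0 : 0 < β := by linarith
  have hα := neg_one_lt_weightExponent hβ0 hmn
  obtain ⟨c, hc0, hct, hc⟩ := lintegral_coneDensity_of_homogeneous hβ0 hm hα one_pos 0
  have h := hc (fun _ => 1) measurable_const (by simp)
  simp only [one_mul] at h
  have hpos := lintegral_coneDensity_pos (weightExponent β n m) 1 β hβ0 m
  have hfin : ∫⁻ x : Fin m → ℝ, ENNReal.ofReal (coneDensity (weightExponent β n m) 1 β x) ≠ ∞ := by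
    have := integrable_eval_mul_coneDensity (m := m) hα one_pos hβ 1
    simp only [map_one, one_mul] at this
    exact ((hasFiniteIntegral_iff_ofReal (ae_of_all _ fun x => coneDensity_nonneg _ _ _ _)).1
      this.2).ne
  rw [h] at hpos hfin
  refine ⟨fun h0 => by simp [h0] at hpos, fun h0 => hfin ?_⟩
  rw [h0, ENNReal.mul_top hc0]

theorem ae_mem_orderedSimplex (m : ℕ) :
    ∀ᵐ x ∂(hyperplaneMeasure m).restrict (orderedSimplex m), x ∈ orderedSimplex m :=
  self_mem_ae_restrict (isClosed_orderedSimplex m).measurableSet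

theorem le_one_of_mem_orderedSimplex {m : ℕ} {x : Fin m → ℝ} (hx : x ∈ orderedSimplex m)
    (i : Fin m) : x i ≤ 1 := by
  rw [← hx.2.2]
  exact Finset.single_le_sum (fun j _ => hx.2.1 j) (Finset.mem_univ i)

theorem integrableOn_weight {β : ℝ} (hβ : 1 ≤ β) {n m : ℕ} (hm : 0 < m) (hmn : m ≤ n) :
    IntegrableOn (weight β n m) (orderedSimplex m) (hyperplaneMeasure m) := by
  refine ⟨(measurable_weight β n m).aestronglyMeasurable, ?_⟩
  rw [hasFiniteIntegral_iff_ofReal]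
  · exact (lintegral_simplex_weight hβ hm hmn).2.lt_top
  · filter_upwards [ae_mem_orderedSimplex m] with x hx using weight_nonneg hx.2.1

theorem zetaWellDefined {β : ℝ} (hβ : 1 ≤ β) {n m : ℕ} (hmn : m ≤ n) (i : Fin m) :
    ZetaWellDefined β n m i := by
  have hm : 0 < m := i.pos
  have h := integrableOn_weight hβ hm hmn
  refine ⟨h, ?_, ?_⟩
  · refine Integrable.mono h ((measurable_pi_apply i).mul
      (measurable_weight β n m)).aestronglyMeasurable ?_
    filter_upwards [ae_mem_orderedSimplex m] with x hx
    rw [norm_mul, Real.norm_eq_abs, abs_of_nonneg (hx.2.1 i)]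
    exact mul_le_of_le_one_left (norm_nonneg _) (le_one_of_mem_orderedSimplex hx i)
  · have hnn : 0 ≤ᵐ[(hyperplaneMeasure m).restrict (orderedSimplex m)] weight β n m := by
      filter_upwards [ae_mem_orderedSimplex m] with x hx using weight_nonneg hx.2.1
    rw [zetaDen, integral_eq_lintegral_of_nonneg_ae hnn
      (measurable_weight β n m).aestronglyMeasurable]
    obtain ⟨h0, ht⟩ := lintegral_simplex_weight hβ hm hmn
    exact ENNReal.toReal_pos h0 ht

end SimplexDecomposition

end

/-! ### Power sums, ordered vectors and measurability of eigenvalues -/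

noncomputable section

section Eigenvalues

variable {m : ℕ}

/-- A nonincreasing vector is determined by its power sums. -/
theorem eq_of_powerSums_eq {x y : Fin m → ℝ} (hx : Antitone x) (hy : Antitone y)
    (h : ∀ k : ℕ, ∑ i, x i ^ k = ∑ i, y i ^ k) : x = y := by
  have hpoly : ∀ q : Polynomial ℝ, ∑ i, q.eval (x i) = ∑ i, q.eval (y i) := by
    intro q
    simp_rw [Polynomial.eval_eq_sum_range]
    rw [Finset.sum_comm, Finset.sum_comm (s := Finset.univ (α := Fin m))]
    refine Finset.sum_congr rfl fun k _ => ?_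
    rw [← Finset.mul_sum, ← Finset.mul_sum, h]
  have hcount : Multiset.map x Finset.univ.val = Multiset.map y Finset.univ.val := by
    refine Multiset.ext.2 fun c => ?_
    have hc : ∀ z : Fin m → ℝ, ((Multiset.map z Finset.univ.val).count c : ℝ)
        = ∑ i, if z i = c then 1 else 0 := by
      intro z
      rw [Multiset.count_map, Finset.sum_boole]
      simp [Finset.card_def, Finset.filter_val, eq_comm]
    -- A polynomial equal to 1 at c and to 0 at all other values of x and y turns equal power sums
    -- into equal multiplicities of c.
    set s : Finset ℝ := insert c (Finset.univ.image x ∪ Finset.univ.image y) with hs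
    have he := fun t (ht : t ∈ s) => Lagrange.eval_interpolate_at_node
      (s := s) (v := id) (fun t : ℝ => if t = c then (1 : ℝ) else 0) (Set.injOn_id _) ht
    have hq := hpoly (Lagrange.interpolate s id fun t : ℝ => if t = c then (1 : ℝ) else 0)
    have ex : ∀ i, (Lagrange.interpolate s id fun t : ℝ => if t = c then (1 : ℝ) else 0).eval (x i)
        = if x i = c then 1 else 0 := fun i => he (x i) (by simp [hs])
    have ey : ∀ i, (Lagrange.interpolate s id fun t : ℝ => if t = c then (1 : ℝ) else 0).eval (y i)
        = if y i = c then 1 else 0 := fun i => he (y i) (by simp [hs])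
    simp_rw [ex, ey] at hq
    rw [← hc, ← hc] at hq
    exact_mod_cast hq
  rw [Fin.univ_val_map, Fin.univ_val_map, Multiset.coe_eq_coe] at hcount
  refine List.ofFn_injective (hcount.eq_of_pairwise' (r := (· ≥ ·)) ?_ ?_)
  · exact List.sortedGE_iff_pairwise.1 hx.sortedGE_ofFn
  · exact List.sortedGE_iff_pairwise.1 hy.sortedGE_ofFn

/-- The power sums as continuous functions on the ordered simplex. -/
def simplexPowerSums (m : ℕ) : MvPolynomial ℕ ℝ →ₐ[ℝ] C(orderedSimplex m, ℝ) :=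
  MvPolynomial.aeval fun k => ⟨fun x => ∑ i, x.1 i ^ k,
    continuous_finsetSum _ fun i _ => ((continuous_apply i).comp continuous_subtype_val).pow k⟩

theorem simplexPowerSums_apply (q : MvPolynomial ℕ ℝ) (x : orderedSimplex m) :
    simplexPowerSums m q x = MvPolynomial.eval x.1 (powerSums m q) := by
  rw [eval_powerSums, simplexPowerSums, ← MvPolynomial.aeval_eq_eval]
  change ContinuousMap.evalAlgHom ℝ ℝ x _ = _
  rw [MvPolynomial.comp_aeval_apply]
  rfl

theorem isCompact_orderedSimplex (m : ℕ) : IsCompact (orderedSimplex m) := by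
  refine (isCompact_univ_pi fun _ : Fin m => isCompact_Icc (a := (0 : ℝ)) (b := 1)).of_isClosed_subset
    (isClosed_orderedSimplex m) fun x hx => ?_
  exact fun j _ => ⟨hx.2.1 j, le_one_of_mem_orderedSimplex hx j⟩

theorem integrable_of_ae_mem_orderedSimplex {μ : Measure (Fin m → ℝ)} [IsFiniteMeasure μ]
    (hμ : ∀ᵐ x ∂μ, x ∈ orderedSimplex m) {f : (Fin m → ℝ) → ℝ} (hf : Continuous f) :
    Integrable f μ := by
  obtain ⟨C, hC⟩ := (isCompact_orderedSimplex m).exists_bound_of_continuousOn hf.continuousOn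
  exact Integrable.of_bound hf.aestronglyMeasurable C (hμ.mono hC)

/-- Two finite measures on the ordered simplex with the same integrals of symmetric polynomials have
the same barycentre. -/
theorem integral_coord_eq_of_powerSums {μ₁ μ₂ : Measure (Fin m → ℝ)} [IsFiniteMeasure μ₁]
    [IsFiniteMeasure μ₂] (h₁ : ∀ᵐ x ∂μ₁, x ∈ orderedSimplex m)
    (h₂ : ∀ᵐ x ∂μ₂, x ∈ orderedSimplex m)
    (h : ∀ q, ∫ x, MvPolynomial.eval x (powerSums m q) ∂μ₁
      = ∫ x, MvPolynomial.eval x (powerSums m q) ∂μ₂) (i : Fin m) :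
    ∫ x, x i ∂μ₁ = ∫ x, x i ∂μ₂ := by
  have : CompactSpace (orderedSimplex m) := isCompact_iff_compactSpace.1 (isCompact_orderedSimplex m)
  have hsep : (simplexPowerSums m).range.SeparatesPoints := by
    intro x y hxy
    by_contra hcon
    push Not at hcon
    refine hxy (Subtype.ext (eq_of_powerSums_eq x.2.1 y.2.1 fun k => ?_))
    have := hcon _ ⟨simplexPowerSums m (MvPolynomial.X k), ⟨_, rfl⟩, rfl⟩
    simpa [simplexPowerSums] using this
  have hc : ∀ q, Continuous fun x : Fin m → ℝ => MvPolynomial.eval x (powerSums m q) :=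
    fun q => MvPolynomial.continuous_eval _
  have key : ∀ ε : ℝ, 0 < ε → |∫ x, x i ∂μ₁ - ∫ x, x i ∂μ₂|
      ≤ ε * (μ₁.real Set.univ + μ₂.real Set.univ) := by
    intro ε hε
    -- A single coordinate is not a symmetric polynomial. On ordered vectors it is nevertheless a
    -- continuous function, and Stone–Weierstrass approximates it uniformly by polynomials in the
    -- power sums.
    obtain ⟨⟨g, q, hq⟩, hg⟩ := ContinuousMap.exists_mem_subalgebra_near_continuousMap_of_separatesPoints
      _ hsep (⟨fun x => x.1 i, (continuous_apply i).comp continuous_subtype_val⟩ : C(orderedSimplex m, ℝ)) ε hε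
    have hb : ∀ x ∈ orderedSimplex m, ‖x i - MvPolynomial.eval x (powerSums m q)‖ ≤ ε := by
      intro x hx
      have := ContinuousMap.norm_coe_le_norm (g - ⟨fun x : orderedSimplex m => x.1 i,
        (continuous_apply i).comp continuous_subtype_val⟩)
        ⟨x, hx⟩
      rw [norm_sub_rev, ← simplexPowerSums_apply q ⟨x, hx⟩]
      refine le_trans ?_ (this.trans hg.le)
      rw [← hq]
      rfl
    have e1 := norm_integral_le_of_norm_le_const (h₁.mono hb)
    have e2 := norm_integral_le_of_norm_le_const (h₂.mono hb)
    rw [integral_sub (integrable_of_ae_mem_orderedSimplex h₁ (by fun_prop)) (integrable_of_ae_mem_orderedSimplex h₁ (hc q)), Real.norm_eq_abs] at e1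
    rw [integral_sub (integrable_of_ae_mem_orderedSimplex h₂ (by fun_prop)) (integrable_of_ae_mem_orderedSimplex h₂ (hc q)), Real.norm_eq_abs, ← h] at e2
    rw [abs_le] at *
    constructor <;> linarith [e1.1, e1.2, e2.1, e2.2]
  refine eq_of_abs_sub_eq_zero (le_antisymm (le_of_forall_pos_le_add fun δ hδ => ?_) (abs_nonneg _))
  set M := μ₁.real Set.univ + μ₂.real Set.univ with hM
  have hM0 : 0 ≤ M := by positivity
  refine (key (δ / (M + 1)) (by positivity)).trans ?_
  rw [zero_add, div_mul_eq_mul_div, div_le_iff₀ (by positivity)]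
  nlinarith

variable {𝕜 : Type*} [RCLike 𝕜]

theorem eig_antitone (A : Matrix (Fin m) (Fin m) 𝕜) : Antitone (eig A) := by
  intro i j hij
  unfold eig
  split_ifs with h
  · exact h.eigenvalues₀_antitone (by simpa using hij)
  · exact le_rfl

theorem sum_eig_eq {A : Matrix (Fin m) (Fin m) 𝕜} (hA : A.IsHermitian) (f : ℝ → ℝ) :
    ∑ i, f (eig A i) = ∑ i, f (hA.eigenvalues i) := by
  simp only [eig, dif_pos hA, Matrix.IsHermitian.eigenvalues]
  exact Fintype.sum_equiv
    ((finCongr (Fintype.card_fin m).symm).trans (Fintype.equivOfCardEq (Fintype.card_fin _)))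
    _ _ (fun i => by simp)

theorem trace_pow_eq {A : Matrix (Fin m) (Fin m) 𝕜} (hA : A.IsHermitian) (k : ℕ) :
    (A ^ k).trace = ((∑ i, eig A i ^ k : ℝ) : 𝕜) := by
  rw [sum_eig_eq hA fun t => t ^ k]
  conv_lhs => rw [hA.spectral_theorem]
  rw [← map_pow, Unitary.conjStarAlgAut_apply, Matrix.trace_mul_comm, ← mul_assoc,
    Unitary.coe_star_mul_self, one_mul, Matrix.diagonal_pow, Matrix.trace_diagonal]
  simp

open scoped ComplexOrder in
theorem eig_nonneg {A : Matrix (Fin m) (Fin m) 𝕜} (hA : A.PosSemidef) (i : Fin m) : 0 ≤ eig A i := by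
  have h := hA.eigenvalues_nonneg (Fintype.equivOfCardEq (Fintype.card_fin _)
    (Fin.cast (Fintype.card_fin m).symm i))
  simpa [eig, dif_pos hA.1, Matrix.IsHermitian.eigenvalues] using h

variable [MeasurableSpace 𝕜] [BorelSpace 𝕜]

theorem borelSpace_matrix (ι κ : Type*) [Countable ι] [Countable κ] : BorelSpace (Matrix ι κ 𝕜) :=
  inferInstanceAs (BorelSpace (ι → κ → 𝕜))

/-- The nonincreasing vectors form a closed set. -/
theorem isClosed_antitone : IsClosed {x : Fin m → ℝ | Antitone x} := by
  have h : {x : Fin m → ℝ | Antitone x} = ⋂ i, ⋂ j, ⋂ _ : i ≤ j, {x | x j ≤ x i} := by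
    ext x
    simp [Antitone]
  rw [h]
  exact isClosed_iInter fun i => isClosed_iInter fun j => isClosed_iInter fun _ =>
    isClosed_le (by fun_prop) (by fun_prop)

/-- The power sums embed the Polish space of ordered vectors continuously and injectively into the
sequences, hence as a measurable embedding. Composed with `eig` they are traces of powers on the
Hermitian matrices, which are continuous, so `eig` is measurable. -/
theorem measurable_eig : Measurable fun A : Matrix (Fin m) (Fin m) 𝕜 => eig A := by
  have := borelSpace_matrix (𝕜 := 𝕜) (Fin m) (Fin m)
  have : PolishSpace {x : Fin m → ℝ | Antitone x} := isClosed_antitone.polishSpace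
  set Φ : {x : Fin m → ℝ | Antitone x} → ℕ → ℝ := fun x k => ∑ i, x.1 i ^ k with hΦ
  have hemb : MeasurableEmbedding Φ := by
    refine Continuous.measurableEmbedding (continuous_pi fun k => continuous_finsetSum _ fun i _ =>
      ((continuous_apply i).comp continuous_subtype_val).pow k) fun x y hxy => ?_
    exact Subtype.ext (eq_of_powerSums_eq x.2 y.2 fun k => congrFun hxy k)
  set e : Matrix (Fin m) (Fin m) 𝕜 → {x : Fin m → ℝ | Antitone x} :=
    fun A => ⟨eig A, eig_antitone A⟩ with he
  have hΦe : Measurable (Φ ∘ e) := by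
    refine measurable_pi_lambda _ fun k => ?_
    classical
    have hk : (fun A => (Φ ∘ e) A k) = fun A : Matrix (Fin m) (Fin m) 𝕜 =>
        if A.IsHermitian then RCLike.re ((A ^ k).trace) else ∑ _i : Fin m, (0 : ℝ) ^ k := by
      funext A
      split_ifs with h
      · rw [trace_pow_eq h, RCLike.ofReal_re]
        rfl
      · simp only [hΦ, he, Function.comp_apply, eig, dif_neg h]
    rw [hk]
    refine Measurable.ite ?_ ?_ measurable_const
    · exact (isClosed_eq (by fun_prop) continuous_id :
        IsClosed {A : Matrix (Fin m) (Fin m) 𝕜 | Aᴴ = A}).measurableSet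
    · exact (RCLike.continuous_re.comp
        ((continuous_id.pow k).matrix_trace)).measurable
  exact measurable_subtype_coe.comp ((hemb.measurable_comp_iff).1 hΦe)

end Eigenvalues

end

/-! ### Independence of the norm from scale invariant functions -/

noncomputable section

section Radial

open scoped ENNReal

/-- A finite product of measures with densities has the product density. -/
theorem pi_withDensity_ofReal {ι E : Type*} [Fintype ι] [MeasurableSpace E] {κ : Measure E}
    [SigmaFinite κ] {g : E → ℝ} (hg : Integrable g κ) (h0 : ∀ x, 0 ≤ g x) :
    Measure.pi (fun _ : ι => κ.withDensity fun x => ENNReal.ofReal (g x))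
      = (Measure.pi fun _ : ι => κ).withDensity fun x => ENNReal.ofReal (∏ i, g (x i)) := by
  have : IsFiniteMeasure (κ.withDensity fun x => ENNReal.ofReal (g x)) :=
    isFiniteMeasure_withDensity_ofReal hg.2
  refine Measure.pi_eq fun s hs => ?_
  rw [withDensity_apply _ (MeasurableSet.univ_pi hs), ← lintegral_indicator (MeasurableSet.univ_pi hs)]
  have h1 : ∀ x : ι → E, (Set.univ.pi s).indicator (fun x => ENNReal.ofReal (∏ i, g (x i))) x
      = ENNReal.ofReal (∏ i, (s i).indicator g (x i)) := by
    intro x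
    by_cases hx : x ∈ Set.univ.pi s
    · rw [Set.indicator_of_mem hx]
      congr 1
      exact Finset.prod_congr rfl fun i _ => (Set.indicator_of_mem (hx i trivial) _).symm
    · rw [Set.indicator_of_notMem hx]
      simp only [Set.mem_pi, Set.mem_univ, true_implies, not_forall] at hx
      obtain ⟨i, hi⟩ := hx
      rw [Finset.prod_eq_zero (Finset.mem_univ i) (Set.indicator_of_notMem hi _),
        ENNReal.ofReal_zero]
  simp_rw [h1]
  have hi : ∀ i, Integrable ((s i).indicator g) κ := fun i => hg.indicator (hs i)
  have hn : ∀ i x, 0 ≤ (s i).indicator g x := fun i x => Set.indicator_nonneg (fun x _ => h0 x) x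
  rw [← ofReal_integral_eq_lintegral_ofReal (Integrable.fintype_prod hi)
    (ae_of_all _ fun x => Finset.prod_nonneg fun i _ => hn i _), integral_fintype_prod_eq_prod,
    ENNReal.ofReal_prod_of_nonneg fun i _ => integral_nonneg (hn i)]
  refine Finset.prod_congr rfl fun i _ => ?_
  rw [ofReal_integral_eq_lintegral_ofReal (hi i) (ae_of_all _ (hn i)), withDensity_apply _ (hs i),
    ← lintegral_indicator (hs i)]
  refine lintegral_congr fun x => ?_
  by_cases hx : x ∈ s i <;> simp [hx]

variable {E : Type*} [NormedAddCommGroup E] [NormedSpace ℝ E] [MeasurableSpace E] [BorelSpace E]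
  [FiniteDimensional ℝ E] [Nontrivial E] {Λ : Measure E} [Λ.IsAddHaarMeasure]

theorem lintegral_haar_smul {r : ℝ} (hr : 0 < r) {f : E → ℝ≥0∞} (hf : Measurable f) :
    ∫⁻ x, f x ∂Λ = ENNReal.ofReal (r ^ Module.finrank ℝ E) * ∫⁻ x, f (r • x) ∂Λ := by
  have h := Measure.map_addHaar_smul Λ hr.ne'
  rw [← lintegral_map (f := f) hf (measurable_const_smul r), h, lintegral_smul_measure, smul_eq_mul,
    ← mul_assoc, ← ENNReal.ofReal_mul (by positivity),
    abs_of_pos (by positivity), mul_inv_cancel₀ (by positivity), ENNReal.ofReal_one, one_mul]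

/-- A scale invariant function integrates independently of a homogeneous gauge `T`. -/
theorem exists_lintegral_eq_mul_of_scale_invariant {T : E → ℝ} (hTm : Measurable T)
    (hTs : ∀ (r : ℝ) x, T (r • x) = r ^ 2 * T x) (hTn : ∀ x, ‖x‖ ^ 2 ≤ T x)
    {F : E → ℝ≥0∞} (hFm : Measurable F) (hFs : ∀ (r : ℝ) x, 0 < r → F (r • x) = F x) {C : ℝ≥0∞}
    (hC : C ≠ ∞) (hF : ∀ x, F x ≤ C) :
    ∃ c : ℝ≥0∞, ∀ g : ℝ → ℝ≥0∞, Measurable g →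
      ∫⁻ x, g (T x) * F x ∂Λ = c * ∫⁻ x, g (T x) ∂Λ := by
  have hfin : ∀ s : ℝ, Λ {x | T x ≤ s} ≠ ∞ := by
    intro s
    refine ((measure_mono fun x hx => ?_).trans_lt
      (measure_closedBall_lt_top (μ := Λ) (x := 0) (r := √s))).ne
    rw [mem_closedBall_zero_iff]
    exact Real.le_sqrt_of_sq_le ((hTn x).trans hx)
  set M : (E → ℝ≥0∞) → Measure ℝ := fun F => (Λ.withDensity F).map T with hM
  have hMapp : ∀ F : E → ℝ≥0∞, ∀ s : Set ℝ, MeasurableSet s →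
      M F s = ∫⁻ x in T ⁻¹' s, F x ∂Λ := by
    intro F s hs
    rw [hM]
    simp only
    rw [Measure.map_apply hTm hs, withDensity_apply _ (hTm hs)]
  have hMfin : ∀ F : E → ℝ≥0∞, ∀ C ≠ ∞, (∀ x, F x ≤ C) → ∀ s, M F (Set.Iic s) ≠ ∞ := by
    intro F C hC hF s
    rw [hMapp F _ measurableSet_Iic]
    refine ((lintegral_mono hF).trans_lt ?_).ne
    rw [setLIntegral_const]
    exact ENNReal.mul_lt_top hC.lt_top (hfin s).lt_top
  -- The dilation by √s carries {T ≤ 1} onto {T ≤ s} and preserves F. So the mass of {T ≤ s} has the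
  -- same growth for every invariant F and is fixed by its value at s = 1.
  have hscale : ∀ F : E → ℝ≥0∞, Measurable F → (∀ (r : ℝ) x, 0 < r → F (r • x) = F x) →
      ∀ s : ℝ, 0 < s → M F (Set.Iic s)
        = ENNReal.ofReal (√s ^ Module.finrank ℝ E) * M F (Set.Iic 1) := by
    intro F hFm hFs s hs
    have hr := Real.sqrt_pos.2 hs
    have hmeas : ∀ s, MeasurableSet (T ⁻¹' Set.Iic s) := fun s => hTm measurableSet_Iic
    rw [hMapp F _ measurableSet_Iic, hMapp F _ measurableSet_Iic, ← lintegral_indicator (hmeas s),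
      ← lintegral_indicator (hmeas 1), lintegral_haar_smul hr (hFm.indicator (hmeas s))]
    congr 1
    refine lintegral_congr fun x => ?_
    have hiff : √s • x ∈ T ⁻¹' Set.Iic s ↔ x ∈ T ⁻¹' Set.Iic 1 := by
      rw [Set.mem_preimage, Set.mem_preimage, hTs, Real.sq_sqrt hs.le, Set.mem_Iic, Set.mem_Iic]
      exact mul_le_iff_le_one_right hs
    by_cases hx : x ∈ T ⁻¹' Set.Iic 1
    · rw [Set.indicator_of_mem hx, Set.indicator_of_mem (hiff.2 hx), hFs _ _ hr]
    · rw [Set.indicator_of_notMem hx, Set.indicator_of_notMem (mt hiff.1 hx)]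
  -- Such a sublevel set lies in {0}, a null set because the space is nontrivial.
  have hzero : ∀ F : E → ℝ≥0∞, ∀ s : ℝ, s ≤ 0 → M F (Set.Iic s) = 0 := by
    intro F s hs
    rw [hMapp F _ measurableSet_Iic]
    refine setLIntegral_measure_zero _ _ (measure_mono_null (t := {0}) (fun x hx => ?_)
      (measure_singleton _))
    have h1 : T x ≤ s := hx
    have h2 : ‖x‖ ^ 2 ≤ 0 := (hTn x).trans (h1.trans hs)
    have h3 : ‖x‖ = 0 := by
      have := sq_nonneg ‖x‖
      exact pow_eq_zero_iff two_ne_zero |>.1 (le_antisymm h2 this)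
    simpa using h3
  set one : E → ℝ≥0∞ := fun _ => 1 with hone
  have hone_le : M F (Set.Iic 1) ≤ C * M one (Set.Iic 1) := by
    rw [hMapp F _ measurableSet_Iic, hMapp one _ measurableSet_Iic, hone, ← lintegral_const_mul' _ _ hC]
    exact lintegral_mono fun x => by simpa using hF x
  set c := M F (Set.Iic 1) / M one (Set.Iic 1) with hc
  have hone_fin := hMfin one 1 ENNReal.one_ne_top (fun _ => le_rfl)
  -- Should the denominator of c vanish, the numerator vanishes as well, since F is bounded.
  have hc1 : M F (Set.Iic 1) = c * M one (Set.Iic 1) := by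
    rw [hc, ENNReal.div_mul_cancel' (fun h => ?_) (fun h => absurd h (hone_fin 1))]
    rw [h, mul_zero] at hone_le
    exact le_antisymm hone_le zero_le
  have hIic : ∀ s, M F (Set.Iic s) = (c • M one) (Set.Iic s) := by
    intro s
    rw [Measure.smul_apply, smul_eq_mul]
    rcases le_or_gt s 0 with hs | hs
    · rw [hzero F s hs, hzero one s hs, mul_zero]
    · rw [hscale F hFm hFs s hs, hscale one measurable_const (fun _ _ _ => rfl) s hs, hc1]
      ring
  have hFfin := hMfin F C hC hF
  have hEq : M F = c • M one := by
    refine Measure.ext_of_Ioc' _ _ (fun a b _ => ?_) fun a b hab => ?_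
    · exact ((measure_mono Set.Ioc_subset_Iic_self).trans_lt (hFfin b).lt_top).ne
    · have hset : Set.Ioc a b = Set.Iic b \ Set.Iic a := by
        ext t
        simp [and_comm]
      rw [hset, measure_sdiff (Set.Iic_subset_Iic.2 hab.le)
        measurableSet_Iic.nullMeasurableSet (hFfin a), measure_sdiff (Set.Iic_subset_Iic.2 hab.le)
        measurableSet_Iic.nullMeasurableSet (hIic a ▸ hFfin a), hIic, hIic]
  refine ⟨c, fun g hg => ?_⟩
  have hMint : ∀ F : E → ℝ≥0∞, Measurable F → ∫⁻ t, g t ∂M F = ∫⁻ x, g (T x) * F x ∂Λ := by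
    intro F hF
    rw [hM]
    simp only
    have hgT : Measurable fun x => g (T x) := hg.comp hTm
    rw [lintegral_map hg hTm, lintegral_withDensity_eq_lintegral_mul _ hF hgT]
    exact lintegral_congr fun x => mul_comm _ _
  rw [← hMint F hFm, hEq, lintegral_smul_measure, hMint one measurable_const, smul_eq_mul]
  simp [hone]

/-- Under a law with a density depending only on the gauge, the gauge is independent of scale
invariant functions. -/
theorem lintegral_mul_eq_of_scale_invariant {T : E → ℝ} (hTm : Measurable T)
    (hTs : ∀ (r : ℝ) x, T (r • x) = r ^ 2 * T x) (hTn : ∀ x, ‖x‖ ^ 2 ≤ T x) {h : ℝ → ℝ≥0∞}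
    (hh : Measurable h) {γ : Measure E} [IsProbabilityMeasure γ]
    (hγ : γ = Λ.withDensity fun x => h (T x))
    {F : E → ℝ≥0∞} (hFm : Measurable F) (hFs : ∀ (r : ℝ) x, 0 < r → F (r • x) = F x) {C : ℝ≥0∞}
    (hC : C ≠ ∞) (hF : ∀ x, F x ≤ C) {g : ℝ → ℝ≥0∞} (hg : Measurable g) :
    ∫⁻ x, g (T x) * F x ∂γ = (∫⁻ x, g (T x) ∂γ) * ∫⁻ x, F x ∂γ := by
  obtain ⟨c, hc⟩ := exists_lintegral_eq_mul_of_scale_invariant (Λ := Λ) hTm hTs hTn hFm hFs hC hF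
  have key : ∀ g : ℝ → ℝ≥0∞, Measurable g → ∫⁻ x, g (T x) * F x ∂γ = c * ∫⁻ x, g (T x) ∂γ := by
    intro g hg
    have hhT : Measurable fun x => h (T x) := hh.comp hTm
    have hgT : Measurable fun x => g (T x) := hg.comp hTm
    have hgF : Measurable fun x => g (T x) * F x := hgT.mul hFm
    rw [hγ, lintegral_withDensity_eq_lintegral_mul _ hhT hgF,
      lintegral_withDensity_eq_lintegral_mul _ hhT hgT]
    -- The density is itself a function of T and is absorbed into the test function.
    have := hc (fun t => h t * g t) (hh.mul hg)
    simp only [Pi.mul_apply]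
    simp_rw [← mul_assoc]
    exact this
  -- The test function 1 identifies the constant c as the mean of F.
  have h1 := key (fun _ => 1) measurable_const
  simp only [one_mul, lintegral_const, measure_univ, mul_one] at h1
  rw [key g hg, h1, mul_comm]

end Radial

end

/-! ### Gram matrices and eigenvalue shares -/

noncomputable section

section Gram

variable {𝕜 : Type*} [RCLike 𝕜] {n m : ℕ}

/-- The Gram matrix of the columns of `H`. -/
def gram (H : Fin n → Fin m → 𝕜) : Matrix (Fin m) (Fin m) 𝕜 := (Matrix.of H)ᴴ * Matrix.of H

/-- The squared Frobenius norm. -/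
def frobSq (H : Fin n → Fin m → 𝕜) : ℝ := ∑ i, ∑ a, ‖H i a‖ ^ 2

open scoped ComplexOrder in
theorem posSemidef_gram (H : Fin n → Fin m → 𝕜) : (gram H).PosSemidef :=
  Matrix.posSemidef_conjTranspose_mul_self _

theorem isHermitian_gram (H : Fin n → Fin m → 𝕜) : (gram H).IsHermitian :=
  (posSemidef_gram H).1

theorem eig_gram_mem_orderedCone (H : Fin n → Fin m → 𝕜) : eig (gram H) ∈ orderedCone m :=
  ⟨eig_antitone _, eig_nonneg (posSemidef_gram H)⟩

theorem trace_gram (H : Fin n → Fin m → 𝕜) : (gram H).trace = ((frobSq H : ℝ) : 𝕜) := by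
  simp only [gram, frobSq, Matrix.trace, Matrix.diag, Matrix.mul_apply, Matrix.conjTranspose_apply,
    Matrix.of_apply]
  rw [Finset.sum_comm]
  push_cast
  refine Finset.sum_congr rfl fun i _ => Finset.sum_congr rfl fun a _ => ?_
  exact RCLike.conj_mul _

theorem eigSum_gram (H : Fin n → Fin m → 𝕜) : eigSum (gram H) = frobSq H := by
  have := eigSum_eq_trace _ (isHermitian_gram H)
  rw [trace_gram] at this
  exact_mod_cast this

theorem sum_eig_gram (H : Fin n → Fin m → 𝕜) : ∑ i, eig (gram H) i = frobSq H := eigSum_gram H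

theorem frobSq_nonneg (H : Fin n → Fin m → 𝕜) : 0 ≤ frobSq H := by
  unfold frobSq
  positivity

theorem continuous_frobSq : Continuous (frobSq : (Fin n → Fin m → 𝕜) → ℝ) := by
  unfold frobSq
  fun_prop

theorem frobSq_smul (r : ℝ) (H : Fin n → Fin m → 𝕜) : frobSq (r • H) = r ^ 2 * frobSq H := by
  simp [frobSq, Finset.mul_sum, norm_smul, mul_pow]

theorem norm_sq_le_frobSq (H : Fin n → Fin m → 𝕜) : ‖H‖ ^ 2 ≤ frobSq H := by
  have h : ‖H‖ ≤ √(frobSq H) := by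
    refine (pi_norm_le_iff_of_nonneg (Real.sqrt_nonneg _)).2 fun i =>
      (pi_norm_le_iff_of_nonneg (Real.sqrt_nonneg _)).2 fun a => Real.le_sqrt_of_sq_le ?_
    refine (Finset.single_le_sum (f := fun a => ‖H i a‖ ^ 2) (fun a _ => by positivity)
      (Finset.mem_univ a)).trans ?_
    exact Finset.single_le_sum (f := fun i => ∑ a, ‖H i a‖ ^ 2) (fun i _ => by positivity)
      (Finset.mem_univ i)
  calc ‖H‖ ^ 2 ≤ √(frobSq H) ^ 2 := by gcongr
    _ = frobSq H := Real.sq_sqrt (frobSq_nonneg H)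

theorem frobSq_pos {H : Fin n → Fin m → 𝕜} (hH : H ≠ 0) : 0 < frobSq H :=
  lt_of_lt_of_le (by positivity) (norm_sq_le_frobSq H)

/-- Both vectors are ordered and have the same power sums, read off from traces of powers. -/
theorem eig_gram_smul {r : ℝ} (H : Fin n → Fin m → 𝕜) :
    eig (gram (r • H)) = r ^ 2 • eig (gram H) := by
  have hg : gram (r • H) = r ^ 2 • gram H := by
    ext a b
    simp only [gram, Matrix.mul_apply, Matrix.conjTranspose_apply, Matrix.of_apply, Pi.smul_apply,
      Matrix.smul_apply, Finset.smul_sum, RCLike.real_smul_eq_coe_mul, star_mul', RCLike.star_def,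
      RCLike.conj_ofReal]
    refine Finset.sum_congr rfl fun i _ => ?_
    push_cast
    ring
  refine eq_of_powerSums_eq (eig_antitone _) ((eig_antitone _).const_mul (sq_nonneg r)) fun k => ?_
  have h1 := trace_pow_eq (isHermitian_gram (r • H)) k
  have h2 := trace_pow_eq (isHermitian_gram H) k
  rw [hg, smul_pow, Matrix.trace_smul, h2, RCLike.real_smul_eq_coe_mul, ← hg] at h1
  have h3 : ∑ i, eig (gram (r • H)) i ^ k = (r ^ 2) ^ k * ∑ i, eig (gram H) i ^ k := by
    exact_mod_cast h1.symm
  rw [h3, Finset.mul_sum]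
  exact Finset.sum_congr rfl fun i _ => by simp [mul_pow]

/-- The eigenvalues of the Gram matrix divided by their sum. -/
def eigShare (H : Fin n → Fin m → 𝕜) : Fin m → ℝ := (frobSq H)⁻¹ • eig (gram H)

theorem eigShare_smul {r : ℝ} (hr : 0 < r) (H : Fin n → Fin m → 𝕜) :
    eigShare (r • H) = eigShare H := by
  rw [eigShare, eig_gram_smul, frobSq_smul, smul_smul, eigShare]
  congr 1
  field_simp

/-- This also holds when the norm is 0: the eigenvalues are nonnegative with sum 0, so all of them
vanish. -/
theorem frobSq_smul_eigShare (H : Fin n → Fin m → 𝕜) : frobSq H • eigShare H = eig (gram H) := by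
  rcases eq_or_ne (frobSq H) 0 with h | h
  · rw [h, zero_smul]
    have hs := sum_eig_gram H
    rw [h, Finset.sum_eq_zero_iff_of_nonneg fun i _ => eig_nonneg (posSemidef_gram H) i] at hs
    exact funext fun i => (hs i (Finset.mem_univ i)).symm
  · rw [eigShare, smul_smul, mul_inv_cancel₀ h, one_smul]

theorem eigShare_nonneg (H : Fin n → Fin m → 𝕜) (i : Fin m) : 0 ≤ eigShare H i :=
  mul_nonneg (inv_nonneg.2 (frobSq_nonneg H)) (eig_nonneg (posSemidef_gram H) i)

theorem eigShare_mem_orderedSimplex {H : Fin n → Fin m → 𝕜} (hH : H ≠ 0) :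
    eigShare H ∈ orderedSimplex m := by
  refine ⟨(eig_antitone _).const_mul (inv_nonneg.2 (frobSq_nonneg H)), eigShare_nonneg H, ?_⟩
  simp only [eigShare, Pi.smul_apply, smul_eq_mul, ← Finset.mul_sum, sum_eig_gram]
  exact inv_mul_cancel₀ (frobSq_pos hH).ne'

theorem eigShare_le_one (H : Fin n → Fin m → 𝕜) (i : Fin m) : eigShare H i ≤ 1 := by
  by_cases hH : H = 0
  · have : frobSq H = 0 := by simp [hH, frobSq]
    simp [eigShare, this]
  · exact le_one_of_mem_orderedSimplex (eigShare_mem_orderedSimplex hH) i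

theorem eval_powerSums_listMon (x : Fin m → ℝ) (l : List ℕ) :
    MvPolynomial.eval x (powerSums m (listMon l)) = (l.map fun k => ∑ i, x i ^ k).prod := by
  rw [eval_powerSums, listMon, map_list_prod, List.map_map]
  congr 2
  funext k
  simp

theorem eval_powerSums_listMon_smul (t : ℝ) (x : Fin m → ℝ) (l : List ℕ) :
    MvPolynomial.eval (t • x) (powerSums m (listMon l))
      = t ^ l.sum * MvPolynomial.eval x (powerSums m (listMon l)) := by
  simp only [eval_powerSums_listMon]
  induction l with
  | nil => simp
  | cons k l ih =>
    have h : ∑ i, (t • x) i ^ k = t ^ k * ∑ i, x i ^ k := by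
      simp only [Pi.smul_apply, smul_eq_mul, mul_pow, ← Finset.mul_sum]
    rw [List.map_cons, List.prod_cons, ih, h, List.map_cons, List.prod_cons, List.sum_cons, pow_add]
    ring

theorem eval_powerSums_listMon_nonneg {x : Fin m → ℝ} (hx : ∀ i, 0 ≤ x i) (l : List ℕ) :
    0 ≤ MvPolynomial.eval x (powerSums m (listMon l)) := by
  rw [eval_powerSums_listMon]
  refine List.prod_nonneg fun a ha => ?_
  obtain ⟨k, -, rfl⟩ := List.mem_map.1 ha
  exact Finset.sum_nonneg fun i _ => pow_nonneg (hx i) k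

/-- Supplies the boundedness of functions of the shares required by the independence statement. -/
theorem eval_powerSums_listMon_le {x : Fin m → ℝ} (hx : ∀ i, 0 ≤ x i) (hx1 : ∀ i, x i ≤ 1)
    (l : List ℕ) : MvPolynomial.eval x (powerSums m (listMon l)) ≤ m ^ l.length := by
  rw [eval_powerSums_listMon]
  induction l with
  | nil => simp
  | cons k l ih =>
    rw [List.map_cons, List.prod_cons, List.length_cons, pow_succ']
    refine mul_le_mul ?_ ih ?_ (Nat.cast_nonneg m)
    · refine (Finset.sum_le_sum fun i _ => pow_le_one₀ (n := k) (hx i) (hx1 i)).trans ?_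
      simp
    · rw [← eval_powerSums_listMon]
      exact eval_powerSums_listMon_nonneg hx l

variable [MeasurableSpace 𝕜] [BorelSpace 𝕜]

theorem measurable_gram : Measurable (gram : (Fin n → Fin m → 𝕜) → _) := by
  have := borelSpace_matrix (𝕜 := 𝕜) (Fin m) (Fin m)
  have h : Continuous fun H : Fin n → Fin m → 𝕜 => Matrix.of H := continuous_id
  exact (h.matrix_conjTranspose.matrix_mul h).measurable

theorem measurable_eig_gram :
    Measurable fun H : Fin n → Fin m → 𝕜 => eig (gram H) :=
  measurable_eig.comp measurable_gram

theorem measurable_eigShare : Measurable (eigShare : (Fin n → Fin m → 𝕜) → _) := by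
  have h : Measurable (frobSq : (Fin n → Fin m → 𝕜) → ℝ) := continuous_frobSq.measurable
  exact h.inv.smul measurable_eig_gram

end Gram

end

/-! ### Matching the moments of the two laws -/

noncomputable section

section Moments

open scoped ENNReal
open MvPolynomial

variable {m : ℕ}

/-- Finite measures on the ordered simplex which integrate the products of power sums equally have
the same barycentre. -/
theorem integral_coord_eq_of_listMon {μ₁ μ₂ : Measure (Fin m → ℝ)} [IsFiniteMeasure μ₁]
    [IsFiniteMeasure μ₂] (h₁ : ∀ᵐ x ∂μ₁, x ∈ orderedSimplex m)
    (h₂ : ∀ᵐ x ∂μ₂, x ∈ orderedSimplex m)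
    (h : ∀ l, ∫⁻ x, ENNReal.ofReal (eval x (powerSums m (listMon l))) ∂μ₁
      = ∫⁻ x, ENNReal.ofReal (eval x (powerSums m (listMon l))) ∂μ₂) (i : Fin m) :
    ∫ x, x i ∂μ₁ = ∫ x, x i ∂μ₂ := by
  have hc : ∀ q, Continuous fun x : Fin m → ℝ => eval x (powerSums m q) :=
    fun q => MvPolynomial.continuous_eval _
  refine integral_coord_eq_of_powerSums h₁ h₂ (fun q => ?_) i
  let M : ∀ (μ : Measure (Fin m → ℝ)) [IsFiniteMeasure μ], (∀ᵐ x ∂μ, x ∈ orderedSimplex m) →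
      (MvPolynomial ℕ ℝ →ₗ[ℝ] ℝ) := fun μ _ hμ =>
    { toFun := fun q => ∫ x, eval x (powerSums m q) ∂μ
      map_add' := fun p q => by
        simp only [map_add]
        exact integral_add (integrable_of_ae_mem_orderedSimplex hμ (hc p))
          (integrable_of_ae_mem_orderedSimplex hμ (hc q))
      map_smul' := fun c p => by
        simp only [map_smul, smul_eval, RingHom.id_apply, smul_eq_mul]
        exact integral_const_mul _ _ }
  have hpos : ∀ {μ : Measure (Fin m → ℝ)}, (∀ᵐ x ∂μ, x ∈ orderedSimplex m) → ∀ l,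
      ∫ x, eval x (powerSums m (listMon l)) ∂μ
        = (∫⁻ x, ENNReal.ofReal (eval x (powerSums m (listMon l))) ∂μ).toReal := fun hμ l =>
    integral_eq_lintegral_of_nonneg_ae
      (hμ.mono fun x hx => eval_powerSums_listMon_nonneg hx.2.1 l)
      (hc _).aestronglyMeasurable
  have : M μ₁ h₁ = M μ₂ h₂ := linearMap_ext_listMon fun l => by
    change ∫ x, eval x (powerSums m (listMon l)) ∂μ₁ = ∫ x, eval x (powerSums m (listMon l)) ∂μ₂
    rw [hpos h₁, hpos h₂, h]
  exact congrArg (fun L => L q) this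

variable {𝕜 : Type*} [RCLike 𝕜] {n : ℕ} [MeasurableSpace 𝕜] [BorelSpace 𝕜] {ν : Measure 𝕜} {β : ℝ}

/-- The law of an `n × m` array with i.i.d. entries. -/
def entriesLaw (ν : Measure 𝕜) (n m : ℕ) : Measure (Fin n → Fin m → 𝕜) :=
  Measure.pi fun _ : Fin n => Measure.pi fun _ : Fin m => ν

theorem aeval_trace_gram (H : Fin n → Fin m → 𝕜) (q : MvPolynomial ℕ ℝ) :
    aeval (fun l => (gram H ^ l).trace) q
      = ((eval (eig (gram H)) (powerSums m q) : ℝ) : 𝕜) := by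
  have : (fun l => (gram H ^ l).trace)
      = algebraMap ℝ 𝕜 ∘ fun l => ∑ i, eig (gram H) i ^ l := by
    funext l
    exact trace_pow_eq (isHermitian_gram H) l
  rw [this, MvPolynomial.aeval_algebraMap_apply, eval_powerSums, ← MvPolynomial.aeval_eq_eval]

theorem GaussianEntry.ofReal_integrable (hν : GaussianEntry ν β) (q : MvPolynomial ℕ ℝ) :
    Integrable (fun H => ((eval (eig (gram H)) (powerSums m q) : ℝ) : 𝕜)) (entriesLaw ν n m) := by
  refine (hν.integrable_entryEval
    (aeval (fun l => ((formalAdjoint 𝕜 n m * formalEntries 𝕜 n m) ^ l).trace) q)).congr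
    (ae_of_all _ fun H => ?_)
  rw [entryEval_aeval_trace]
  exact aeval_trace_gram H q

theorem GaussianEntry.integrable_eig_gram (hν : GaussianEntry ν β) (q : MvPolynomial ℕ ℝ) :
    Integrable (fun H => eval (eig (gram H)) (powerSums m q)) (entriesLaw ν n m) := by
  simpa using (hν.ofReal_integrable q).re

theorem GaussianEntry.isProbabilityMeasure (hν : GaussianEntry ν β) (n m : ℕ) :
    IsProbabilityMeasure (entriesLaw ν n m) := by
  have := hν.prob
  unfold entriesLaw
  infer_instance

theorem coneIntegral_one_pos {α a β : ℝ} (hα : -1 < α) (ha : 0 < a) (hβ : 1 ≤ β) (m : ℕ) :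
    0 < coneIntegral hα ha hβ m 1 := by
  have hint := integrable_eval_mul_coneDensity (m := m) hα ha hβ 1
  have h := lintegral_coneDensity_pos α a β (by linarith) m
  simp only [map_one, one_mul] at hint
  have h2 : coneIntegral hα ha hβ m 1 = ∫ x : Fin m → ℝ, coneDensity α a β x := by
    simp [coneIntegral]
  rw [h2, ← ENNReal.ofReal_pos, ofReal_integral_eq_lintegral_ofReal hint
    (ae_of_all _ fun x => coneDensity_nonneg _ _ _ _)]
  exact h

/-- The joint eigenvalue moments of a Gram matrix are those of the density on the cone. -/
theorem GaussianEntry.exists_integral_eq (hν : GaussianEntry ν β) (hmn : m ≤ n) :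
    ∃ z : ℝ, 0 < z ∧ ∀ q, ∫ H, eval (eig (gram H)) (powerSums m q) ∂entriesLaw ν n m
      = z * ∫ x, eval x (powerSums m q) * coneDensity (weightExponent β n m) (β / 2) β x := by
  have hβ := hν.one_le
  have := hν.isProbabilityMeasure n m
  have ha : 0 < β / 2 := by linarith
  have hα := neg_one_lt_weightExponent (β := β) (by linarith) hmn
  have hZ := coneIntegral_one_pos hα ha hβ m
  refine ⟨(coneIntegral hα ha hβ m 1)⁻¹, inv_pos.2 hZ, fun q => ?_⟩
  have h₁ := hν.loopEquations (n := n) (m := m)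
  have h₂ := (coneIntegral_loopEquations (d := (n : ℝ) - m) hα hβ ha rfl m).comp
    ((coneIntegral hα ha hβ m 1)⁻¹ • (Algebra.linearMap ℝ 𝕜))
  have hval : ∀ q, (hν.expect n m ∘ₗ (aeval fun l =>
      ((formalAdjoint 𝕜 n m * formalEntries 𝕜 n m) ^ l).trace :
        MvPolynomial ℕ ℝ →ₐ[ℝ] _).toLinearMap) q
      = ((∫ H, eval (eig (gram H)) (powerSums m q) ∂entriesLaw ν n m : ℝ) : 𝕜) := by
    intro q
    rw [← integral_ofReal]
    refine integral_congr_ae (ae_of_all _ fun H => ?_)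
    rw [AlgHom.toLinearMap_apply]
    simp only
    rw [entryEval_aeval_trace]
    exact aeval_trace_gram H q
  -- Both functionals are normalised to take the value 1 at 1: the first is an expectation, the
  -- second is divided by its total mass.
  have h := h₁.unique h₂ (by
    rw [hval]
    simp [hZ.ne'])
  have hq := congrArg (fun L => L q) h
  simp only [hval] at hq
  have : ((∫ H, eval (eig (gram H)) (powerSums m q) ∂entriesLaw ν n m : ℝ) : 𝕜)
    = (((coneIntegral hα ha hβ m 1)⁻¹ * coneIntegral hα ha hβ m q : ℝ) : 𝕜) := by
    rw [hq]
    simp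
  exact_mod_cast this

/-- Products of power sums are nonnegative on the cone, so the equality of moments can be stated for
lower Lebesgue integrals, the setting of the homogeneity and independence results. -/
theorem GaussianEntry.exists_lintegral_eq (hν : GaussianEntry ν β) (hmn : m ≤ n) :
    ∃ z : ℝ≥0∞, z ≠ 0 ∧ z ≠ ∞ ∧ ∀ l,
      ∫⁻ H, ENNReal.ofReal (eval (eig (gram H)) (powerSums m (listMon l))) ∂entriesLaw ν n m
      = z * ∫⁻ x, ENNReal.ofReal (eval x (powerSums m (listMon l))) *
          ENNReal.ofReal (coneDensity (weightExponent β n m) (β / 2) β x) := by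
  have hβ := hν.one_le
  have ha : 0 < β / 2 := by linarith
  have hα := neg_one_lt_weightExponent (β := β) (by linarith) hmn
  obtain ⟨z, hz, h⟩ := hν.exists_integral_eq hmn
  refine ⟨ENNReal.ofReal z, by simpa using hz, ENNReal.ofReal_ne_top, fun l => ?_⟩
  rw [← ofReal_integral_eq_lintegral_ofReal (hν.integrable_eig_gram _)
    (ae_of_all _ fun H => eval_powerSums_listMon_nonneg (eig_gram_mem_orderedCone H).2 l), h,
    ENNReal.ofReal_mul hz.le, ofReal_integral_eq_lintegral_ofReal
      (integrable_eval_mul_coneDensity hα ha hβ _)]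
  · congr 1
    exact lintegral_congr fun x => ENNReal.ofReal_mul' (coneDensity_nonneg _ _ _ _)
  · filter_upwards [ae_ne_zero m] with x hx
    by_cases hc : x ∈ orderedCone m
    · exact mul_nonneg (eval_powerSums_listMon_nonneg hc.2 l) (coneDensity_nonneg _ _ _ _)
    · rw [coneDensity_eq (by linarith) n m _ hx, Set.indicator_of_notMem hc, mul_zero]
      exact le_rfl

/-- The Gaussian law has a density which is a function of the Frobenius norm. -/
theorem GaussianEntry.exists_density (hν : GaussianEntry ν β) (n m : ℕ) :
    ∃ Λ : Measure (Fin n → Fin m → 𝕜), Λ.IsAddHaarMeasure ∧ ∃ C : ℝ, 0 < C ∧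
      entriesLaw ν n m
        = Λ.withDensity fun H => ENNReal.ofReal (C * Real.exp (-(β / 2 * frobSq H))) := by
  obtain ⟨κ, hκ, c, hc, hd⟩ := hν.density
  have := hν.prob
  set g : 𝕜 → ℝ := fun z => c * Real.exp (-(β / 2 * ‖z‖ ^ 2)) with hg
  have hg0 : ∀ z, 0 ≤ g z := fun z => by positivity
  have hgm : Measurable g := by fun_prop
  have hgi : Integrable g κ := by
    refine ⟨hgm.aestronglyMeasurable, ?_⟩
    rw [hasFiniteIntegral_iff_ofReal (ae_of_all _ hg0), ← setLIntegral_univ,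
      ← withDensity_apply _ MeasurableSet.univ, ← hd]
    exact measure_lt_top _ _
  have h1 : (Measure.pi fun _ : Fin m => κ).IsAddHaarMeasure := inferInstance
  have h2 : (Measure.pi fun _ : Fin n => Measure.pi fun _ : Fin m => κ).IsAddHaarMeasure :=
    Measure.pi.isAddHaarMeasure _
  refine ⟨_, h2, (c ^ m) ^ n, by positivity, ?_⟩
  rw [entriesLaw, hd, pi_withDensity_ofReal hgi hg0, pi_withDensity_ofReal
    (g := fun h : Fin m → 𝕜 => ∏ a, g (h a)) (Integrable.fintype_prod fun _ => hgi)
    fun h => Finset.prod_nonneg fun a _ => hg0 _]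
  congr 1
  funext H
  congr 1
  simp only [hg, Finset.prod_mul_distrib, Finset.prod_const, ← Real.exp_sum, Finset.card_univ,
    Fintype.card_fin, frobSq, Finset.mul_sum, Finset.sum_neg_distrib]

end Moments

end

/-! ### The law of the eigenvalue shares -/

noncomputable section

section EigenvalueShares

open scoped ENNReal
open MvPolynomial

variable {𝕜 : Type*} [RCLike 𝕜] {n m : ℕ} [MeasurableSpace 𝕜] [BorelSpace 𝕜] {ν : Measure 𝕜} {β : ℝ}

theorem nontrivial_entries (hm : 0 < m) (hmn : m ≤ n) : Nontrivial (Fin n → Fin m → 𝕜) := by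
  have : Nonempty (Fin m) := ⟨⟨0, hm⟩⟩
  have : Nonempty (Fin n) := ⟨⟨0, by omega⟩⟩
  infer_instance

theorem haar_singleton {E : Type*} [NormedAddCommGroup E] [NormedSpace ℝ E] [MeasurableSpace E]
    [BorelSpace E] [FiniteDimensional ℝ E] [Nontrivial E] (Λ : Measure E) [Λ.IsAddHaarMeasure]
    (x : E) : Λ {x} = 0 := measure_singleton x

/-- The Frobenius norm of a Gaussian matrix is independent of its scale invariant functions. -/
theorem GaussianEntry.lintegral_frobSq_mul (hν : GaussianEntry ν β) (hm : 0 < m) (hmn : m ≤ n)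
    {F : (Fin n → Fin m → 𝕜) → ℝ≥0∞} (hFm : Measurable F)
    (hFs : ∀ (r : ℝ) H, 0 < r → F (r • H) = F H) {C : ℝ≥0∞} (hC : C ≠ ∞) (hF : ∀ H, F H ≤ C)
    {g : ℝ → ℝ≥0∞} (hg : Measurable g) :
    ∫⁻ H, g (frobSq H) * F H ∂entriesLaw ν n m
      = (∫⁻ H, g (frobSq H) ∂entriesLaw ν n m) * ∫⁻ H, F H ∂entriesLaw ν n m := by
  have := hν.isProbabilityMeasure n m
  have := nontrivial_entries (𝕜 := 𝕜) hm hmn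
  obtain ⟨Λ, hΛ, K, -, hd⟩ := hν.exists_density n m
  have hh : Measurable fun t : ℝ => ENNReal.ofReal (K * Real.exp (-(β / 2 * t))) := by fun_prop
  exact lintegral_mul_eq_of_scale_invariant (E := Fin n → Fin m → 𝕜) (Λ := Λ) (T := frobSq)
    (F := F) (C := C) (g := g) continuous_frobSq.measurable frobSq_smul norm_sq_le_frobSq hh hd hFm
    hFs hC hF hg

theorem GaussianEntry.ae_ne_zero (hν : GaussianEntry ν β) (hm : 0 < m) (hmn : m ≤ n) :
    ∀ᵐ H ∂entriesLaw ν n m, H ≠ 0 := by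
  have := nontrivial_entries (𝕜 := 𝕜) hm hmn
  obtain ⟨Λ, hΛ, K, -, hd⟩ := hν.exists_density n m
  have h : ∀ᵐ H ∂Λ, H ≠ 0 := by
    rw [ae_iff]
    simpa using haar_singleton Λ 0
  rw [hd]
  exact (withDensity_absolutelyContinuous Λ _).ae_le h

theorem GaussianEntry.measure_pos_of_isOpen (hν : GaussianEntry ν β) {U : Set (Fin n → Fin m → 𝕜)}
    (hU : IsOpen U) (hne : U.Nonempty) : 0 < entriesLaw ν n m U := by
  obtain ⟨Λ, hΛ, K, hK, hd⟩ := hν.exists_density n m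
  have hf : Measurable fun H : Fin n → Fin m → 𝕜 =>
      ENNReal.ofReal (K * Real.exp (-(β / 2 * frobSq H))) := by
    have : Measurable (frobSq : (Fin n → Fin m → 𝕜) → ℝ) := continuous_frobSq.measurable
    fun_prop
  rw [pos_iff_ne_zero, hd]
  intro h0
  refine (hU.measure_pos Λ hne).ne' (withDensity_absolutelyContinuous' hf.aemeasurable
    (ae_of_all _ fun H => ?_) h0)
  have : 0 < K * Real.exp (-(β / 2 * frobSq H)) := by positivity
  simpa using this

/-- Joint moments of the eigenvalue shares. -/
theorem GaussianEntry.lintegral_eigShare (hν : GaussianEntry ν β) (hm : 0 < m) (hmn : m ≤ n)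
    (l : List ℕ) :
    (∫⁻ x in orderedSimplex m, ENNReal.ofReal (weight β n m x) ∂hyperplaneMeasure m) *
      ∫⁻ H, ENNReal.ofReal (eval (eigShare H) (powerSums m (listMon l))) ∂entriesLaw ν n m
    = ∫⁻ x in orderedSimplex m, ENNReal.ofReal (eval x (powerSums m (listMon l))) *
        ENNReal.ofReal (weight β n m x) ∂hyperplaneMeasure m := by
  have hβ := hν.one_le
  have := hν.isProbabilityMeasure n m
  have ha : 0 < β / 2 := by linarith
  have hα := neg_one_lt_weightExponent (β := β) (by linarith) hmn
  obtain ⟨z, hz0, hzt, hz⟩ := hν.exists_lintegral_eq hmn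
  obtain ⟨c, hc0, hct, hc⟩ := lintegral_coneDensity_of_homogeneous (by linarith) hm hα ha l.sum
  have hpm : ∀ l, Measurable fun x : Fin m → ℝ =>
      ENNReal.ofReal (eval x (powerSums m (listMon l))) := fun l =>
    (MvPolynomial.continuous_eval _).measurable.ennreal_ofReal
  have hmom : ∀ l', l'.sum = l.sum →
      ∫⁻ H, ENNReal.ofReal (eval (eig (gram H)) (powerSums m (listMon l'))) ∂entriesLaw ν n m
      = z * (c * ∫⁻ x in orderedSimplex m, ENNReal.ofReal (eval x (powerSums m (listMon l'))) *
        ENNReal.ofReal (weight β n m x) ∂hyperplaneMeasure m) := by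
    intro l' hl'
    rw [hz, hc _ (hpm l')]
    intro t x ht _
    rw [eval_powerSums_listMon_smul, hl', ENNReal.ofReal_mul (by positivity)]
  have h1 := hmom l rfl
  -- The constant c depends only on the degree. Comparing with p_1^{|l|} = T^{|l|}, which is 1 on
  -- the simplex, gives the radial moment with the same factor z · c, which then cancels.
  have h2 := hmom (List.replicate l.sum 1) (by simp)
  have hrep : ∀ x : Fin m → ℝ, eval x (powerSums m (listMon (List.replicate l.sum 1)))
      = (∑ i, x i) ^ l.sum := fun x => by
    rw [eval_powerSums_listMon]
    simp
  have h3 : ∫⁻ x in orderedSimplex m, ENNReal.ofReal (eval x (powerSums m (listMon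
        (List.replicate l.sum 1)))) * ENNReal.ofReal (weight β n m x) ∂hyperplaneMeasure m
      = ∫⁻ x in orderedSimplex m, ENNReal.ofReal (weight β n m x) ∂hyperplaneMeasure m := by
    refine lintegral_congr_ae ?_
    filter_upwards [ae_mem_orderedSimplex m] with x hx
    rw [hrep, hx.2.2]
    simp
  rw [h3] at h2
  simp only [hrep, sum_eig_gram] at h2
  have h4 := hν.lintegral_frobSq_mul hm hmn
    (F := fun H => ENNReal.ofReal (eval (eigShare H) (powerSums m (listMon l))))
    ((hpm l).comp measurable_eigShare) (fun r H hr => by rw [eigShare_smul hr])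
    (C := ENNReal.ofReal (m ^ l.length)) ENNReal.ofReal_ne_top
    (fun H => ENNReal.ofReal_le_ofReal
      (eval_powerSums_listMon_le (eigShare_nonneg H) (eigShare_le_one H) l))
    (g := fun t => ENNReal.ofReal (t ^ l.sum)) (by fun_prop)
  have h5 : ∀ H : Fin n → Fin m → 𝕜, ENNReal.ofReal (frobSq H ^ l.sum) *
      ENNReal.ofReal (eval (eigShare H) (powerSums m (listMon l)))
      = ENNReal.ofReal (eval (eig (gram H)) (powerSums m (listMon l))) := fun H => by
    rw [← ENNReal.ofReal_mul (pow_nonneg (frobSq_nonneg H) _), ← eval_powerSums_listMon_smul,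
      frobSq_smul_eigShare]
  simp only [h5] at h4
  rw [h1, h2, ← mul_assoc, ← mul_assoc, mul_assoc (z * c)] at h4
  have hzc : z * c ≠ 0 := mul_ne_zero hz0 hc0
  have hzc' : z * c ≠ ∞ := ENNReal.mul_ne_top hzt hct
  exact ((ENNReal.mul_right_inj hzc hzc').1 h4).symm

/-- The mean share of the `i`-th eigenvalue. -/
theorem GaussianEntry.integral_eigShare (hν : GaussianEntry ν β) (hmn : m ≤ n) (i : Fin m) :
    ∫ H, eigShare H i ∂entriesLaw ν n m = zeta β n m i := by
  have hm : 0 < m := i.pos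
  have hβ := hν.one_le
  have := hν.isProbabilityMeasure n m
  set K := ∫⁻ x in orderedSimplex m, ENNReal.ofReal (weight β n m x) ∂hyperplaneMeasure m with hK
  obtain ⟨hK0, hKt⟩ := lintegral_simplex_weight hβ hm hmn
  have hwm := (measurable_weight β n m).ennreal_ofReal
  have hw0 : ∀ᵐ x ∂(hyperplaneMeasure m).restrict (orderedSimplex m), 0 ≤ weight β n m x := by
    filter_upwards [ae_mem_orderedSimplex m] with x hx using weight_nonneg hx.2.1
  have hden : zetaDen β n m = K.toReal :=
    integral_eq_lintegral_of_nonneg_ae hw0 (measurable_weight β n m).aestronglyMeasurable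
  -- Scaling the law of the shares by the total weight K gives it the mass of the unnormalised
  -- weight measure, so that no division occurs before the final ratio.
  set μ₁ : Measure (Fin m → ℝ) := K • (entriesLaw ν n m).map eigShare with hμ₁
  set μ₂ : Measure (Fin m → ℝ) := ((hyperplaneMeasure m).restrict (orderedSimplex m)).withDensity
    fun x => ENNReal.ofReal (weight β n m x) with hμ₂
  have : IsProbabilityMeasure ((entriesLaw ν n m).map eigShare) :=
    Measure.isProbabilityMeasure_map measurable_eigShare.aemeasurable
  have : IsFiniteMeasure μ₁ := Measure.smul_finite _ hKt
  have : IsFiniteMeasure μ₂ := isFiniteMeasure_withDensity hKt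
  have h := integral_coord_eq_of_listMon (μ₁ := μ₁) (μ₂ := μ₂) ?_ ?_ (fun l => ?_) i
  · rw [hμ₁, integral_smul_measure, integral_map measurable_eigShare.aemeasurable
      (measurable_pi_apply i).aestronglyMeasurable, hμ₂, integral_withDensity_eq_integral_toReal_smul hwm
      (ae_of_all _ fun x => ENNReal.ofReal_lt_top)] at h
    have hnum : ∫ x in orderedSimplex m, (ENNReal.ofReal (weight β n m x)).toReal • x i
        ∂hyperplaneMeasure m = zetaNum β n m i := by
      refine integral_congr_ae ?_
      filter_upwards [hw0] with x hx
      rw [ENNReal.toReal_ofReal hx, smul_eq_mul, mul_comm]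
    rw [hnum] at h
    rw [zeta, ← h, hden, smul_eq_mul, mul_div_cancel_left₀]
    exact (ENNReal.toReal_pos hK0 hKt).ne'
  · refine Measure.ae_smul_measure ?_ K
    refine (ae_map_iff measurable_eigShare.aemeasurable
      (isClosed_orderedSimplex m).measurableSet).2 ?_
    exact (hν.ae_ne_zero hm hmn).mono fun H hH => eigShare_mem_orderedSimplex hH
  · exact (withDensity_absolutelyContinuous _ _).ae_le (ae_mem_orderedSimplex m)
  · have hpm : Measurable fun x : Fin m → ℝ =>
        ENNReal.ofReal (eval x (powerSums m (listMon l))) :=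
      (MvPolynomial.continuous_eval _).measurable.ennreal_ofReal
    rw [hμ₁, lintegral_smul_measure, lintegral_map hpm measurable_eigShare, smul_eq_mul,
      hν.lintegral_eigShare hm hmn l, hμ₂, lintegral_withDensity_eq_lintegral_mul _ hwm hpm]
    exact lintegral_congr fun x => mul_comm _ _

theorem GaussianEntry.zeta_nonneg (hν : GaussianEntry ν β) (hmn : m ≤ n) (i : Fin m) :
    0 ≤ zeta β n m i := by
  rw [← hν.integral_eigShare hmn i]
  exact integral_nonneg fun H => eigShare_nonneg H i

/-- The trace of the Gram matrix against its `i`-th eigenvalue. -/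
theorem GaussianEntry.lintegral_mul_eig (hν : GaussianEntry ν β) (hmn : m ≤ n) (i : Fin m)
    {g : ℝ → ℝ≥0∞} (hg : Measurable g) :
    ∫⁻ H, g (eigSum (gram H)) * ENNReal.ofReal (eig (gram H) i) ∂entriesLaw ν n m
      = ENNReal.ofReal (zeta β n m i) *
        ∫⁻ H, g (eigSum (gram H)) * ENNReal.ofReal (eigSum (gram H)) ∂entriesLaw ν n m := by
  have hm : 0 < m := i.pos
  have := hν.isProbabilityMeasure n m
  have hsm : Measurable fun H : Fin n → Fin m → 𝕜 => eigShare H i :=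
    (measurable_pi_apply i).comp measurable_eigShare
  -- Since λ_i is T times its share, the radial test function is g(t) · t.
  have h := hν.lintegral_frobSq_mul hm hmn (F := fun H => ENNReal.ofReal (eigShare H i))
    hsm.ennreal_ofReal (fun r H hr => by rw [eigShare_smul hr]) ENNReal.one_ne_top
    (fun H => by simpa using ENNReal.ofReal_le_ofReal (eigShare_le_one H i))
    (g := fun t => g t * ENNReal.ofReal t) (by fun_prop)
  have h1 : ∫⁻ H, ENNReal.ofReal (eigShare H i) ∂entriesLaw ν n m
      = ENNReal.ofReal (zeta β n m i) := by
    rw [← hν.integral_eigShare hmn i, ofReal_integral_eq_lintegral_ofReal _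
      (ae_of_all _ fun H => eigShare_nonneg H i)]
    refine Integrable.of_bound hsm.aestronglyMeasurable 1 (ae_of_all _ fun H => ?_)
    rw [Real.norm_eq_abs, abs_of_nonneg (eigShare_nonneg H i)]
    exact eigShare_le_one H i
  rw [h1, mul_comm] at h
  simp only [eigSum_gram]
  rw [← h]
  refine lintegral_congr fun H => ?_
  rw [mul_assoc, ← ENNReal.ofReal_mul (frobSq_nonneg H), ← frobSq_smul_eigShare]
  rfl

theorem GaussianEntry.integrable_eigSum (hν : GaussianEntry ν β) :
    Integrable (fun H => eigSum (gram H)) (entriesLaw ν n m) := by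
  refine (hν.integrable_eig_gram (X 1)).congr (ae_of_all _ fun H => ?_)
  simp [eval_powerSums, eigSum]

/-- The set is open, and a nonzero matrix rescaled so that its squared norm is exactly c belongs to
it; nonempty open sets are charged because the density is positive. -/
theorem GaussianEntry.measure_eigSum_near_pos (hν : GaussianEntry ν β) (hm : 0 < m) (hmn : m ≤ n)
    {c ε : ℝ} (hc : 0 < c) (hε : 0 < ε) :
    0 < entriesLaw ν n m {H | |eigSum (gram H) - c| < ε} := by
  have := nontrivial_entries (𝕜 := 𝕜) hm hmn
  obtain ⟨H, hH⟩ := exists_ne (0 : Fin n → Fin m → 𝕜)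
  simp only [eigSum_gram]
  refine hν.measure_pos_of_isOpen
    (isOpen_lt (continuous_frobSq.sub continuous_const).abs continuous_const)
    ⟨√(c / frobSq H) • H, ?_⟩
  have h := frobSq_pos hH
  rw [Set.mem_ofPred_eq, frobSq_smul, Real.sq_sqrt (by positivity), div_mul_cancel₀ _ h.ne']
  simpa using hε

end EigenvalueShares

/-! ### From the weighted identity to conditional expectations -/

section Conditioning

open scoped ENNReal

variable {Ω : Type*} [MeasurableSpace Ω] {μ : Measure Ω} {X T : Ω → ℝ} {ζ : ℝ}

theorem integrable_of_lintegral_mul (hX : Measurable X) (hX0 : 0 ≤ᵐ[μ] X) (hTi : Integrable T μ)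
    (hT0 : 0 ≤ᵐ[μ] T)
    (h : ∀ g : ℝ → ℝ≥0∞, Measurable g → ∫⁻ ω, g (T ω) * ENNReal.ofReal (X ω) ∂μ
      = ENNReal.ofReal ζ * ∫⁻ ω, g (T ω) * ENNReal.ofReal (T ω) ∂μ) : Integrable X μ := by
  refine ⟨hX.aestronglyMeasurable, ?_⟩
  rw [hasFiniteIntegral_iff_ofReal hX0]
  have h1 := h (fun _ => 1) measurable_const
  simp only [one_mul] at h1
  rw [h1]
  exact ENNReal.mul_lt_top ENNReal.ofReal_lt_top
    ((hasFiniteIntegral_iff_ofReal hT0).1 hTi.2)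

theorem setIntegral_eq_of_lintegral_mul (hX : Measurable X) (hX0 : 0 ≤ᵐ[μ] X)
    (hT : Measurable T) (hT0 : 0 ≤ᵐ[μ] T) (hζ : 0 ≤ ζ)
    (h : ∀ g : ℝ → ℝ≥0∞, Measurable g → ∫⁻ ω, g (T ω) * ENNReal.ofReal (X ω) ∂μ
      = ENNReal.ofReal ζ * ∫⁻ ω, g (T ω) * ENNReal.ofReal (T ω) ∂μ) {B : Set ℝ}
    (hB : MeasurableSet B) : ∫ ω in T ⁻¹' B, X ω ∂μ = ζ * ∫ ω in T ⁻¹' B, T ω ∂μ := by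
  rw [integral_eq_lintegral_of_nonneg_ae (ae_restrict_of_ae hX0) hX.aestronglyMeasurable,
    integral_eq_lintegral_of_nonneg_ae (ae_restrict_of_ae hT0) hT.aestronglyMeasurable,
    ← ENNReal.toReal_ofReal hζ, ← ENNReal.toReal_mul]
  have key : ∀ Y : Ω → ℝ, ∫⁻ ω in T ⁻¹' B, ENNReal.ofReal (Y ω) ∂μ
      = ∫⁻ ω, B.indicator 1 (T ω) * ENNReal.ofReal (Y ω) ∂μ := by
    intro Y
    rw [← lintegral_indicator (hT hB)]
    refine lintegral_congr fun ω => ?_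
    by_cases hω : T ω ∈ B
    · rw [Set.indicator_of_mem (show ω ∈ T ⁻¹' B from hω), Set.indicator_of_mem hω, Pi.one_apply,
        one_mul]
    · rw [Set.indicator_of_notMem (show ω ∉ T ⁻¹' B from hω), Set.indicator_of_notMem hω, zero_mul]
  rw [key X, key T, h _ (measurable_one.indicator hB)]

theorem condExp_eq_of_setIntegral [IsFiniteMeasure μ] (hXi : Integrable X μ) (hT : Measurable T) (hTi : Integrable T μ)
    (h : ∀ B : Set ℝ, MeasurableSet B → ∫ ω in T ⁻¹' B, X ω ∂μ = ζ * ∫ ω in T ⁻¹' B, T ω ∂μ) :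
    μ[X | MeasurableSpace.comap T inferInstance] =ᵐ[μ] fun ω => ζ * T ω := by
  refine (ae_eq_condExp_of_forall_setIntegral_eq hT.comap_le hXi
    (fun s _ _ => (hTi.const_mul ζ).integrableOn) ?_ ?_).symm
  · rintro s ⟨B, hB, rfl⟩ -
    rw [h B hB, integral_const_mul]
  · exact ((comap_measurable T).const_mul ζ).aestronglyMeasurable

/-- Given |T - c| < ε, the mean of X is ζ times the mean of T, and the latter is within ε of c; the
error is therefore at most ζε. -/
theorem condMeanAt_of_setIntegral [IsFiniteMeasure μ] (hζ : 0 ≤ ζ) (hT : Measurable T)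
    (hTi : Integrable T μ) {c : ℝ}
    (h : ∀ B : Set ℝ, MeasurableSet B → ∫ ω in T ⁻¹' B, X ω ∂μ = ζ * ∫ ω in T ⁻¹' B, T ω ∂μ)
    (hpos : ∀ ε : ℝ, 0 < ε → 0 < μ {ω | |T ω - c| < ε}) : CondMeanAt μ X T c (ζ * c) := by
  refine ⟨hpos, ?_⟩
  have hbound : ∀ ε : ℝ, 0 < ε →
      |∫ ω, X ω ∂(cond μ {ω | |T ω - c| < ε}) - ζ * c| ≤ ζ * ε := by
    intro ε hε
    set B : Set ℝ := {t | |t - c| < ε}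
    have hB : MeasurableSet B := measurableSet_lt (by fun_prop) measurable_const
    have hs : {ω | |T ω - c| < ε} = T ⁻¹' B := rfl
    rw [hs]
    have hprob : IsProbabilityMeasure (cond μ (T ⁻¹' B)) := cond_isProbabilityMeasure (hpos ε hε).ne'
    have hX : ∫ ω, X ω ∂(cond μ (T ⁻¹' B)) = ζ * ∫ ω, T ω ∂(cond μ (T ⁻¹' B)) := by
      rw [ProbabilityTheory.cond, integral_smul_measure, integral_smul_measure, h B hB,
        smul_eq_mul, smul_eq_mul]
      ring
    have hTc : Integrable T (cond μ (T ⁻¹' B)) :=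
      hTi.restrict.smul_measure (ENNReal.inv_ne_top.2 (hpos ε hε).ne')
    have hae : ∀ᵐ ω ∂(cond μ (T ⁻¹' B)), ‖T ω - c‖ ≤ ε := by
      refine Measure.ae_smul_measure ?_ _
      filter_upwards [self_mem_ae_restrict (hT hB)] with ω hω
      exact le_of_lt hω
    have hm := norm_integral_le_of_norm_le_const hae
    rw [integral_sub hTc (integrable_const c), integral_const] at hm
    simp only [probReal_univ, one_smul, mul_one, Real.norm_eq_abs] at hm
    rw [hX, ← mul_sub, abs_mul, abs_of_nonneg hζ]
    exact mul_le_mul_of_nonneg_left hm hζ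
  rw [tendsto_iff_norm_sub_tendsto_zero]
  refine squeeze_zero' (g := fun ε => ζ * ε) (Eventually.of_forall fun _ => norm_nonneg _) ?_ ?_
  · filter_upwards [self_mem_nhdsWithin] with ε hε using hbound ε hε
  · have : Tendsto (fun ε : ℝ => ζ * ε) (𝓝 0) (𝓝 (ζ * 0)) := (continuous_const_mul ζ).tendsto 0
    rw [mul_zero] at this
    exact this.mono_left nhdsWithin_le_nhds

end Conditioning

/-! ### Transfer to a Wishart matrix on an arbitrary probability space -/

section Conclusion

open scoped ENNReal

variable {𝕜 : Type*} [RCLike 𝕜] {n m : ℕ} [MeasurableSpace 𝕜] [BorelSpace 𝕜] {ν : Measure 𝕜} {β : ℝ}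

theorem gramLaw_eq_map (ν : Measure 𝕜) (n m : ℕ) : gramLaw ν n m = (entriesLaw ν n m).map gram := by
  have := borelSpace_matrix (𝕜 := 𝕜) (Fin n) (Fin m)
  have := borelSpace_matrix (𝕜 := 𝕜) (Fin m) (Fin m)
  have h1 : Measurable fun H : Matrix (Fin n) (Fin m) 𝕜 => Hᴴ * H :=
    (continuous_id.matrix_conjTranspose.matrix_mul continuous_id).measurable
  have h2 : Measurable fun H : Fin n → Fin m → 𝕜 => Matrix.of H := measurable_id
  rw [gramLaw, iidEntries, Measure.map_map h1 h2]
  rfl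

theorem measurable_eigSum : Measurable fun A : Matrix (Fin m) (Fin m) 𝕜 => eigSum A :=
  Finset.measurable_sum _ fun i _ => (measurable_pi_apply i).comp measurable_eig

/-- The conditional mean of an eigenvalue of a Gram matrix of Gaussian entries given the trace. -/
theorem GaussianEntry.condMean_eig (hν : GaussianEntry ν β) {Ω : Type*} [MeasurableSpace Ω]
    {μ : Measure Ω} [IsProbabilityMeasure μ] (hmn : m ≤ n) (i : Fin m)
    {W : Ω → Matrix (Fin m) (Fin m) 𝕜} (hW : Measurable W) (hlaw : HasLaw W (gramLaw ν n m) μ) :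
    Integrable (fun ω => eig (W ω) i) μ ∧
    Measurable (fun ω => eigSum (W ω)) ∧
    μ[fun ω => eig (W ω) i | MeasurableSpace.comap (fun ω => eigSum (W ω)) inferInstance]
      =ᵐ[μ] (fun ω => zeta β n m i * eigSum (W ω)) ∧
    ∀ c : ℝ, 0 < c → CondMeanAt μ (fun ω => eig (W ω) i) (fun ω => eigSum (W ω)) c
      (zeta β n m i * c) := by
  have hmap : μ.map W = (entriesLaw ν n m).map gram := hlaw.map_eq.trans (gramLaw_eq_map ν n m)
  have hXm : Measurable fun A : Matrix (Fin m) (Fin m) 𝕜 => eig A i :=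
    (measurable_pi_apply i).comp measurable_eig
  have hTm : Measurable fun A : Matrix (Fin m) (Fin m) 𝕜 => eigSum A := measurable_eigSum
  have hT : Measurable fun ω => eigSum (W ω) := hTm.comp hW
  have hX : Measurable fun ω => eig (W ω) i := hXm.comp hW
  have hpsd : ∀ᵐ ω ∂μ, ∀ j, 0 ≤ eig (W ω) j := by
    have hs : MeasurableSet {A : Matrix (Fin m) (Fin m) 𝕜 | ∀ j, 0 ≤ eig A j} :=
      measurable_eig (isClosed_Ici (a := (0 : Fin m → ℝ))).measurableSet
    have h := (ae_map_iff measurable_gram.aemeasurable hs).2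
      (ae_of_all (entriesLaw ν n m) fun H => (eig_gram_mem_orderedCone H).2)
    rw [← hmap] at h
    exact (ae_map_iff hW.aemeasurable hs).1 h
  have hX0 : 0 ≤ᵐ[μ] fun ω => eig (W ω) i := hpsd.mono fun ω h => h i
  have hT0 : 0 ≤ᵐ[μ] fun ω => eigSum (W ω) := hpsd.mono fun ω h => Finset.sum_nonneg fun j _ => h j
  have hTi : Integrable (fun ω => eigSum (W ω)) μ := by
    have h := (integrable_map_measure (g := eigSum) hTm.aestronglyMeasurable
      measurable_gram.aemeasurable).2 (hν.integrable_eigSum (n := n) (m := m))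
    rw [← hmap] at h
    exact (integrable_map_measure hTm.aestronglyMeasurable hW.aemeasurable).1 h
  have htransfer : ∀ f : Matrix (Fin m) (Fin m) 𝕜 → ℝ≥0∞, Measurable f →
      ∫⁻ ω, f (W ω) ∂μ = ∫⁻ H, f (gram H) ∂entriesLaw ν n m := fun f hf => by
    rw [← lintegral_map hf hW, hmap, lintegral_map hf measurable_gram]
  have hmul : ∀ g : ℝ → ℝ≥0∞, Measurable g →
      ∫⁻ ω, g (eigSum (W ω)) * ENNReal.ofReal (eig (W ω) i) ∂μ
      = ENNReal.ofReal (zeta β n m i) *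
        ∫⁻ ω, g (eigSum (W ω)) * ENNReal.ofReal (eigSum (W ω)) ∂μ := fun g hg => by
    rw [htransfer (fun A => g (eigSum A) * ENNReal.ofReal (eig A i))
        ((hg.comp hTm).mul hXm.ennreal_ofReal),
      htransfer (fun A => g (eigSum A) * ENNReal.ofReal (eigSum A))
        ((hg.comp hTm).mul hTm.ennreal_ofReal), hν.lintegral_mul_eig hmn i hg]
  have hζ := hν.zeta_nonneg hmn i
  have hXi := integrable_of_lintegral_mul hX hX0 hTi hT0 hmul
  have hset := fun (B : Set ℝ) (hB : MeasurableSet B) =>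
    setIntegral_eq_of_lintegral_mul hX hX0 hT hT0 hζ hmul hB
  refine ⟨hXi, hT, condExp_eq_of_setIntegral hXi hT hTi hset, fun c hc =>
    condMeanAt_of_setIntegral hζ hT hTi hset fun ε hε => ?_⟩
  have hs : MeasurableSet {A : Matrix (Fin m) (Fin m) 𝕜 | |eigSum A - c| < ε} :=
    measurableSet_lt (continuous_abs.measurable.comp (hTm.sub_const c)) measurable_const
  have h := hν.measure_eigSum_near_pos i.pos hmn hc hε
  have h1 := Measure.map_apply (μ := μ) hW hs
  rw [hmap, Measure.map_apply measurable_gram hs] at h1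
  exact h1 ▸ h

end Conclusion

end

end Wishart

theorem proposition1 {Ω : Type*} [MeasurableSpace Ω] (μ : Measure Ω) [IsProbabilityMeasure μ]
    (n m : ℕ) (hmn : m ≤ n) (i : Fin m) :
    (Wishart.ZetaWellDefined 1 n m i ∧
      ∀ W : Ω → Matrix (Fin m) (Fin m) ℝ,
        Measurable W → HasLaw W (Wishart.realWishart n m) μ →
          Integrable (fun ω => Wishart.eig (W ω) i) μ ∧
          Measurable (fun ω => Wishart.eigSum (W ω)) ∧
          μ[fun ω => Wishart.eig (W ω) i |
              MeasurableSpace.comap (fun ω => Wishart.eigSum (W ω)) inferInstance]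
            =ᵐ[μ] (fun ω => Wishart.zeta 1 n m i * Wishart.eigSum (W ω)) ∧
          ∀ c : ℝ, 0 < c →
            Wishart.CondMeanAt μ (fun ω => Wishart.eig (W ω) i) (fun ω => Wishart.eigSum (W ω))
              c (Wishart.zeta 1 n m i * c)) ∧
    (Wishart.ZetaWellDefined 2 n m i ∧
      ∀ W : Ω → Matrix (Fin m) (Fin m) ℂ,
        Measurable W → HasLaw W (Wishart.complexWishart n m) μ →
          Integrable (fun ω => Wishart.eig (W ω) i) μ ∧
          Measurable (fun ω => Wishart.eigSum (W ω)) ∧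
          μ[fun ω => Wishart.eig (W ω) i |
              MeasurableSpace.comap (fun ω => Wishart.eigSum (W ω)) inferInstance]
            =ᵐ[μ] (fun ω => Wishart.zeta 2 n m i * Wishart.eigSum (W ω)) ∧
          ∀ c : ℝ, 0 < c →
            Wishart.CondMeanAt μ (fun ω => Wishart.eig (W ω) i) (fun ω => Wishart.eigSum (W ω))
              c (Wishart.zeta 2 n m i * c)) := by
  exact ⟨⟨Wishart.zetaWellDefined le_rfl hmn i, fun _ hW hlaw =>
      Wishart.gaussianEntry_real.condMean_eig hmn i hW hlaw⟩,
    Wishart.zetaWellDefined one_le_two hmn i, fun _ hW hlaw =>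
      Wishart.gaussianEntry_complex.condMean_eig hmn i hW hlaw⟩
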